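/- For a hypergraph $\mathcal H$ with finite vertex set $V(\mathcal H)$ write $v(\mathcal H)$ and $e(\mathcal H)$ for its numbers of vertices and edges, $\mathcal H[W]$ for the subhypergraph induced by $W\subseteq V(\mathcal H)$, and $\Delta_2(\mathcal H)=\max_{S\subseteq V(\mathcal H),\,|S|=2}|\{f\in\mathcal H: S\subseteq f\}|$. For $p\in(0,1]$ let $V_p(\mathcal H)$ be the random subset of $V(\mathcal H)$ in which each vertex is included independently with probability $p$, let $\mathcal H_p=\mathcal H[V_p(\mathcal H)]$, $X=e(\mathcal H_p)$ and $\mu=\mathbb E X$. For real $D,x$ let $\mathfrak X(\mathcal H,D,x)$ be the property that there is $W\subseteq V(\mathcal H)$ with $|W|\le D\max\{\sqrt x,1\}$ and $e(\mathcal H[W])\ge x$. Let $\varphi(x)=(1+x)\log(1+x)-x$. **Theorem.** Let $k\ge 3$ be an integer, $a>0$ and $D\ge 1$. There is $n_0>0$, depending only on $k,a,D$, such that for every $\gamma\in(0,1)$ there are $c,C,d>0$ and $\lambda\ge 1$, depending only on $\gamma,k,a,D$, such that the following holds for every integer $n\ge n_0$, every $k$-uniform hypergraph $\mathcal H$ with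 $v(\mathcal H)\le Dn$, $e(\mathcal H)\ge an^2$ and $\Delta_2(\mathcal H)\le D$, every $p\in(0,1]$ and every $t>0$. Put $\Lambda=\mu(1+np^{k-1})$. *Upper bound.* If one of (a) $p\notin\bigl(n^{-1/(k-1)-\gamma},\ \gamma n^{-1/(k-1)}(\log n)^{1/(k-1)}\bigr)$, or (b) $t\ge\gamma\min\{(\operatorname{Var}X)^{2/3},\mu^{2/3}\}(\log n)^{4/3}$, or (c) $t\ge\mu p^{(k-2)/3-\gamma}$ holds, then $$\mathbb P(X\ge\mu+t)\le(1+n^{-1})\exp\Bigl(-c\min\bigl\{\varphi(t/\mu)\mu^2/\Lambda,\ \sqrt t\log(e/p)\bigr\}\Bigr).$$ *Lower bound.* If one of (i) $p\le n^{-2/(k+1/3)}$, or (ii) $t\ge\min\{(\operatorname{Var}X)^{2/3},\mu^{2/3}\}(\log n)^{2/3}$ and $p\le n^{-1/(k-1)}\log n$, or (iii) $t\ge\min\{\sqrt{\operatorname{Var}X},\sqrt\Lambda\}$ and $\gamma n^{-1/(k-1)}\le p\le 1-\gamma$ holds, and if moreover $\mathfrak X(\mathcal H,D,\min\{\lambda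 t,\mu+t\})$ and $\mu+t\ge 1$ hold, then $$\mathbb P(X\ge\mu+t)\ge d\exp\Bigl(-C\min\bigl\{\varphi(t/\mu)\mu^2/\Lambda,\ \sqrt t\log(1/p)\bigr\}\Bigr).$$ -/

import Mathlib

open Real MeasureTheory ProbabilityTheory

open scoped Hypergraph

namespace Hypergraph

variable {α : Type*}

/-- `H` is `k`-uniform: every edge has exactly `k` vertices. -/
def IsUniform (H : Hypergraph α) (k : ℕ) : Prop :=
  ∀ e ∈ E(H), e.ncard = k

/-- `v(H)`, the number of vertices of `H`. -/
noncomputable def vertexCount (H : Hypergraph α) : ℕ :=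
  V(H).ncard

/-- `e(H)`, the number of edges of `H`. -/
noncomputable def edgeCount (H : Hypergraph α) : ℕ :=
  E(H).ncard

/-- `H[W]`, the subhypergraph of `H` induced by the vertex set `W`. -/
def induce (H : Hypergraph α) (W : Set α) : Hypergraph α where
  vertexSet := V(H) ∩ W
  edgeSet := {e | e ∈ E(H) ∧ e ⊆ W}
  subset_vertexSet_of_mem_edgeSet' := fun _ he =>
    Set.subset_inter (H.subset_vertexSet_of_mem_edgeSet' he.1) he.2

/-- `Δ_j(H)`, the maximum over all `j`-element sets `S` of vertices of the number of edges of `H`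
that contain `S` (for `j = 1, 2` the maximum degree and codegree). The supremum is a maximum when
the vertex set is finite. -/
noncomputable def maxDegree (H : Hypergraph α) (j : ℕ) : ℕ :=
  sSup {m : ℕ | ∃ S : Set α, S ⊆ V(H) ∧ S.ncard = j ∧ m = {f | f ∈ E(H) ∧ S ⊆ f}.ncard}

/-- The property `𝔛(H, D, x)`: at least `x` edges of `H` cluster on at most `D * max {√x, 1}`
vertices. -/
def ClusterProperty (H : Hypergraph α) (D x : ℝ) : Prop :=
  ∃ W : Set α, W ⊆ V(H) ∧ (W.ncard : ℝ) ≤ D * max (√x) 1 ∧ x ≤ ((H.induce W).edgeCount : ℝ)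

/-- The law of the random vertex set `V_p(H)`, in which each vertex of `H` is included
independently with probability `p`. -/
noncomputable def randomVertexSet (H : Hypergraph α) (p : unitInterval) : Measure (Set α) :=
  setBernoulli V(H) p

/-- The random variable `X = e(H_p)`, where `H_p = H[V_p(H)]`, as a function of the outcome `W` of
the random vertex set `V_p(H)`. -/
noncomputable def inducedEdges (H : Hypergraph α) (W : Set α) : ℝ :=
  ((H.induce W).edgeCount : ℝ)

/-- The expectation `𝔼 X` of `X = e(H_p)`. -/
noncomputable def meanEdges (H : Hypergraph α) (p : unitInterval) : ℝ :=
  ∫ W, H.inducedEdges W ∂(H.randomVertexSet p)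

/-- The variance `Var X` of `X = e(H_p)`. -/
noncomputable def varEdges (H : Hypergraph α) (p : unitInterval) : ℝ :=
  variance H.inducedEdges (H.randomVertexSet p)

/-- The upper tail probability `ℙ(X ≥ s)` of `X = e(H_p)`. -/
noncomputable def upperTail (H : Hypergraph α) (p : unitInterval) (s : ℝ) : ℝ :=
  (H.randomVertexSet p).real {W | s ≤ H.inducedEdges W}

end Hypergraph

/-- `φ(x) = (1 + x) log (1 + x) - x`. -/
noncomputable def chernoffRate (x : ℝ) : ℝ :=
  (1 + x) * log (1 + x) - x

/-! Write q = n p^(k-1). Bounded codegrees make all degrees O(n), and φ(t/μ)μ²/Λ equals t log(1 +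
t/μ)/(1 + q) up to a factor 2. The two terms in the minimum are the costs of two ways to gain t
edges: a moderate excess spread over the whole hypergraph, or about √t chosen vertices that span
order t edges.

Upper bound. If every edge of a family meets at most C others, counting ordered tuples of disjoint
edges and applying Markov gives a Chernoff bound with exponent (t/C) log(1 + t/μ), up to constants
(`prob_large_bounded_le_exp`). A vertex of large degree is the centre of a large star, because
codegrees are bounded, and the expected number of stars is explicit (`sum_stars_le`). Unless the
random set contains many disjoint stars, deleting at most t/2 edges leaves a family of bounded
degree (`exists_large_bounded`). Stars of three sizes are used, so that the degree is lowered in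
stages and each stage deletes few edges. For polynomially small q the final degree is a constant;
otherwise it is of order q + log n (`exists_prob_upper_tail_le_of_dense`). The term log n instead of
1 does no harm if q is at least of order log n. When (a) fails it may cost too much, and there (b)
or (c) makes even the weakened rate at least of order √t log n.

Lower bound. Containing a cluster W costs p^|W|, and by Chebyshev the remaining edges stay near
their mean (`cluster_le_prob`); this is the term √t log(1/p). The other term comes, for q bounded
below, from comparison with density p(1 + θ), where the mean is larger by a multiple of t
(`exp_le_prob_of_tilt`). For small p it comes from a second moment argument over planted induced
matchings with order t edges (`exp_le_prob_of_matching`). Where neither construction applies, the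
clustering term is the smaller one up to a constant.

The threshold for n must not depend on γ. Upper bound estimates that need n large in terms of γ are
therefore complemented by `exists_prob_upper_tail_le_of_bounded`, in which only the constant in the
exponent gets smaller. -/

namespace BinomialSubset

/-! ### The binomial random subset: moments, conditioning, change of density. -/

open Finset

variable {α : Type*} [DecidableEq α] {V : Finset α} {p : ℝ}

/-- The probability that the binomial random subset of `V` with density `p` equals `S`. -/
noncomputable def weight (V : Finset α) (p : ℝ) (S : Finset α) : ℝ :=
  p ^ #S * (1 - p) ^ #(V \ S)

/-- Expectation over the binomial random subset of `V` with density `p`. -/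
noncomputable def expect (V : Finset α) (p : ℝ) (f : Finset α → ℝ) : ℝ :=
  ∑ S ∈ V.powerset, weight V p S * f S

open Classical in
/-- Probability of an event for the binomial random subset of `V` with density `p`. -/
noncomputable def prob (V : Finset α) (p : ℝ) (A : Finset α → Prop) : ℝ :=
  expect V p fun S => if A S then 1 else 0

lemma weight_nonneg (h0 : 0 ≤ p) (h1 : p ≤ 1) (S : Finset α) : 0 ≤ weight V p S :=
  mul_nonneg (pow_nonneg h0 _) (pow_nonneg (by linarith) _)

lemma weight_pos (h0 : 0 < p) (h1 : p < 1) (S : Finset α) : 0 < weight V p S :=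
  mul_pos (pow_pos h0 _) (pow_pos (by linarith) _)

lemma expect_add (f g : Finset α → ℝ) :
    expect V p (fun S => f S + g S) = expect V p f + expect V p g := by
  simp only [expect, mul_add, sum_add_distrib]

lemma expect_sub (f g : Finset α → ℝ) :
    expect V p (fun S => f S - g S) = expect V p f - expect V p g := by
  simp only [expect, mul_sub, sum_sub_distrib]

lemma expect_const_mul (c : ℝ) (f : Finset α → ℝ) :
    expect V p (fun S => c * f S) = c * expect V p f := by
  simp only [expect, mul_sum]
  exact sum_congr rfl fun _ _ => by ring

lemma expect_sum {ι : Type*} (s : Finset ι) (f : ι → Finset α → ℝ) :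
    expect V p (fun S => ∑ i ∈ s, f i S) = ∑ i ∈ s, expect V p (f i) := by
  simp only [expect, mul_sum]
  exact sum_comm

lemma expect_congr {f g : Finset α → ℝ} (h : ∀ S ⊆ V, f S = g S) : expect V p f = expect V p g :=
  sum_congr rfl fun S hS => by rw [h S (mem_powerset.1 hS)]

lemma expect_mono (h0 : 0 ≤ p) (h1 : p ≤ 1) {f g : Finset α → ℝ} (h : ∀ S ⊆ V, f S ≤ g S) :
    expect V p f ≤ expect V p g :=
  sum_le_sum fun S hS =>
    mul_le_mul_of_nonneg_left (h S (mem_powerset.1 hS)) (weight_nonneg h0 h1 S)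

lemma expect_nonneg (h0 : 0 ≤ p) (h1 : p ≤ 1) {f : Finset α → ℝ} (h : ∀ S ⊆ V, 0 ≤ f S) :
    0 ≤ expect V p f :=
  sum_nonneg fun S hS => mul_nonneg (weight_nonneg h0 h1 S) (h S (mem_powerset.1 hS))

lemma expect_const (c : ℝ) : expect V p (fun _ => c) = c := by
  have h : ∑ S ∈ V.powerset, weight V p S = 1 := by
    have := sum_pow_mul_eq_add_pow p (1 - p) V
    simp only [add_sub_cancel, one_pow] at this
    rw [← this]
    refine sum_congr rfl fun S hS => ?_
    rw [weight, card_sdiff_of_subset (mem_powerset.1 hS)]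
  rw [expect, ← sum_mul, h, one_mul]

lemma prob_nonneg (h0 : 0 ≤ p) (h1 : p ≤ 1) (A : Finset α → Prop) : 0 ≤ prob V p A :=
  expect_nonneg h0 h1 fun S _ => by split_ifs <;> norm_num

lemma prob_mono (h0 : 0 ≤ p) (h1 : p ≤ 1) {A B : Finset α → Prop} (h : ∀ S ⊆ V, A S → B S) :
    prob V p A ≤ prob V p B := by
  refine expect_mono h0 h1 fun S hS => ?_
  by_cases hA : A S
  · simp [hA, h S hS hA]
  · rw [if_neg hA]; split_ifs <;> norm_num

lemma prob_le_one (h0 : 0 ≤ p) (h1 : p ≤ 1) (A : Finset α → Prop) : prob V p A ≤ 1 := by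
  rw [← expect_const (V := V) (p := p) 1]
  exact expect_mono h0 h1 fun S _ => by split_ifs <;> norm_num

lemma prob_or_le (h0 : 0 ≤ p) (h1 : p ≤ 1) (A B : Finset α → Prop) :
    prob V p (fun S => A S ∨ B S) ≤ prob V p A + prob V p B := by
  rw [prob, prob, prob, ← expect_add]
  refine expect_mono h0 h1 fun S _ => ?_
  by_cases hA : A S <;> by_cases hB : B S <;> simp [hA, hB]

lemma prob_add_prob_not (A : Finset α → Prop) :
    prob V p A + prob V p (fun S => ¬ A S) = 1 := by
  rw [prob, prob, ← expect_add, ← expect_const (V := V) (p := p) 1]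
  refine expect_congr fun S _ => ?_
  by_cases hA : A S <;> simp [hA, expect_const]

/-- Markov's inequality. -/
lemma prob_le_expect_div (h0 : 0 ≤ p) (h1 : p ≤ 1) {f : Finset α → ℝ} (hf : ∀ S ⊆ V, 0 ≤ f S)
    {x : ℝ} (hx : 0 < x) {A : Finset α → Prop} (hA : ∀ S ⊆ V, A S → x ≤ f S) :
    prob V p A ≤ expect V p f / x := by
  rw [le_div_iff₀ hx, mul_comm, prob, ← expect_const_mul]
  refine expect_mono h0 h1 fun S hS => ?_
  by_cases h : A S
  · simpa [h] using hA S hS h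
  · simpa [h] using hf S hS

/-- Chebyshev's inequality. -/
lemma one_sub_le_prob (h0 : 0 ≤ p) (h1 : p ≤ 1) (f : Finset α → ℝ) (m : ℝ) {τ : ℝ} (hτ : 0 < τ) :
    1 - expect V p (fun S => (f S - m) ^ 2) / τ ^ 2 ≤ prob V p (fun S => m - τ ≤ f S) := by
  have h := prob_add_prob_not (V := V) (p := p) (fun S => m - τ ≤ f S)
  have h2 : prob V p (fun S => ¬ (m - τ ≤ f S)) ≤ expect V p (fun S => (f S - m) ^ 2) / τ ^ 2 := by
    refine prob_le_expect_div h0 h1 (fun S _ => sq_nonneg _) (by positivity) fun S _ hS => ?_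
    nlinarith
  linarith

/-- Cauchy-Schwarz for the restriction of `f` to an event. -/
lemma sq_expect_ite_le (h0 : 0 ≤ p) (h1 : p ≤ 1) (f : Finset α → ℝ) (A : Finset α → Prop)
    [DecidablePred A] :
    (expect V p fun S => if A S then f S else 0) ^ 2 ≤
      prob V p A * expect V p fun S => f S ^ 2 := by
  classical
  refine sum_sq_le_sum_mul_sum_of_sq_le_mul _ ?_ ?_ ?_
  · intro S _
    exact mul_nonneg (weight_nonneg h0 h1 S) (by dsimp only; split_ifs <;> norm_num)
  · intro S _
    exact mul_nonneg (weight_nonneg h0 h1 S) (sq_nonneg _)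
  · intro S _
    by_cases h : A S
    · simp only [h, if_true]; exact le_of_eq (by ring)
    · simp [h]

/-- Change of the density: an event that is likely at density `p'` is not too rare at density `p`. -/
lemma sq_prob_le_prob_mul (h0 : 0 < p) (h1 : p < 1) {p' : ℝ} (A : Finset α → Prop) :
    prob V p' A ^ 2 ≤ prob V p A * (1 + (p' - p) ^ 2 / (p * (1 - p))) ^ #V := by
  classical
  have h1' : 0 < 1 - p := by linarith
  -- The second moment of the likelihood ratio factorises over the points of V; each point
  -- contributes p'²/p + (1-p')²/(1-p).
  have key : ∑ S ∈ V.powerset, weight V p' S ^ 2 / weight V p S =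
      (1 + (p' - p) ^ 2 / (p * (1 - p))) ^ #V := by
    have : 1 + (p' - p) ^ 2 / (p * (1 - p)) = p' ^ 2 / p + (1 - p') ^ 2 / (1 - p) := by
      field_simp; ring
    rw [this, ← sum_pow_mul_eq_add_pow]
    refine sum_congr rfl fun S hS => ?_
    rw [weight, weight, card_sdiff_of_subset (mem_powerset.1 hS), div_pow, div_pow, mul_pow,
      ← pow_mul, ← pow_mul, ← pow_mul, ← pow_mul, mul_div_mul_comm, mul_comm 2, mul_comm 2]
  rw [← key]
  refine sum_sq_le_sum_mul_sum_of_sq_le_mul _ ?_ ?_ ?_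
  · intro S _
    exact mul_nonneg (weight_nonneg h0.le h1.le S) (by dsimp only; split_ifs <;> norm_num)
  · intro S _
    exact div_nonneg (sq_nonneg _) (weight_nonneg h0.le h1.le S)
  · intro S _
    have hw := (weight_pos (V := V) h0 h1 S).ne'
    by_cases h : A S
    · simp only [h, if_true, mul_one]
      rw [mul_div_cancel₀ _ hw]
    · simp [h]

/-- Write V as W with u added. Subsets of V without and with u have weights (1-p) and p times the
weight on W. Since `insert u S` forgets whether u was in S, both halves of the right-hand
expectation coincide and their weights add up to that on W. -/
lemma expect_ite_mem {u : α} (hu : u ∈ V) (g : Finset α → ℝ) :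
    expect V p (fun S => if u ∈ S then g S else 0) = p * expect V p fun S => g (insert u S) := by
  obtain ⟨W, hW, rfl⟩ : ∃ W, u ∉ W ∧ insert u W = V :=
    ⟨V.erase u, by simp, insert_erase hu⟩
  have w1 : ∀ S ∈ W.powerset, weight (insert u W) p S = (1 - p) * weight W p S := by
    intro S hS
    have hS' := mem_powerset.1 hS
    have : u ∉ S := fun h => hW (hS' h)
    rw [weight, weight, insert_sdiff_of_notMem _ this, card_insert_of_notMem (by simp [hW])]
    ring
  have w2 : ∀ S ∈ W.powerset, weight (insert u W) p (insert u S) = p * weight W p S := by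
    intro S hS
    have hS' := mem_powerset.1 hS
    have : u ∉ S := fun h => hW (hS' h)
    have h2 : insert u W \ insert u S = W \ S := by
      ext x; simp only [mem_sdiff, mem_insert, not_or]
      constructor
      · rintro ⟨h | h, h3, h4⟩
        · exact absurd h h3
        · exact ⟨h, h4⟩
      · rintro ⟨h, h3⟩
        exact ⟨Or.inr h, fun h5 => hW (h5 ▸ h), h3⟩
    rw [weight, weight, h2, card_insert_of_notMem this]
    ring
  simp only [expect]
  rw [sum_powerset_insert hW, sum_powerset_insert hW, ← sum_add_distrib, ← sum_add_distrib, mul_sum]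
  refine sum_congr rfl fun S hS => ?_
  have : u ∉ S := fun h => hW (mem_powerset.1 hS h)
  rw [w1 S hS, w2 S hS]
  simp only [this, if_false, mem_insert_self, if_true, insert_idem]
  ring

/-- Conditioning on the random set containing `U`. -/
lemma expect_ite_subset {U : Finset α} (hU : U ⊆ V) (g : Finset α → ℝ) :
    expect V p (fun S => if U ⊆ S then g S else 0) = p ^ #U * expect V p fun S => g (S ∪ U) := by
  induction U using Finset.induction_on generalizing g with
  | empty => simp
  | insert u U hu ih =>
    have hU' : U ⊆ V := (subset_insert _ _).trans hU
    have huV : u ∈ V := hU (mem_insert_self _ _)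
    have e1 : expect V p (fun S => if insert u U ⊆ S then g S else 0) =
        expect V p (fun S => if U ⊆ S then (if u ∈ S then g S else 0) else 0) := by
      refine expect_congr fun S _ => ?_
      by_cases h1 : U ⊆ S <;> by_cases h2 : u ∈ S <;> simp [h1, h2, insert_subset_iff]
    have e2 : expect V p (fun S => if u ∈ S ∪ U then g (S ∪ U) else 0) =
        expect V p (fun S => if u ∈ S then g (S ∪ U) else 0) := by
      refine expect_congr fun S _ => ?_
      simp [hu]
    rw [e1, ih hU', e2, expect_ite_mem huV, card_insert_of_notMem hu, pow_succ, mul_assoc]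
    congr 2
    refine expect_congr fun S _ => ?_
    rw [insert_union, union_insert]

lemma expect_subset {U : Finset α} (hU : U ⊆ V) :
    expect V p (fun S => if U ⊆ S then 1 else 0) = p ^ #U := by
  rw [expect_ite_subset hU, expect_const, mul_one]

/-- The number of members of `F` contained in `S`. -/
def count (F : Finset (Finset α)) (S : Finset α) : ℕ := #{f ∈ F | f ⊆ S}

lemma count_eq_sum (F : Finset (Finset α)) (S : Finset α) :
    (count F S : ℝ) = ∑ f ∈ F, if f ⊆ S then 1 else 0 := by
  rw [count, card_filter]; push_cast; rfl

lemma expect_count {F : Finset (Finset α)} (hF : ∀ f ∈ F, f ⊆ V) :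
    expect V p (fun S => (count F S : ℝ)) = ∑ f ∈ F, p ^ #f := by
  simp only [count_eq_sum]
  rw [expect_sum]
  exact sum_congr rfl fun f hf => expect_subset (hF f hf)

lemma expect_count_sq {F : Finset (Finset α)} (hF : ∀ f ∈ F, f ⊆ V) :
    expect V p (fun S => (count F S : ℝ) ^ 2) = ∑ e ∈ F, ∑ f ∈ F, p ^ #(e ∪ f) := by
  simp only [count_eq_sum, sq, sum_mul_sum]
  rw [expect_sum]
  refine sum_congr rfl fun e he => ?_
  rw [expect_sum]
  refine sum_congr rfl fun f hf => ?_
  rw [← expect_subset (union_subset (hF e he) (hF f hf))]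
  refine expect_congr fun S _ => ?_
  by_cases h1 : e ⊆ S <;> by_cases h2 : f ⊆ S <;> simp [h1, h2, union_subset_iff]

lemma variance_count {F : Finset (Finset α)} (hF : ∀ f ∈ F, f ⊆ V) :
    expect V p (fun S => ((count F S : ℝ) - ∑ f ∈ F, p ^ #f) ^ 2) =
      ∑ e ∈ F, ∑ f ∈ F, (p ^ #(e ∪ f) - p ^ #e * p ^ #f) := by
  set m := ∑ f ∈ F, p ^ #f with hm
  have : expect V p (fun S => ((count F S : ℝ) - m) ^ 2) =
      expect V p (fun S => (count F S : ℝ) ^ 2) - m ^ 2 := by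
    have e1 : expect V p (fun S => ((count F S : ℝ) - m) ^ 2) = expect V p
        (fun S => (count F S : ℝ) ^ 2 - (2 * m) * (count F S : ℝ) + m ^ 2) :=
      expect_congr fun S _ => by ring
    rw [e1, expect_add, expect_sub, expect_const_mul, expect_const, expect_count hF]
    ring
  rw [this, expect_count_sq hF, sq, hm, sum_mul_sum, ← sum_sub_distrib]
  refine sum_congr rfl fun e _ => ?_
  rw [← sum_sub_distrib]

/-- Only intersecting pairs contribute to the variance. -/
lemma variance_count_le (h0 : 0 ≤ p) {F : Finset (Finset α)} (hF : ∀ f ∈ F, f ⊆ V) :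
    expect V p (fun S => ((count F S : ℝ) - ∑ f ∈ F, p ^ #f) ^ 2) ≤
      ∑ e ∈ F, ∑ f ∈ F with ¬ Disjoint e f, p ^ #(e ∪ f) := by
  rw [variance_count hF]
  refine sum_le_sum fun e _ => ?_
  rw [sum_filter]
  refine sum_le_sum fun f _ => ?_
  by_cases h : Disjoint e f
  · rw [card_union_of_disjoint h, pow_add]; simp [h]
  · simp only [h, not_false_eq_true, if_true]
    have : 0 ≤ p ^ #e * p ^ #f := by positivity
    linarith

end BinomialSubset

/-! ### A Chernoff bound through tuples of disjoint sets. -/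

namespace BinomialSubset

open Finset

variable {α : Type*} [DecidableEq α] {V : Finset α} {p : ℝ}

/-- The number of ordered `r`-tuples of pairwise disjoint members of `J`. -/
def disjTuples : ℕ → Finset (Finset α) → ℕ
  | 0, _ => 1
  | r + 1, J => ∑ U ∈ J, disjTuples r {f ∈ J | Disjoint U f}

lemma disjTuples_mono (r : ℕ) {J J' : Finset (Finset α)} (h : J ⊆ J') :
    disjTuples r J ≤ disjTuples r J' := by
  induction r generalizing J J' with
  | zero => simp [disjTuples]
  | succ r ih =>
    simp only [disjTuples]
    exact (sum_le_sum fun U _ => ih (filter_subset_filter _ h)).trans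
      (sum_le_sum_of_subset h)

/-- Disjoint sets are contained in the random set independently. Peel off the first set U of the
tuple: conditioning on U ⊆ S does not affect sets disjoint from U, and the restriction to such sets
only decreases the sum. -/
lemma expect_disjTuples_le (h0 : 0 ≤ p) (r : ℕ) {F : Finset (Finset α)}
    (hF : ∀ f ∈ F, f ⊆ V) :
    expect V p (fun S => (disjTuples r {f ∈ F | f ⊆ S} : ℝ)) ≤ (∑ f ∈ F, p ^ #f) ^ r := by
  induction r generalizing F with
  | zero => simp [disjTuples, expect_const]
  | succ r ih =>
    have e1 : expect V p (fun S => (disjTuples (r + 1) {f ∈ F | f ⊆ S} : ℝ)) =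
        expect V p (fun S => ∑ U ∈ F, if U ⊆ S then
          (disjTuples r {f ∈ {f ∈ F | Disjoint U f} | f ⊆ S} : ℝ) else 0) := by
      refine expect_congr fun S _ => ?_
      simp only [disjTuples]
      push_cast
      rw [sum_filter]
      refine sum_congr rfl fun U _ => ?_
      rw [filter_filter, filter_filter]
      simp only [and_comm]
    rw [e1, expect_sum, pow_succ', sum_mul]
    refine sum_le_sum fun U hU => ?_
    rw [expect_ite_subset (hF U hU)]
    refine mul_le_mul_of_nonneg_left ?_ (by positivity)
    have e2 : expect V p (fun S => (disjTuples r {f ∈ {f ∈ F | Disjoint U f} | f ⊆ S ∪ U} : ℝ)) =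
        expect V p (fun S => (disjTuples r {f ∈ {f ∈ F | Disjoint U f} | f ⊆ S} : ℝ)) := by
      refine expect_congr fun S _ => ?_
      congr 2
      refine filter_congr fun f hf => ?_
      have hd := (mem_filter.1 hf).2
      constructor
      · intro h x hx
        rcases mem_union.1 (h hx) with h | h
        · exact h
        · exact absurd hx (disjoint_left.1 hd h)
      · exact fun h => h.trans subset_union_left
    rw [e2]
    refine (ih fun f hf => hF f (mem_filter.1 hf).1).trans ?_
    refine pow_le_pow_left₀ (sum_nonneg fun _ _ => by positivity) ?_ _
    exact sum_le_sum_of_subset_of_nonneg (filter_subset _ _) fun _ _ _ => by positivity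

/-- Greedy choice: each chosen member excludes at most C members, itself included, so at least x
candidates remain for each of the r + 1 choices. -/
lemma pow_le_disjTuples {C x : ℝ} (hx : 0 ≤ x) (hC0 : 0 ≤ C) (r : ℕ) {J : Finset (Finset α)}
    (hC : ∀ U ∈ J, (#{f ∈ J | ¬ Disjoint U f} : ℝ) ≤ C) (hJ : x + r * C ≤ #J) :
    x ^ (r + 1) ≤ disjTuples (r + 1) J := by
  induction r generalizing J with
  | zero => simpa [disjTuples] using hJ
  | succ r ih =>
    have key : ∀ U ∈ J, x ^ (r + 1) ≤ (disjTuples (r + 1) {f ∈ J | Disjoint U f} : ℝ) := by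
      intro U hU
      refine ih ?_ ?_
      · intro W hW
        refine le_trans ?_ (hC W (mem_filter.1 hW).1)
        exact_mod_cast card_le_card (filter_subset_filter _ (filter_subset _ _))
      · have h1 := card_filter_add_card_filter_not (s := J) (fun f => Disjoint U f)
        have h2 := hC U hU
        have h3 : (#{f ∈ J | Disjoint U f} : ℝ) + #{f ∈ J | ¬ Disjoint U f} = #J := by
          exact_mod_cast h1
        push_cast at hJ
        linarith
    have h : x ≤ #J := by
      have : 0 ≤ ((r + 1 : ℕ) : ℝ) * C := by positivity
      linarith
    calc x ^ (r + 1 + 1) = x * x ^ (r + 1) := pow_succ' _ _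
      _ ≤ #J * x ^ (r + 1) := mul_le_mul_of_nonneg_right h (by positivity)
      _ = ∑ _U ∈ J, x ^ (r + 1) := by rw [sum_const, nsmul_eq_mul]
      _ ≤ ∑ U ∈ J, (disjTuples (r + 1) {f ∈ J | Disjoint U f} : ℝ) := sum_le_sum key
      _ = disjTuples (r + 1 + 1) J := by rw [disjTuples.eq_2]; push_cast; rfl

/-- Markov's inequality for the number of disjoint (r+1)-tuples. That number is monotone in the
family, so no union bound over J is needed. -/
lemma prob_large_bounded_le (h0 : 0 ≤ p) (h1 : p ≤ 1) {C x : ℝ} (hx : 0 < x) (hC0 : 0 ≤ C)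
    (r : ℕ) {F : Finset (Finset α)} (hF : ∀ f ∈ F, f ⊆ V) :
    prob V p (fun S => ∃ J ⊆ {f ∈ F | f ⊆ S},
        (∀ U ∈ J, (#{f ∈ J | ¬ Disjoint U f} : ℝ) ≤ C) ∧ x + r * C ≤ #J) ≤
      ((∑ f ∈ F, p ^ #f) / x) ^ (r + 1) := by
  rw [div_pow]
  refine (prob_le_expect_div h0 h1
    (f := fun S => (disjTuples (r + 1) {f ∈ F | f ⊆ S} : ℝ)) (fun S _ => by positivity)
    (pow_pos hx (r + 1)) ?_).trans ?_
  · rintro S - ⟨J, hJ, hJC, hJx⟩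
    exact (pow_le_disjTuples hx.le hC0 r hJC hJx).trans (by exact_mod_cast disjTuples_mono _ hJ)
  · exact div_le_div_of_nonneg_right (expect_disjTuples_le h0 _ hF) (by positivity)

/-- A Chernoff bound for the largest subfamily in which every set meets at most `C` others. -/
lemma prob_large_bounded_le_exp (h0 : 0 ≤ p) (h1 : p ≤ 1) {C τ m : ℝ} (hC : 0 < C) (hτ : 0 < τ)
    (hm : 0 < m) {F : Finset (Finset α)} (hF : ∀ f ∈ F, f ⊆ V) (hmF : ∑ f ∈ F, p ^ #f = m) :
    prob V p (fun S => ∃ J ⊆ {f ∈ F | f ⊆ S},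
        (∀ U ∈ J, (#{f ∈ J | ¬ Disjoint U f} : ℝ) ≤ C) ∧ m + τ ≤ #J) ≤
      exp (-(τ / (2 * C) * log (1 + τ / (2 * m)))) := by
  -- With this r the greedy choice wastes rC ≤ τ/2, so the base is m/(m + τ/2), while the number r +
  -- 1 of factors exceeds τ/(2C).
  set r := ⌊τ / (2 * C)⌋₊ with hr
  have hr1 : (r : ℝ) ≤ τ / (2 * C) := Nat.floor_le (by positivity)
  have hr2 : τ / (2 * C) < r + 1 := Nat.lt_floor_add_one _
  have hrC : r * C ≤ τ / 2 := by
    calc r * C ≤ τ / (2 * C) * C := mul_le_mul_of_nonneg_right hr1 hC.le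
      _ = τ / 2 := by field_simp
  have hx : 0 < m + τ / 2 := by positivity
  refine (prob_mono h0 h1 (B := fun S => ∃ J ⊆ {f ∈ F | f ⊆ S},
        (∀ U ∈ J, (#{f ∈ J | ¬ Disjoint U f} : ℝ) ≤ C) ∧ (m + τ / 2) + r * C ≤ #J) ?_).trans ?_
  · rintro S - ⟨J, hJ, hJC, hJm⟩
    exact ⟨J, hJ, hJC, by linarith⟩
  · refine (prob_large_bounded_le h0 h1 hx hC.le r hF).trans ?_
    have hl : 0 ≤ log (1 + τ / (2 * m)) := log_nonneg (by
      have : 0 ≤ τ / (2 * m) := by positivity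
      linarith)
    have e1 : (∑ f ∈ F, p ^ #f) / (m + τ / 2) = exp (-log (1 + τ / (2 * m))) := by
      rw [hmF, exp_neg, exp_log (by positivity)]
      field_simp
    rw [e1, ← exp_nat_mul]
    apply exp_le_exp.2
    push_cast
    nlinarith

/-- The case C = x = 1 of `prob_large_bounded_le`: a member of a pairwise disjoint family meets at
most itself. -/
lemma prob_disjoint_le (h0 : 0 ≤ p) (h1 : p ≤ 1) (m : ℕ) {F : Finset (Finset α)}
    (hF : ∀ f ∈ F, f ⊆ V) :
    prob V p (fun S => ∃ M ⊆ {f ∈ F | f ⊆ S}, #M = m + 1 ∧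
      ∀ U ∈ M, ∀ W ∈ M, U ≠ W → Disjoint U W) ≤ (∑ f ∈ F, p ^ #f) ^ (m + 1) := by
  have h := prob_large_bounded_le h0 h1 one_pos zero_le_one m hF
  rw [div_one] at h
  refine (prob_mono h0 h1 ?_).trans h
  rintro S - ⟨M, hM, hMm, hMd⟩
  refine ⟨M, hM, ?_, by rw [hMm]; push_cast; linarith⟩
  intro U hU
  have : {f ∈ M | ¬ Disjoint U f} ⊆ {U} := by
    intro W hW
    obtain ⟨hW1, hW2⟩ := mem_filter.1 hW
    by_contra hne
    exact hW2 (hMd U hU W hW1 fun h => hne (by simp [h]))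
  exact_mod_cast card_le_card this

/-! ### Almost linear families and their stars. -/

/-- A `k`-uniform family of subsets of `V` in which any two points lie in at most `D` sets. -/
structure AlmostLinear (V : Finset α) (E : Finset (Finset α)) (k : ℕ) (D : ℝ) : Prop where
  subset : ∀ e ∈ E, e ⊆ V
  card : ∀ e ∈ E, #e = k
  codegree : ∀ u v, u ≠ v → (#{e ∈ E | u ∈ e ∧ v ∈ e} : ℝ) ≤ D

lemma AlmostLinear.mono {E E' : Finset (Finset α)} {k : ℕ} {D : ℝ} (h : AlmostLinear V E k D)
    (hE : E' ⊆ E) : AlmostLinear V E' k D where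
  subset e he := h.subset e (hE he)
  card e he := h.card e (hE he)
  codegree u v huv := le_trans (by exact_mod_cast card_le_card (filter_subset_filter _ hE))
    (h.codegree u v huv)

/-- A star with centre `v`: members of `E` that pairwise meet exactly in `v`. -/
structure IsStar (E : Finset (Finset α)) (v : α) (F : Finset (Finset α)) : Prop where
  subset : F ⊆ E
  mem : ∀ e ∈ F, v ∈ e
  inter : ∀ e ∈ F, ∀ f ∈ F, e ≠ f → e ∩ f = {v}

open Classical in
/-- The point sets of the stars with `s` members. -/
noncomputable def stars (V : Finset α) (E : Finset (Finset α)) (s : ℕ) : Finset (Finset α) :=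
  V.biUnion fun v => ((powersetCard s {e ∈ E | v ∈ e}).filter (IsStar E v)).image (·.biUnion id)

lemma mem_stars {E : Finset (Finset α)} {s : ℕ} {U : Finset α} :
    U ∈ stars V E s ↔ ∃ v ∈ V, ∃ F, IsStar E v F ∧ #F = s ∧ F.biUnion id = U := by
  simp only [stars, mem_biUnion, mem_image, mem_filter, mem_powersetCard]
  constructor
  · rintro ⟨v, hv, F, ⟨⟨-, hF⟩, hS⟩, rfl⟩
    exact ⟨v, hv, F, hS, hF, rfl⟩
  · rintro ⟨v, hv, F, hS, hF, rfl⟩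
    exact ⟨v, hv, F, ⟨⟨fun e he => mem_filter.2 ⟨hS.subset he, hS.mem e he⟩, hF⟩, hS⟩, rfl⟩

lemma IsStar.card_biUnion {E : Finset (Finset α)} {v : α} {F : Finset (Finset α)} {k : ℕ}
    (h : IsStar E v F) (hk : ∀ e ∈ E, #e = k) (hF : F.Nonempty) :
    #(F.biUnion id) = 1 + #F * (k - 1) := by
  have e1 : F.biUnion id = insert v (F.biUnion fun e => e.erase v) := by
    ext x
    simp only [mem_biUnion, id, mem_insert, mem_erase]
    constructor
    · rintro ⟨e, he, hx⟩
      by_cases hxv : x = v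
      · exact Or.inl hxv
      · exact Or.inr ⟨e, he, hxv, hx⟩
    · rintro (rfl | ⟨e, he, -, hx⟩)
      · obtain ⟨e, he⟩ := hF
        exact ⟨e, he, h.mem e he⟩
      · exact ⟨e, he, hx⟩
  rw [e1, card_insert_of_notMem (by simp), Finset.card_biUnion, add_comm]
  · congr 1
    rw [sum_const_nat]
    intro e he
    rw [card_erase_of_mem (h.mem e he), hk e (h.subset he)]
  · intro e he f hf hef
    show Disjoint (e.erase v) (f.erase v)
    rw [disjoint_left]
    intro x hx hx'
    have : x ∈ e ∩ f := mem_inter.2 ⟨(mem_erase.1 hx).2, (mem_erase.1 hx').2⟩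
    rw [h.inter e he f hf hef] at this
    exact (mem_erase.1 hx).1 (mem_singleton.1 this)

lemma stars_subset {E : Finset (Finset α)} (hE : ∀ e ∈ E, e ⊆ V) {s : ℕ} {U : Finset α}
    (hU : U ∈ stars V E s) : U ⊆ V := by
  obtain ⟨v, -, F, hF, -, rfl⟩ := mem_stars.1 hU
  exact biUnion_subset.2 fun e he => hE e (hF.subset he)

lemma card_of_mem_stars {E : Finset (Finset α)} {k s : ℕ} (hk : ∀ e ∈ E, #e = k) (hs : 1 ≤ s)
    {U : Finset α} (hU : U ∈ stars V E s) : #U = 1 + s * (k - 1) := by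
  obtain ⟨v, -, F, hF, hFs, rfl⟩ := mem_stars.1 hU
  rw [hF.card_biUnion hk (card_pos.1 (by omega)), hFs]

/-- Union bound over the centre and the s edges through it: a centre admits at most (Δ choose s) ≤
(eΔ/s)^s choices, and every star has exactly 1 + s(k-1) points. -/
lemma sum_stars_le (h0 : 0 ≤ p) {E : Finset (Finset α)} {k s : ℕ} (hk : ∀ e ∈ E, #e = k)
    (hs : 1 ≤ s) {Δ : ℝ} (hΔ : ∀ v ∈ V, (#{e ∈ E | v ∈ e} : ℝ) ≤ Δ) :
    ∑ U ∈ stars V E s, p ^ #U ≤ #V * p * (exp 1 * Δ * p ^ (k - 1) / s) ^ s := by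
  have e1 : ∑ U ∈ stars V E s, p ^ #U = #(stars V E s) * p ^ (1 + s * (k - 1)) := by
    rw [sum_congr rfl fun U hU => by rw [card_of_mem_stars hk hs hU], sum_const, nsmul_eq_mul]
  have e2 : (#(stars V E s) : ℝ) ≤ #V * (exp 1 * Δ / s) ^ s := by
    have h : #(stars V E s) ≤ ∑ v ∈ V, (#{e ∈ E | v ∈ e}).choose s := by
      classical
      refine card_biUnion_le.trans (sum_le_sum fun v _ => ?_)
      refine card_image_le.trans ((card_filter_le _ _).trans ?_)
      rw [card_powersetCard]
    have h2 : ∀ v ∈ V, ((#{e ∈ E | v ∈ e}).choose s : ℝ) ≤ (exp 1 * Δ / s) ^ s := by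
      intro v hv
      have hs0 : (0 : ℝ) < s := by exact_mod_cast hs
      refine (Nat.choose_le_pow_div (α := ℝ) s _).trans ?_
      have h3 : ((#{e ∈ E | v ∈ e} : ℝ)) ^ s ≤ Δ ^ s := pow_le_pow_left₀ (by positivity) (hΔ v hv) _
      have h4 := Real.pow_div_factorial_le_exp (s : ℝ) hs0.le s
      have h5 : (0 : ℝ) < s.factorial := by exact_mod_cast s.factorial_pos
      have hΔ0 : 0 ≤ Δ := le_trans (by positivity) (hΔ v hv)
      rw [div_le_iff₀ h5] at h4 ⊢
      have h6 : (exp 1 * Δ / s) ^ s = exp s * Δ ^ s / (s : ℝ) ^ s := by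
        rw [div_pow, mul_pow, ← exp_nat_mul, mul_one]
      rw [h6, div_mul_eq_mul_div, le_div_iff₀ (by positivity)]
      calc (#{e ∈ E | v ∈ e} : ℝ) ^ s * (s : ℝ) ^ s ≤ Δ ^ s * (exp s * s.factorial) :=
            mul_le_mul h3 h4 (by positivity) (by positivity)
        _ = exp s * Δ ^ s * s.factorial := by ring
    calc (#(stars V E s) : ℝ) ≤ ∑ v ∈ V, ((#{e ∈ E | v ∈ e}).choose s : ℝ) := by exact_mod_cast h
      _ ≤ ∑ v ∈ V, (exp 1 * Δ / s) ^ s := sum_le_sum h2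
      _ = #V * (exp 1 * Δ / s) ^ s := by rw [sum_const, nsmul_eq_mul]
  rw [e1]
  calc _ ≤ #V * (exp 1 * Δ / s) ^ s * p ^ (1 + s * (k - 1)) :=
        mul_le_mul_of_nonneg_right e2 (by positivity)
    _ = _ := by
      rw [pow_add, pow_one, mul_comm s (k - 1), pow_mul, mul_div_right_comm (exp 1 * Δ),
        mul_pow _ (p ^ (k - 1))]
      ring

/-- Large degrees force large stars. -/
lemma exists_isStar {E : Finset (Finset α)} {k : ℕ} {D : ℝ} (hk : 2 ≤ k) (h : AlmostLinear V E k D)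
    (v : α) (hD : 0 ≤ D) (s : ℕ) (hs : s * (k * D) < #{e ∈ E | v ∈ e}) :
    ∃ F, IsStar E v F ∧ #F = s := by
  have hkD : 0 ≤ k * D := by positivity
  induction s with
  | zero => exact ⟨∅, ⟨by simp, by simp, by simp⟩, by simp⟩
  | succ s ih =>
    push_cast at hs
    obtain ⟨F, hF, hFs⟩ := ih (by nlinarith)
    -- B consists of the edges at v that share a second point with the star built so far. The
    -- codegree condition keeps B smaller than the degree of v, so some edge outside B extends the
    -- star.
    set B : Finset (Finset α) :=
      F.biUnion fun f => (f.erase v).biUnion fun u => {e ∈ E | v ∈ e ∧ u ∈ e} with hB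
    have hBc : (#B : ℝ) ≤ s * (k * D) := by
      have h1 : ∀ f ∈ F, (#((f.erase v).biUnion fun u => {e ∈ E | v ∈ e ∧ u ∈ e}) : ℝ) ≤ k * D := by
        intro f hf
        calc (#((f.erase v).biUnion fun u => {e ∈ E | v ∈ e ∧ u ∈ e}) : ℝ)
            ≤ ∑ u ∈ f.erase v, (#{e ∈ E | v ∈ e ∧ u ∈ e} : ℝ) := by exact_mod_cast card_biUnion_le
          _ ≤ ∑ u ∈ f.erase v, D :=
            sum_le_sum fun u hu => h.codegree v u (mem_erase.1 hu).1.symm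
          _ = #(f.erase v) * D := by rw [sum_const, nsmul_eq_mul]
          _ ≤ k * D := by
            refine mul_le_mul_of_nonneg_right ?_ hD
            rw [← h.card f (hF.subset hf)]
            exact_mod_cast card_le_card (erase_subset _ _)
      calc (#B : ℝ) ≤ ∑ f ∈ F, (#((f.erase v).biUnion fun u => {e ∈ E | v ∈ e ∧ u ∈ e}) : ℝ) := by
            exact_mod_cast card_biUnion_le
        _ ≤ ∑ f ∈ F, (k * D) := sum_le_sum h1
        _ = s * (k * D) := by rw [sum_const, nsmul_eq_mul, hFs]
    have hlt : #B < #{e ∈ E | v ∈ e} := by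
      have : (#B : ℝ) < #{e ∈ E | v ∈ e} := by nlinarith
      exact_mod_cast this
    obtain ⟨e, he, heB⟩ := exists_mem_notMem_of_card_lt_card hlt
    obtain ⟨heE, hev⟩ := mem_filter.1 he
    have hdis : ∀ f ∈ F, e ∩ f = {v} := by
      intro f hf
      ext x
      simp only [mem_inter, mem_singleton]
      constructor
      · rintro ⟨hxe, hxf⟩
        by_contra hxv
        refine heB (mem_biUnion.2 ⟨f, hf, mem_biUnion.2 ⟨x, mem_erase.2 ⟨hxv, hxf⟩, ?_⟩⟩)
        exact mem_filter.2 ⟨heE, hev, hxe⟩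
      · rintro rfl
        exact ⟨hev, hF.mem f hf⟩
    have heF : e ∉ F := by
      intro hmem
      have h1 := hdis e hmem
      rw [inter_self] at h1
      have h2 := h.card e heE
      rw [h1, card_singleton] at h2
      omega
    refine ⟨insert e F, ⟨insert_subset heE hF.subset, ?_, ?_⟩, by
      rw [card_insert_of_notMem heF, hFs]⟩
    · intro f hf
      rcases mem_insert.1 hf with rfl | hf
      · exact hev
      · exact hF.mem f hf
    · intro f hf g hg hfg
      rcases mem_insert.1 hf with rfl | hf' <;> rcases mem_insert.1 hg with rfl | hg'
      · exact absurd rfl hfg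
      · exact hdis g hg'
      · rw [inter_comm]; exact hdis f hf'
      · exact hF.inter f hf' g hg' hfg

end BinomialSubset

/-! ### From few disjoint stars to bounded degrees. -/

namespace BinomialSubset

open Finset

variable {α : Type*} [DecidableEq α] {V : Finset α} {p : ℝ}

/-- The set `S` contains the point sets of `m` pairwise disjoint stars with `s` members each. -/
def HasStars (V : Finset α) (E : Finset (Finset α)) (s m : ℕ) (S : Finset α) : Prop :=
  ∃ M ⊆ {U ∈ stars V E s | U ⊆ S}, #M = m ∧ ∀ U ∈ M, ∀ W ∈ M, U ≠ W → Disjoint U W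

lemma prob_hasStars_le (h0 : 0 ≤ p) (h1 : p ≤ 1) {E : Finset (Finset α)} (hE : ∀ e ∈ E, e ⊆ V)
    (s m : ℕ) : prob V p (HasStars V E s (m + 1)) ≤ (∑ U ∈ stars V E s, p ^ #U) ^ (m + 1) :=
  prob_disjoint_le h0 h1 m fun _ hU => stars_subset hE hU

/-- Few disjoint stars can be destroyed by deleting few edges. -/
lemma exists_bounded_degree {E : Finset (Finset α)} {k : ℕ} {D : ℝ} (hk : 2 ≤ k) (hD : 0 ≤ D)
    (h : AlmostLinear V E k D) {s m : ℕ} (hs : 1 ≤ s) {S : Finset α} {E₀ : Finset (Finset α)}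
    (hE₀ : E₀ ⊆ {e ∈ E | e ⊆ S}) (hno : ¬ HasStars V E s (m + 1) S) {Δ : ℝ}
    (hΔ0 : 0 ≤ Δ)     (hΔ : ∀ v, (#{e ∈ E₀ | v ∈ e} : ℝ) ≤ Δ) :
    ∃ E₁ ⊆ E₀, (∀ v, (#{e ∈ E₁ | v ∈ e} : ℝ) ≤ s * (k * D)) ∧
      (#E₀ : ℝ) ≤ #E₁ + m * (s * k) * Δ := by
  classical
  have hE₀E : E₀ ⊆ E := hE₀.trans (filter_subset _ _)
  set T := {U ∈ stars V E s | U ⊆ S} with hT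
  set 𝓜 := T.powerset.filter fun M => ∀ U ∈ M, ∀ W ∈ M, U ≠ W → Disjoint U W with h𝓜
  -- Take a largest family M of disjoint stars inside S; it has at most m members, and the edges to
  -- be deleted are those that meet its union.
  obtain ⟨M, hM, hmax⟩ := exists_max_image 𝓜 card ⟨∅, by simp [h𝓜]⟩
  obtain ⟨hMT, hMd⟩ := mem_filter.1 hM
  rw [mem_powerset] at hMT
  have hMm : #M ≤ m := by
    by_contra hlt
    obtain ⟨M', hM', hM'c⟩ := exists_subset_card_eq (show m + 1 ≤ #M by omega)
    exact hno ⟨M', hM'.trans hMT, hM'c, fun U hU W hW => hMd U (hM' hU) W (hM' hW)⟩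
  set U := M.biUnion id with hU
  have hUc : #U ≤ m * (s * k) := by
    refine card_biUnion_le.trans ((sum_le_card_nsmul M _ (s * k) fun W hW => ?_).trans ?_)
    · rw [id, card_of_mem_stars h.card hs (mem_filter.1 (hMT hW)).1]
      obtain ⟨k, rfl⟩ : ∃ k', k = k' + 1 := ⟨k - 1, by omega⟩
      rw [Nat.add_sub_cancel, mul_add]; omega
    · rw [smul_eq_mul]; exact Nat.mul_le_mul_right _ hMm
  refine ⟨{e ∈ E₀ | Disjoint e U}, filter_subset _ _, ?_, ?_⟩
  · intro v
    by_contra! hv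
    -- A vertex still of large degree would be the centre of a star made of remaining edges. That
    -- star avoids M and would enlarge it.
    obtain ⟨F, hF, hFs⟩ := exists_isStar hk
      (h.mono ((filter_subset (fun e => Disjoint e U) _).trans hE₀E)) v hD s hv
    have hFne : F.Nonempty := card_pos.1 (by omega)
    obtain ⟨e₀, he₀⟩ := hFne
    set W := F.biUnion id with hW
    have hvW : v ∈ W := mem_biUnion.2 ⟨e₀, he₀, hF.mem e₀ he₀⟩
    have hWdis : Disjoint W U := by
      rw [hW, disjoint_biUnion_left]
      exact fun e he => (mem_filter.1 (hF.subset he)).2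
    have hvV : v ∈ V := h.subset e₀ (hE₀E (mem_filter.1 (hF.subset he₀)).1) (hF.mem e₀ he₀)
    have hWT : W ∈ T := by
      refine mem_filter.2 ⟨mem_stars.2 ⟨v, hvV, F, ⟨fun e he => hE₀E
        (mem_filter.1 (hF.subset he)).1, hF.mem, hF.inter⟩, hFs, rfl⟩, ?_⟩
      exact biUnion_subset.2 fun e he =>
        (mem_filter.1 (hE₀ (mem_filter.1 (hF.subset he)).1)).2
    have hWdis' : ∀ A ∈ M, Disjoint W A := fun A hA =>
      hWdis.mono_right (subset_biUnion_of_mem id hA)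
    have hWM : W ∉ M := fun hWM =>
      disjoint_left.1 (hWdis' W hWM) hvW hvW
    have := hmax (insert W M) (mem_filter.2 ⟨mem_powerset.2 (insert_subset hWT hMT), ?_⟩)
    · rw [card_insert_of_notMem hWM] at this
      omega
    · intro A hA B hB hAB
      rcases mem_insert.1 hA with rfl | hA' <;> rcases mem_insert.1 hB with rfl | hB'
      · exact absurd rfl hAB
      · exact hWdis' B hB'
      · exact (hWdis' A hA').symm
      · exact hMd A hA' B hB' hAB
  · have h1 := card_filter_add_card_filter_not (s := E₀) (fun e => Disjoint e U)
    have h2 : (#{e ∈ E₀ | ¬ Disjoint e U} : ℝ) ≤ #U * Δ := by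
      have : {e ∈ E₀ | ¬ Disjoint e U} ⊆ U.biUnion fun u => {e ∈ E₀ | u ∈ e} := by
        intro e he
        obtain ⟨he1, he2⟩ := mem_filter.1 he
        obtain ⟨x, hx1, hx2⟩ := not_disjoint_iff.1 he2
        exact mem_biUnion.2 ⟨x, hx2, mem_filter.2 ⟨he1, hx1⟩⟩
      calc (#{e ∈ E₀ | ¬ Disjoint e U} : ℝ) ≤ ∑ u ∈ U, (#{e ∈ E₀ | u ∈ e} : ℝ) := by
            exact_mod_cast (card_le_card this).trans card_biUnion_le
        _ ≤ ∑ u ∈ U, Δ := sum_le_sum fun u _ => hΔ u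
        _ = #U * Δ := by rw [sum_const, nsmul_eq_mul]
    have h3 : (#U : ℝ) * Δ ≤ m * (s * k) * Δ :=
      mul_le_mul_of_nonneg_right (by exact_mod_cast hUc) hΔ0
    have h4 : (#E₀ : ℝ) = #{e ∈ E₀ | Disjoint e U} + #{e ∈ E₀ | ¬ Disjoint e U} := by
      exact_mod_cast h1.symm
    linarith

/-- Without many large disjoint stars, most edges form a subfamily of bounded degree. -/
lemma exists_large_bounded {E : Finset (Finset α)} {k : ℕ} {D : ℝ} (hk : 2 ≤ k) (hD : 0 ≤ D)
    (h : AlmostLinear V E k D) {s₁ s₂ s₃ m₁ m₂ : ℕ} (hs₁ : 1 ≤ s₁) (hs₂ : 1 ≤ s₂) (hs₃ : 1 ≤ s₃)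
    {S : Finset α} (h₁ : ¬ HasStars V E s₁ (m₁ + 1) S) (h₂ : ¬ HasStars V E s₂ (m₂ + 1) S)
    (h₃ : ¬ HasStars V E s₃ (0 + 1) S) :
    ∃ J ⊆ {e ∈ E | e ⊆ S}, (∀ U ∈ J, (#{f ∈ J | ¬ Disjoint U f} : ℝ) ≤ k * (s₁ * (k * D))) ∧
      (count E S : ℝ) ≤ #J + m₁ * (s₁ * k) * (s₂ * (k * D)) + m₂ * (s₂ * k) * (s₃ * (k * D)) := by
  -- Degrees drop to s₃kD, then s₂kD, then s₁kD. The first round starts from the trivial degree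
  -- bound, which is harmless because no s₃-star at all is allowed and so nothing is deleted. Each
  -- later round deletes edges whose number is controlled by the degree bound of the round before.
  obtain ⟨E₃, hE₃, hd₃, hc₃⟩ := exists_bounded_degree hk hD h hs₃ subset_rfl h₃
    (Δ := #{e ∈ E | e ⊆ S}) (by positivity)
    fun v => by exact_mod_cast card_le_card (filter_subset _ _)
  obtain ⟨E₂, hE₂, hd₂, hc₂⟩ := exists_bounded_degree hk hD h hs₂ hE₃ h₂ (by positivity) hd₃
  obtain ⟨E₁, hE₁, hd₁, hc₁⟩ :=
    exists_bounded_degree hk hD h hs₁ (hE₂.trans hE₃) h₁ (by positivity) hd₂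
  have hsub := hE₁.trans (hE₂.trans hE₃)
  refine ⟨E₁, hsub, fun U hU => ?_, ?_⟩
  · have : {f ∈ E₁ | ¬ Disjoint U f} ⊆ U.biUnion fun u => {f ∈ E₁ | u ∈ f} := by
      intro f hf
      obtain ⟨hf1, hf2⟩ := mem_filter.1 hf
      obtain ⟨x, hx1, hx2⟩ := not_disjoint_iff.1 hf2
      exact mem_biUnion.2 ⟨x, hx1, mem_filter.2 ⟨hf1, hx2⟩⟩
    calc (#{f ∈ E₁ | ¬ Disjoint U f} : ℝ) ≤ ∑ u ∈ U, (#{f ∈ E₁ | u ∈ f} : ℝ) := by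
          exact_mod_cast (card_le_card this).trans card_biUnion_le
      _ ≤ ∑ u ∈ U, (s₁ * (k * D) : ℝ) := sum_le_sum fun u _ => hd₁ u
      _ = k * (s₁ * (k * D)) := by
        rw [sum_const, nsmul_eq_mul, h.card U (mem_filter.1 (hsub hU)).1]
  · simp only [Nat.cast_zero, zero_mul, add_zero] at hc₃
    rw [count]
    linarith

/-- Outside the star events the two rounds of deletion remove at most t/4 edges each, so a family of
bounded degree with at least m + t/2 edges remains, and the Chernoff bound applies to it with
deviation t/2. -/
lemma prob_upper_tail_le (h0 : 0 < p) (h1 : p ≤ 1) {E : Finset (Finset α)} {k : ℕ} {D : ℝ}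
    (hk : 2 ≤ k) (hD : 0 < D) (h : AlmostLinear V E k D) {s₁ s₂ s₃ m₁ m₂ : ℕ} (hs₁ : 1 ≤ s₁)
    (hs₂ : 1 ≤ s₂) (hs₃ : 1 ≤ s₃) {t m : ℝ} (ht : 0 < t) (hm : 0 < m)
    (hmE : ∑ e ∈ E, p ^ #e = m)
    (ht₁ : 4 * (m₁ * (s₁ * k) * (s₂ * (k * D))) ≤ t)
    (ht₂ : 4 * (m₂ * (s₂ * k) * (s₃ * (k * D))) ≤ t) :
    prob V p (fun S => m + t ≤ count E S) ≤
      exp (-(t / (4 * (k * (s₁ * (k * D)))) * log (1 + t / (4 * m)))) +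
        ((∑ U ∈ stars V E s₁, p ^ #U) ^ (m₁ + 1) + (∑ U ∈ stars V E s₂, p ^ #U) ^ (m₂ + 1) +
          ∑ U ∈ stars V E s₃, p ^ #U) := by
  have hC : 0 < (k * (s₁ * (k * D)) : ℝ) := by
    have : (0 : ℝ) < k := by exact_mod_cast (by omega : 0 < k)
    have : (0 : ℝ) < s₁ := by exact_mod_cast hs₁
    positivity
  have hch := prob_large_bounded_le_exp h0.le h1 hC (half_pos ht) hm h.subset hmE
  have e1 : t / 2 / (2 * (k * (s₁ * (k * D)))) = t / (4 * (k * (s₁ * (k * D)))) := by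
    rw [div_div]; ring_nf
  have e2 : t / 2 / (2 * m) = t / (4 * m) := by rw [div_div]; ring_nf
  rw [e1, e2] at hch
  have hb₁ := prob_hasStars_le h0.le h1 h.subset s₁ m₁
  have hb₂ := prob_hasStars_le h0.le h1 h.subset s₂ m₂
  have hb₃ := prob_hasStars_le h0.le h1 h.subset s₃ 0
  rw [zero_add, pow_one] at hb₃
  refine (prob_mono h0.le h1 (B := fun S => (∃ J ⊆ {f ∈ E | f ⊆ S},
        (∀ U ∈ J, (#{f ∈ J | ¬ Disjoint U f} : ℝ) ≤ k * (s₁ * (k * D))) ∧ m + t / 2 ≤ #J) ∨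
        ((HasStars V E s₁ (m₁ + 1) S ∨ HasStars V E s₂ (m₂ + 1) S) ∨
          HasStars V E s₃ 1 S)) ?_).trans ?_
  · intro S _ hS
    by_contra! hcon
    obtain ⟨hJ, ⟨hn₁, hn₂⟩, hn₃⟩ := hcon
    obtain ⟨J, hJ1, hJ2, hJ3⟩ := exists_large_bounded hk hD.le h hs₁ hs₂ hs₃ hn₁ hn₂ hn₃
    have := hJ J hJ1 hJ2
    linarith
  · refine (prob_or_le h0.le h1 _ _).trans (add_le_add hch ?_)
    refine (prob_or_le h0.le h1 _ _).trans (add_le_add ?_ hb₃)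
    exact (prob_or_le h0.le h1 _ _).trans (add_le_add hb₁ hb₂)

end BinomialSubset

/-! ### Dense almost linear families and the polynomially sparse upper bound. -/

namespace BinomialSubset

open Finset

variable {α : Type*} [DecidableEq α] {V : Finset α} {p : ℝ}

/-- An almost linear family with at most `D * n` points and at least `a * n ^ 2` members. -/
structure DenseAlmostLinear (V : Finset α) (E : Finset (Finset α)) (k : ℕ) (a D : ℝ) (n : ℕ) : Prop
    extends AlmostLinear V E k D where
  card_vertices_le : (#V : ℝ) ≤ D * n
  le_card_edges : a * (n : ℝ) ^ 2 ≤ #E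

namespace DenseAlmostLinear

variable {E : Finset (Finset α)} {k n : ℕ} {a D : ℝ}

lemma degree_le (h : DenseAlmostLinear V E k a D n) (hk : 2 ≤ k) (hD : 0 ≤ D) (v : α) :
    (#{e ∈ E | v ∈ e} : ℝ) ≤ D ^ 2 * n := by
  have hsub : {e ∈ E | v ∈ e} ⊆ (V.erase v).biUnion fun u => {e ∈ E | v ∈ e ∧ u ∈ e} := by
    intro e he
    obtain ⟨he, hv⟩ := mem_filter.1 he
    obtain ⟨u, hu, huv⟩ := exists_mem_ne (show 1 < #e by rw [h.card e he]; omega) v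
    exact mem_biUnion.2 ⟨u, mem_erase.2 ⟨huv, h.subset e he hu⟩, mem_filter.2 ⟨he, hv, hu⟩⟩
  calc (#{e ∈ E | v ∈ e} : ℝ) ≤ ∑ u ∈ V.erase v, (#{e ∈ E | v ∈ e ∧ u ∈ e} : ℝ) := by
        exact_mod_cast (card_le_card hsub).trans card_biUnion_le
    _ ≤ ∑ u ∈ V.erase v, D := sum_le_sum fun u hu => h.codegree v u (mem_erase.1 hu).1.symm
    _ = #(V.erase v) * D := by rw [sum_const, nsmul_eq_mul]
    _ ≤ #V * D := mul_le_mul_of_nonneg_right (by exact_mod_cast card_le_card (erase_subset _ _)) hD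
    _ ≤ D * n * D := mul_le_mul_of_nonneg_right h.card_vertices_le hD
    _ = D ^ 2 * n := by ring

lemma card_edges_le (h : DenseAlmostLinear V E k a D n) (hk : 2 ≤ k) (hD : 0 ≤ D) :
    (#E : ℝ) ≤ D ^ 3 * n ^ 2 := by
  have hsub : E ⊆ V.biUnion fun v => {e ∈ E | v ∈ e} := by
    intro e he
    obtain ⟨u, hu⟩ := card_pos.1 (show 0 < #e by rw [h.card e he]; omega)
    exact mem_biUnion.2 ⟨u, h.subset e he hu, mem_filter.2 ⟨he, hu⟩⟩
  calc (#E : ℝ) ≤ ∑ v ∈ V, (#{e ∈ E | v ∈ e} : ℝ) := by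
        exact_mod_cast (card_le_card hsub).trans card_biUnion_le
    _ ≤ ∑ v ∈ V, D ^ 2 * n := sum_le_sum fun v _ => h.degree_le hk hD v
    _ = #V * (D ^ 2 * n) := by rw [sum_const, nsmul_eq_mul]
    _ ≤ D * n * (D ^ 2 * n) := mul_le_mul_of_nonneg_right h.card_vertices_le (by positivity)
    _ = D ^ 3 * n ^ 2 := by ring

lemma sum_pow_card (h : DenseAlmostLinear V E k a D n) (p : ℝ) :
    ∑ e ∈ E, p ^ #e = #E * p ^ k := by
  rw [sum_congr rfl fun e he => by rw [h.card e he], sum_const, nsmul_eq_mul]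

lemma sum_stars_le (h : DenseAlmostLinear V E k a D n) (hk : 2 ≤ k) (hD : 0 ≤ D) (h0 : 0 ≤ p)
    (h1 : p ≤ 1) {s : ℕ} (hs : 1 ≤ s) :
    ∑ U ∈ stars V E s, p ^ #U ≤ D * n * (exp 1 * D ^ 2 * (n * p ^ (k - 1)) / s) ^ s := by
  refine (BinomialSubset.sum_stars_le h0 h.card hs (fun v _ => h.degree_le hk hD v)).trans ?_
  have e1 : exp 1 * (D ^ 2 * n) * p ^ (k - 1) / s = exp 1 * D ^ 2 * (n * p ^ (k - 1)) / s := by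
    ring
  rw [e1]
  refine mul_le_mul_of_nonneg_right ?_ (by positivity)
  calc (#V : ℝ) * p ≤ D * n * 1 :=
        mul_le_mul h.card_vertices_le h1 h0 (by positivity)
    _ = D * n := mul_one _

/-- Here L is the cost per edge of a star. The allowed numbers of disjoint stars are ⌊t/(4Kss')⌋
with K = k²D, the largest for which a round deletes at most t/4 edges. Exceeding such a number takes
more than t/(4Kss') stars of s edges, hence costs at least L t/(4Ks'), and never less than the cost
L s of one star. The factors 1/(3n) of the three events add up to the final 1/n. -/
lemma prob_upper_tail_le (h : DenseAlmostLinear V E k a D n) (hk : 2 ≤ k) (hD : 1 ≤ D)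
    (hn : 1 ≤ n) (h0 : 0 < p) (h1 : p ≤ 1) (hE : 0 < #E) {t : ℝ} (ht : 0 < t)
    {s₁ s₂ s₃ : ℕ} (hs₁ : 1 ≤ s₁) (hs₂ : 1 ≤ s₂) (hs₃ : 1 ≤ s₃) {L₁ L₂ L₃ B : ℝ}
    (hL₁ : 0 ≤ L₁) (hL₂ : 0 ≤ L₂)
    (hA₁ : ∑ U ∈ stars V E s₁, p ^ #U ≤ exp (-(L₁ * s₁)) / (3 * n))
    (hA₂ : ∑ U ∈ stars V E s₂, p ^ #U ≤ exp (-(L₂ * s₂)) / (3 * n))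
    (hA₃ : ∑ U ∈ stars V E s₃, p ^ #U ≤ exp (-(L₃ * s₃)) / (3 * n))
    (hB₁ : B ≤ L₁ * s₁ ∨ B ≤ L₁ * (t / (4 * (k ^ 2 * D) * s₂)))
    (hB₂ : B ≤ L₂ * s₂ ∨ B ≤ L₂ * (t / (4 * (k ^ 2 * D) * s₃)))
    (hB₃ : B ≤ L₃ * s₃) :
    prob V p (fun S => #E * p ^ k + t ≤ count E S) ≤
      exp (-(t / (16 * (k ^ 2 * D) * s₁) * log (1 + t / (#E * p ^ k)))) + exp (-B) / n := by
  have hn0 : (1 : ℝ) ≤ n := by exact_mod_cast hn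
  have hk0 : (0 : ℝ) < k := by exact_mod_cast (by omega : 0 < k)
  have hE0 : (0 : ℝ) < #E := by exact_mod_cast hE
  have hs₁0 : (0 : ℝ) < s₁ := by exact_mod_cast hs₁
  have hs₂0 : (0 : ℝ) < s₂ := by exact_mod_cast hs₂
  have hs₃0 : (0 : ℝ) < s₃ := by exact_mod_cast hs₃
  have hD0 : 0 < D := by linarith
  have hm : 0 < #E * p ^ k := by positivity
  set K := k ^ 2 * D with hK
  have hK0 : 0 < K := by positivity
  have hpow : ∀ (s s' : ℕ) (L : ℝ), 0 ≤ L → (1 : ℕ) ≤ s → (1 : ℕ) ≤ s' →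
      ∑ U ∈ stars V E s, p ^ #U ≤ exp (-(L * s)) / (3 * n) →
      (B ≤ L * s ∨ B ≤ L * (t / (4 * K * s'))) →
      (∑ U ∈ stars V E s, p ^ #U) ^ (⌊t / (4 * K * s * s')⌋₊ + 1) ≤ exp (-B) / (3 * n) := by
    intro s s' L hL hs hs' hA hB
    have hs0 : (0 : ℝ) < s := by exact_mod_cast hs
    have hs0' : (0 : ℝ) < s' := by exact_mod_cast hs'
    set r := ⌊t / (4 * K * s * s')⌋₊ with hr
    have hr2 : t / (4 * K * s * s') < r + 1 := Nat.lt_floor_add_one _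
    have hsr : t / (4 * K * s') ≤ s * (r + 1) := by
      calc t / (4 * K * s') = s * (t / (4 * K * s * s')) := by field_simp
        _ ≤ s * (r + 1) := mul_le_mul_of_nonneg_left hr2.le hs0.le
    have hBr : B ≤ L * (s * (r + 1)) := by
      rcases hB with hB | hB
      · refine hB.trans (mul_le_mul_of_nonneg_left ?_ hL)
        have : (0 : ℝ) ≤ r := by positivity
        nlinarith
      · exact hB.trans (mul_le_mul_of_nonneg_left hsr hL)
    have h3n : (1 : ℝ) ≤ 3 * n := by linarith
    calc (∑ U ∈ stars V E s, p ^ #U) ^ (r + 1) ≤ (exp (-(L * s)) / (3 * n)) ^ (r + 1) :=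
          pow_le_pow_left₀ (sum_nonneg fun _ _ => by positivity) hA _
      _ = exp (-(L * (s * (r + 1)))) / (3 * n) ^ (r + 1) := by
          rw [div_pow, ← exp_nat_mul]; congr 2; push_cast; ring
      _ ≤ exp (-B) / (3 * n) := by
          refine div_le_div₀ (exp_pos _).le (exp_le_exp.2 (neg_le_neg hBr)) (by positivity) ?_
          exact le_self_pow₀ h3n (by omega)
  have hfl : ∀ s s' : ℕ, (1 : ℕ) ≤ s → (1 : ℕ) ≤ s' →
      4 * ((⌊t / (4 * K * s * s')⌋₊ : ℝ) * (s * k) * (s' * (k * D))) ≤ t := by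
    intro s s' hs hs'
    have hs0 : (0 : ℝ) < s := by exact_mod_cast hs
    have hs0' : (0 : ℝ) < s' := by exact_mod_cast hs'
    have := Nat.floor_le (show 0 ≤ t / (4 * K * s * s') by positivity)
    rw [le_div_iff₀ (by positivity)] at this
    refine le_trans (le_of_eq ?_) this
    rw [hK]; ring
  have hmain := BinomialSubset.prob_upper_tail_le h0 h1 hk hD0 h.toAlmostLinear hs₁ hs₂ hs₃ ht hm
    (h.sum_pow_card p) (hfl s₁ s₂ hs₁ hs₂) (hfl s₂ s₃ hs₂ hs₃)
  have h1' := hpow s₁ s₂ L₁ hL₁ hs₁ hs₂ hA₁ hB₁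
  have h2' := hpow s₂ s₃ L₂ hL₂ hs₂ hs₃ hA₂ hB₂
  have h3' : ∑ U ∈ stars V E s₃, p ^ #U ≤ exp (-B) / (3 * n) := by
    refine hA₃.trans (div_le_div_of_nonneg_right (exp_le_exp.2 (neg_le_neg hB₃)) (by positivity))
  have h4' : exp (-(t / (4 * (k * (s₁ * (k * D)))) * log (1 + t / (4 * (#E * p ^ k))))) ≤
      exp (-(t / (16 * K * s₁) * log (1 + t / (#E * p ^ k)))) := by
    apply exp_le_exp.2
    apply neg_le_neg
    set y := t / (4 * (#E * p ^ k)) with hy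
    have hy0 : 0 < y := by positivity
    have hy4 : t / (#E * p ^ k) = 4 * y := by rw [hy]; field_simp
    rw [hy4]
    -- From 1 + 4y ≤ (1 + y)⁴. This passes from t/(4μ) to t/μ inside the logarithm and turns the
    -- constant 4 into 16.
    have hlog : log (1 + 4 * y) ≤ 4 * log (1 + y) := by
      rw [← log_rpow (by positivity)]
      apply log_le_log (by positivity)
      norm_cast
      have := one_add_mul_le_pow (show (-2 : ℝ) ≤ y by linarith) 4
      push_cast at this
      linarith
    have e : t / (4 * (k * (s₁ * (k * D)))) = 4 * (t / (16 * K * s₁)) := by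
      rw [hK]; field_simp; norm_num
    rw [e]
    have : 0 ≤ t / (16 * K * s₁) := by positivity
    nlinarith
  have e3 : exp (-B) / n = exp (-B) / (3 * n) + exp (-B) / (3 * n) + exp (-B) / (3 * n) := by
    field_simp; norm_num
  rw [e3]
  linarith

/-- When all stars with at least s₀ edges cost L per edge, two sizes suffice: s₀ and s₂ = s₃ =
max(s₀, ⌈√t⌉). If √t ≤ s₀, one star of size s₀ is already expensive enough. Otherwise s₃ ≤ 2√t, so
the disjoint s₀-stars needed have at least t/(4Ks₃) ≥ √t/(8K) edges. -/
lemma prob_upper_tail_le_of_forall_le (h : DenseAlmostLinear V E k a D n) (hk : 2 ≤ k)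
    (hD : 1 ≤ D) (hn : 1 ≤ n) (h0 : 0 < p) (h1 : p ≤ 1) (hE : 0 < #E) {t : ℝ} (ht : 0 < t)
    {s₀ : ℕ} (hs₀1 : 1 ≤ s₀) {L : ℝ} (hL : 0 ≤ L)
    (hA : ∀ s : ℕ, s₀ ≤ s → ∑ U ∈ stars V E s, p ^ #U ≤ exp (-(L * s)) / (3 * n)) :
    prob V p (fun S => #E * p ^ k + t ≤ count E S) ≤
      exp (-(t / (16 * (k ^ 2 * D) * s₀) * log (1 + t / (#E * p ^ k)))) +
        exp (-(L * (√t / (8 * (k ^ 2 * D))))) / n := by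
  have hk2 : (2 : ℝ) ≤ k := by exact_mod_cast hk
  have hD0 : 0 < D := by linarith
  set s₃ := max s₀ ⌈√t⌉₊ with hs₃
  have hs₃1 : 1 ≤ s₃ := hs₀1.trans (le_max_left _ _)
  have hs₃t : √t ≤ s₃ := (Nat.le_ceil _).trans (by exact_mod_cast le_max_right _ _)
  have hK8 : 1 ≤ 8 * (k ^ 2 * D) := by nlinarith [mul_le_mul hk2 hD zero_le_one (by linarith)]
  have hsq : √t / (8 * (k ^ 2 * D)) ≤ √t := div_le_self (sqrt_nonneg _) hK8
  have hone : √t / (8 * (k ^ 2 * D)) ≤ s₀ ∨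
      √t / (8 * (k ^ 2 * D)) ≤ t / (4 * (k ^ 2 * D) * s₃) := by
    by_cases hc : √t ≤ s₀
    · exact Or.inl (hsq.trans hc)
    · right
      push Not at hc
      have ht1 : 1 ≤ √t := le_trans (by exact_mod_cast hs₀1) hc.le
      have hs₃2 : (s₃ : ℝ) ≤ 2 * √t := by
        rw [hs₃, Nat.cast_max]
        refine max_le (by linarith) ?_
        have := Nat.ceil_lt_add_one (sqrt_nonneg t)
        linarith
      have hs₃0 : (0 : ℝ) < s₃ := by exact_mod_cast hs₃1
      rw [div_le_div_iff₀ (by positivity) (by positivity)]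
      have e : t = √t * √t := (mul_self_sqrt ht.le).symm
      calc √t * (4 * (k ^ 2 * D) * s₃) ≤ √t * (4 * (k ^ 2 * D) * (2 * √t)) := by gcongr
        _ = (√t * √t) * (8 * (k ^ 2 * D)) := by ring
        _ = t * (8 * (k ^ 2 * D)) := by rw [← e]
  refine h.prob_upper_tail_le hk hD hn h0 h1 hE ht hs₀1 hs₃1 hs₃1 hL hL (hA _ le_rfl)
    (hA _ (le_max_left _ _)) (hA _ (le_max_left _ _)) ?_ (Or.inl ?_) ?_
  · exact hone.imp (mul_le_mul_of_nonneg_left · hL) (mul_le_mul_of_nonneg_left · hL)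
  · exact mul_le_mul_of_nonneg_left (hsq.trans hs₃t) hL
  · exact mul_le_mul_of_nonneg_left (hsq.trans hs₃t) hL

/-- The upper bound for densities that are polynomially smaller than `n ^ (-1 / (k - 1))`. -/
lemma prob_upper_tail_le_of_sparse (h : DenseAlmostLinear V E k a D n) (hk : 2 ≤ k) (hD : 1 ≤ D)
    (hn : 1 ≤ n) (h0 : 0 < p) (h1 : p ≤ 1) (hE : 0 < #E) {t : ℝ} (ht : 0 < t) {η : ℝ} (hη : 0 < η)
    (hη1 : η ≤ 1) (hq : n * p ^ (k - 1) ≤ p ^ η)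
    (hp : 4 / η * (2 + 2 * log D + log (3 * D)) ≤ -log p) :
    prob V p (fun S => #E * p ^ k + t ≤ count E S) ≤
      exp (-(t / (16 * (k ^ 2 * D) * ⌈8 * k / η⌉₊) * log (1 + t / (#E * p ^ k)))) +
        exp (-(η / 4 * (1 - log p) * (√t / (8 * (k ^ 2 * D))))) / n := by
  have hn0 : (1 : ℝ) ≤ n := by exact_mod_cast hn
  have hk2 : (2 : ℝ) ≤ k := by exact_mod_cast hk
  have hD0 : 0 < D := by linarith
  set ℓ := -log p with hℓ
  have hℓ0 : 0 ≤ ℓ := by rw [hℓ]; linarith [log_nonpos h0.le h1]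
  set s₀ := ⌈8 * k / η⌉₊ with hs₀
  have hs₀' : 8 * k / η ≤ s₀ := Nat.le_ceil _
  have hs₀1 : 1 ≤ s₀ := Nat.one_le_iff_ne_zero.2 (Nat.pos_iff_ne_zero.1 (Nat.ceil_pos.2 (by positivity)))
  -- An s-star has weight about p^(ηs), up to constants to the power s and a factor n. Since n ≤
  -- p^(-(k-1)), the size s₀ = ⌈8k/η⌉ lets a quarter of the exponent absorb n², and `hp` lets
  -- another quarter absorb the constants.
  have hA : ∀ s : ℕ, s₀ ≤ s →
      ∑ U ∈ stars V E s, p ^ #U ≤ exp (-(η / 4 * (1 - log p) * s)) / (3 * n) := by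
    intro s hs
    have hs1 : 1 ≤ s := hs₀1.trans hs
    have hsr : (1 : ℝ) ≤ s := by exact_mod_cast hs1
    have hs8 : 8 * k ≤ η * s := by
      have : 8 * k / η ≤ s := hs₀'.trans (by exact_mod_cast hs)
      rw [div_le_iff₀ hη] at this
      linarith
    refine (h.sum_stars_le hk hD0.le h0.le h1 hs1).trans ?_
    rw [le_div_iff₀ (by positivity)]
    have e1 : exp 1 * D ^ 2 * (n * p ^ (k - 1)) / s ≤ exp (1 + 2 * log D - η * ℓ) := by
      have : exp (1 + 2 * log D - η * ℓ) = exp 1 * D ^ 2 * p ^ η := by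
        rw [rpow_def_of_pos h0, sub_eq_add_neg, exp_add, exp_add, two_mul, exp_add, exp_log hD0, sq,
          hℓ]
        congr 2
        ring
      rw [this]
      calc exp 1 * D ^ 2 * (n * p ^ (k - 1)) / s ≤ exp 1 * D ^ 2 * (n * p ^ (k - 1)) / 1 :=
            div_le_div_of_nonneg_left (by positivity) one_pos hsr
        _ ≤ exp 1 * D ^ 2 * p ^ η := by
            rw [div_one]; exact mul_le_mul_of_nonneg_left hq (by positivity)
    have e2 : (n : ℝ) ≤ exp ((k - 1) * ℓ) := by
      have h2 : n * p ^ (k - 1) ≤ 1 := hq.trans (rpow_le_one h0.le h1 hη.le)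
      have h3 : exp ((k - 1) * ℓ) * p ^ (k - 1) = 1 := by
        have : p ^ (k - 1) = exp (-((k - 1) * ℓ)) := by
          rw [hℓ, ← exp_log (pow_pos h0 (k - 1)), log_pow, Nat.cast_sub (by omega)]
          congr 1
          push_cast; ring
        rw [this, ← exp_add]; simp
      have h4 : 0 < p ^ (k - 1) := by positivity
      nlinarith
    calc D * n * (exp 1 * D ^ 2 * (n * p ^ (k - 1)) / s) ^ s * (3 * n)
        = (3 * D) * n ^ 2 * (exp 1 * D ^ 2 * (n * p ^ (k - 1)) / s) ^ s := by ring
      _ ≤ (3 * D) * exp ((k - 1) * ℓ) ^ 2 * exp (1 + 2 * log D - η * ℓ) ^ s := by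
          gcongr
      _ = exp (log (3 * D) + 2 * ((k - 1) * ℓ) + s * (1 + 2 * log D - η * ℓ)) := by
          rw [exp_add, exp_add, exp_log (by positivity), ← exp_nat_mul, ← exp_nat_mul]
          norm_num
      _ ≤ exp (-(η / 4 * (1 - log p) * s)) := by
          apply exp_le_exp.2
          have hl : 0 ≤ log (3 * D) := log_nonneg (by linarith)
          have hlD : 0 ≤ log D := log_nonneg hD
          have h5 : 2 + 2 * log D + log (3 * D) ≤ η / 4 * ℓ := by
            have := mul_le_mul_of_nonneg_left hp (show 0 ≤ η / 4 by positivity)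
            have e : η / 4 * (4 / η * (2 + 2 * log D + log (3 * D))) =
              2 + 2 * log D + log (3 * D) := by field_simp
            linarith
          have h6 : 2 * (k - 1) * ℓ ≤ η / 4 * ℓ * s := by nlinarith
          have h7 : (2 + 2 * log D + log (3 * D)) * s ≤ η / 4 * ℓ * s :=
            mul_le_mul_of_nonneg_right h5 (by linarith)
          have h8 : log (3 * D) ≤ log (3 * D) * s := by nlinarith
          have h9 : η / 4 * s ≤ s := by nlinarith
          have : 1 - log p = 1 + ℓ := by rw [hℓ]; ring
          rw [this]
          nlinarith
  have hL : 0 ≤ η / 4 * (1 - log p) := by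
    have : 0 ≤ 1 - log p := by linarith [log_nonpos h0.le h1]
    positivity
  exact h.prob_upper_tail_le_of_forall_le hk hD hn h0 h1 hE ht hs₀1 hL hA

end DenseAlmostLinear

end BinomialSubset

/-! ### The upper bound above the polynomially sparse range. -/

namespace BinomialSubset

open Finset

namespace DenseAlmostLinear

/-- Beyond s = e⁴D²(q + log n)Q the base (eD²q)/s is at most e⁻³/Q, and 3Dn² ≤ n⁴ ≤ e^(2s) since s ≥
2 log n. The parameter Q makes larger stars dearer per edge: a power of 1/p for Q gives a cost of
order log(e/p). -/
lemma sum_stars_le_exp {α : Type*} [DecidableEq α] {V : Finset α} {p : ℝ}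
    {E : Finset (Finset α)} {k n : ℕ} {a D : ℝ}
    (h : DenseAlmostLinear V E k a D n) (hk : 2 ≤ k) (hD : 1 ≤ D)
    (hn : 3 ≤ n) (hnD : 3 * D ≤ (n : ℝ) ^ 2) (h0 : 0 < p) (h1 : p ≤ 1) {Q : ℝ} (hQ : 1 ≤ Q) {s : ℕ}
    (hs : exp 4 * D ^ 2 * (n * p ^ (k - 1) + log n) * Q ≤ s) :
    ∑ U ∈ stars V E s, p ^ #U ≤ exp (-((1 + log Q) * s)) / (3 * n) := by
  have hn0 : (3 : ℝ) ≤ n := by exact_mod_cast hn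
  have hD0 : 0 < D := by linarith
  have hlog : 1 ≤ log n := by
    rw [le_log_iff_exp_le (by linarith)]
    linarith [exp_one_lt_d9]
  have he4 : 2 ≤ exp 4 := by linarith [add_one_le_exp (4 : ℝ)]
  set q := n * p ^ (k - 1) with hq
  have hq0 : 0 < q := by positivity
  set K := exp 4 * D ^ 2 with hK
  have hK2 : 2 ≤ K := by nlinarith [one_le_pow₀ (n := 2) hD]
  have hg1 : K * q * Q ≤ s := le_trans (by gcongr; linarith) hs
  have hg2 : 2 * log n ≤ s := by
    refine le_trans ?_ hs
    calc 2 * log n ≤ K * (q + log n) := by gcongr; linarith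
      _ ≤ K * (q + log n) * Q := le_mul_of_one_le_right (by positivity) hQ
  have hs0 : (0 : ℝ) < s := by linarith
  have hs1 : 1 ≤ s := by exact_mod_cast hs0
  refine (h.sum_stars_le hk hD0.le h0.le h1 hs1).trans ?_
  rw [le_div_iff₀ (by positivity)]
  have e1 : exp 1 * D ^ 2 * q / s ≤ exp (-3 - log Q) := by
    rw [div_le_iff₀ hs0, exp_sub, exp_log (by linarith), div_mul_eq_mul_div, le_div_iff₀ (by linarith)]
    calc exp 1 * D ^ 2 * q * Q = exp (-3) * (K * q * Q) := by
          rw [hK]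
          have : exp 1 = exp (-3) * exp 4 := by rw [← exp_add]; norm_num
          rw [this]; ring
      _ ≤ exp (-3) * s := by gcongr
  have e2 : 3 * D * n ^ 2 ≤ exp (2 * s) := by
    calc 3 * D * n ^ 2 ≤ (n : ℝ) ^ 2 * n ^ 2 := by gcongr
      _ = exp (4 * log n) := by
        rw [show (4 : ℝ) * log n = ((4 : ℕ) : ℝ) * log n by norm_num, exp_nat_mul,
          exp_log (by linarith)]
        ring
      _ ≤ exp (2 * s) := exp_le_exp.2 (by linarith)
  calc D * n * (exp 1 * D ^ 2 * q / s) ^ s * (3 * n)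
      = 3 * D * n ^ 2 * (exp 1 * D ^ 2 * q / s) ^ s := by ring
    _ ≤ exp (2 * s) * exp (-3 - log Q) ^ s := by gcongr
    _ = exp (-((1 + log Q) * s)) := by
      rw [← exp_nat_mul, ← exp_add]; congr 1; ring

end DenseAlmostLinear

/-- For moderate t the rate with denominator g = q + log n is O(√t), so stars need only cost a
constant per edge and no logarithm is required. Indeed g² ≤ 4n²p^k√p and P⁶√p = 1 give t^(3/2) ≤
g³P⁶ ≤ (4/a) g m, while log(1 + t/m) ≤ t/m. -/
lemma mul_log_div_le {k n : ℕ} (hk : 3 ≤ k) {a p t m P : ℝ} (ha : 0 < a) (h0 : 0 < p) (h1 : p ≤ 1)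
    (ht : 0 < t) (hq0 : 0 ≤ n * p ^ (k - 1)) (hlog : 1 ≤ log n) (hm0 : 0 < m)
    (hma : a * (n ^ 2 * p ^ k) ≤ m) (hH : log n ^ 2 ≤ (n : ℝ) ^ 2 * p ^ k * √p)
    (hP6 : P ^ 6 * √p = 1) (hcase : √t ≤ (n * p ^ (k - 1) + log n) * P ^ 2) :
    t * log (1 + t / m) / (n * p ^ (k - 1) + log n) ≤ 4 / a * √t := by
  have hsp : p ^ (k - 2) ≤ √p := by
    calc p ^ (k - 2) ≤ p ^ 1 := pow_le_pow_of_le_one h0.le h1 (by omega)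
      _ = √p * √p := by rw [pow_one, mul_self_sqrt h0.le]
      _ ≤ √p * 1 := mul_le_mul_of_nonneg_left (sqrt_le_one.2 h1) (sqrt_nonneg _)
      _ = √p := mul_one _
  have hq2 : (n * p ^ (k - 1)) ^ 2 ≤ n ^ 2 * p ^ k * √p := by
    have : (n * p ^ (k - 1)) ^ 2 = n ^ 2 * p ^ k * p ^ (k - 2) := by
      rw [mul_pow, ← pow_mul, mul_assoc, ← pow_add]
      congr 2
      omega
    rw [this]
    exact mul_le_mul_of_nonneg_left hsp (by positivity)
  have hg2 : (n * p ^ (k - 1) + log n) ^ 2 ≤ 4 * (n ^ 2 * p ^ k) * √p := by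
    linarith [add_sq_le (a := n * p ^ (k - 1)) (b := log n)]
  set g := n * p ^ (k - 1) + log n
  have hg0 : 0 < g := by linarith
  have ht3 : √t ^ 3 ≤ g ^ 3 * P ^ 6 := by
    calc √t ^ 3 ≤ (g * P ^ 2) ^ 3 := pow_le_pow_left₀ (sqrt_nonneg _) hcase _
      _ = g ^ 3 * P ^ 6 := by ring
  have ht3' : √t ^ 3 ≤ g * (4 / a * m) := by
    have h1 : g ^ 2 * P ^ 6 ≤ 4 * (n ^ 2 * p ^ k) := by
      calc g ^ 2 * P ^ 6 ≤ 4 * (n ^ 2 * p ^ k) * √p * P ^ 6 :=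
            mul_le_mul_of_nonneg_right hg2 (by positivity)
        _ = 4 * (n ^ 2 * p ^ k) * (P ^ 6 * √p) := by ring
        _ = 4 * (n ^ 2 * p ^ k) := by rw [hP6, mul_one]
    have h2 : 4 * (n ^ 2 * p ^ k) ≤ 4 / a * m := by
      rw [div_mul_eq_mul_div, le_div_iff₀ ha]
      linarith
    calc √t ^ 3 ≤ g ^ 3 * P ^ 6 := ht3
      _ = g * (g ^ 2 * P ^ 6) := by ring
      _ ≤ g * (4 / a * m) := mul_le_mul_of_nonneg_left (h1.trans h2) hg0.le
  have hl : log (1 + t / m) ≤ t / m := by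
    have := log_le_sub_one_of_pos (show 0 < 1 + t / m by positivity)
    linarith
  rw [div_le_iff₀ hg0]
  have e : t = √t * √t := (mul_self_sqrt ht.le).symm
  calc t * log (1 + t / m) ≤ t * (t / m) := mul_le_mul_of_nonneg_left hl ht.le
    _ = √t * (√t ^ 3 / m) := by
      rw [← mul_div_assoc, ← mul_div_assoc]
      congr 1
      have h4 : √t * √t ^ 3 = (√t * √t) * (√t * √t) := by ring
      rw [h4, ← e]
    _ ≤ √t * (g * (4 / a * m) / m) :=
      mul_le_mul_of_nonneg_left (div_le_div_of_nonneg_right ht3' hm0.le) (sqrt_nonneg _)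
    _ = 4 / a * √t * g := by field_simp

set_option maxHeartbeats 1600000 in
/-- The upper bound for densities with `log n ^ 2 ≤ n ^ 2 * p ^ (k + 1 / 2)`. -/
lemma exists_prob_upper_tail_le_of_dense {k : ℕ} (hk : 3 ≤ k) {a D : ℝ} (ha : 0 < a)
    (hD : 1 ≤ D) : ∃ c > 0, ∀ {α : Type*} [DecidableEq α] {V : Finset α}
      {E : Finset (Finset α)} {n : ℕ} {p t : ℝ}, DenseAlmostLinear V E k a D n → 3 ≤ n →
      3 * D ≤ (n : ℝ) ^ 2 → 0 < p → p ≤ 1 → 0 < t →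
      log n ^ 2 ≤ (n : ℝ) ^ 2 * p ^ k * √p →
      prob V p (fun S => #E * p ^ k + t ≤ count E S) ≤ (1 + (n : ℝ)⁻¹) *
        exp (-(c * min (t * log (1 + t / (#E * p ^ k)) / (n * p ^ (k - 1) + log n))
          (√t * (1 - log p)))) := by
  have hD0 : 0 < D := by linarith
  have hk3 : (3 : ℝ) ≤ k := by exact_mod_cast hk
  set K₀ : ℝ := k ^ 2 * D with hK₀
  have hK₀1 : 1 ≤ K₀ := one_le_mul_of_one_le_of_one_le (one_le_pow₀ (by linarith)) hD
  set K := exp 4 * D ^ 2 with hK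
  have hK1 : 1 ≤ K := one_le_mul_of_one_le_of_one_le
    (one_le_exp (by norm_num)) (one_le_pow₀ hD)
  refine ⟨min a 1 / (192 * K₀ * K), by positivity, ?_⟩
  intro α _ V E n p t h hn hnD h0 h1 ht hH
  set c := min a 1 / (192 * K₀ * K) with hc
  have hc0 : 0 < c := by positivity
  have hn0 : (3 : ℝ) ≤ n := by exact_mod_cast hn
  have hlog : 1 ≤ log n := by
    rw [le_log_iff_exp_le (by linarith)]
    linarith [exp_one_lt_d9]
  have hE : 0 < #E := by
    have : (0 : ℝ) < #E := lt_of_lt_of_le (by positivity) h.le_card_edges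
    exact_mod_cast this
  have hE0 : (0 : ℝ) < #E := by exact_mod_cast hE
  set m := #E * p ^ k with hm
  have hm0 : 0 < m := by positivity
  have hma : a * (n ^ 2 * p ^ k) ≤ m := by
    rw [hm, ← mul_assoc]; exact mul_le_mul_of_nonneg_right h.le_card_edges (by positivity)
  set q := n * p ^ (k - 1) with hq
  have hq0 : 0 < q := by positivity
  set g := q + log n with hg
  have hg1 : 1 ≤ g := by linarith
  set L := 1 - log p with hL
  have hL1 : 1 ≤ L := by linarith [log_nonpos h0.le h1]
  have hst : 0 < √t := sqrt_pos.2 ht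
  have hlt : 0 ≤ log (1 + t / m) := log_nonneg (by
    have : 0 < t / m := by positivity
    linarith)
  set ψ := t * log (1 + t / m) / g with hψ
  have hψ0 : 0 ≤ ψ := by positivity
  -- From this size on stars cost at least 1 per edge; after their removal degrees are of order g,
  -- which puts g into the denominator of the Chernoff exponent.
  set s₁ := ⌈K * g⌉₊ with hs₁
  have hs₁l : K * g ≤ s₁ := Nat.le_ceil _
  have hKg : 1 ≤ K * g := one_le_mul_of_one_le_of_one_le hK1 hg1
  have hs₁u : (s₁ : ℝ) ≤ 2 * (K * g) := by
    have := Nat.ceil_lt_add_one (show 0 ≤ K * g by positivity)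
    linarith
  have hs₁0 : (0 : ℝ) < s₁ := by linarith
  have hs₁1 : 1 ≤ s₁ := by exact_mod_cast hs₁0
  have hchern : c * min ψ (√t * L) ≤ t / (16 * K₀ * s₁) * log (1 + t / m) := by
    calc c * min ψ (√t * L) ≤ c * ψ := by gcongr; exact min_le_left _ _
      _ ≤ 1 / (32 * K₀ * K) * ψ := by
        gcongr
        rw [hc]
        gcongr
        · exact min_le_right _ _
        · norm_num
      _ = t / (16 * K₀ * (2 * (K * g))) * log (1 + t / m) := by
        rw [hψ]; field_simp; ring
      _ ≤ t / (16 * K₀ * s₁) * log (1 + t / m) := by gcongr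
  have hfinish : ∀ B : ℝ, c * min ψ (√t * L) ≤ B →
      prob V p (fun S => m + t ≤ count E S) ≤
        exp (-(t / (16 * K₀ * s₁) * log (1 + t / m))) + exp (-B) / n →
      prob V p (fun S => m + t ≤ count E S) ≤ (1 + (n : ℝ)⁻¹) * exp (-(c * min ψ (√t * L))) := by
    intro B hB hP
    refine hP.trans ?_
    rw [add_mul, one_mul, inv_mul_eq_div]
    gcongr
  -- A power of 1/p large enough to dominate L = log(e/p), yet small enough that P⁶ cancels the
  -- factor √p available in `hH`.
  set P := p ^ (-(1 / 12) : ℝ) with hP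
  have hP0 : 0 < P := rpow_pos_of_pos h0 _
  have hP1 : 1 ≤ P := one_le_rpow_of_pos_of_le_one_of_nonpos h0 h1 (by norm_num)
  have hlogP : log P = -log p / 12 := by rw [hP, log_rpow h0]; ring
  have hP6 : P ^ 6 * √p = 1 := by
    rw [hP, ← rpow_natCast, ← rpow_mul h0.le, sqrt_eq_rpow, ← rpow_add h0]
    norm_num
  have hLP : L ≤ 12 * P := by
    have := log_le_sub_one_of_pos hP0
    rw [hlogP] at this
    linarith
  by_cases hcase : √t ≤ g * P ^ 2
  · refine hfinish (1 * (√t / (8 * K₀))) ?_ (h.prob_upper_tail_le_of_forall_le (by omega) hD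
      (by omega) h0 h1 hE ht hs₁1 zero_le_one fun s hs => ?_)
    · have hψ2 : ψ ≤ 4 / a * √t :=
        mul_log_div_le hk ha h0 h1 ht hq0.le hlog hm0 hma hH hP6 hcase
      calc c * min ψ (√t * L) ≤ c * (4 / a * √t) := by
            gcongr; exact (min_le_left _ _).trans hψ2
        _ ≤ a / (32 * K₀) * (4 / a * √t) := by
            gcongr
            rw [hc]
            apply div_le_div₀ ha.le (min_le_left _ _) (by positivity)
            calc 32 * K₀ ≤ 192 * K₀ := by linarith
              _ ≤ 192 * K₀ * K := le_mul_of_one_le_right (by positivity) hK1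
        _ = 1 * (√t / (8 * K₀)) := by field_simp; ring
    · have := h.sum_stars_le_exp (by omega) hD hn hnD h0 h1 (Q := 1) le_rfl (s := s) (by
        rw [mul_one]; exact hs₁l.trans (by exact_mod_cast hs))
      rwa [log_one, add_zero] at this
  · push Not at hcase
    have hgt : g * P ≤ √t / P := by
      rw [le_div_iff₀ hP0]
      calc g * P * P = g * P ^ 2 := by ring
        _ ≤ √t := hcase.le
    have hgt' : g ≤ √t :=
      (le_mul_of_one_le_right (by linarith) (one_le_pow₀ hP1)).trans hcase.le
    -- Stars of size s₂ or more cost L/12 per edge. Because gP² < √t, s₂ is at most of order √t/P.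
    -- So the s₁-stars needed, at cost 1 per edge, contain order t/s₂ ≥ √t P edges up to constants,
    -- which exceeds √t L up to constants. The s₂-stars needed contain order t/s₃ edges, of order
    -- √t, and a single s₃-star has at least √t edges; both cost L/12 per edge.
    set s₂ := ⌈s₁ * P⌉₊ with hs₂
    have hs₂l : s₁ * P ≤ s₂ := Nat.le_ceil _
    have hsP : 1 ≤ s₁ * P := by
      have : (1 : ℝ) ≤ s₁ := by exact_mod_cast hs₁1
      exact one_le_mul_of_one_le_of_one_le this hP1
    have hs₂u : (s₂ : ℝ) ≤ 4 * K * (√t / P) := by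
      have := Nat.ceil_lt_add_one (show 0 ≤ s₁ * P by positivity)
      calc (s₂ : ℝ) ≤ 2 * (s₁ * P) := by linarith
        _ ≤ 2 * (2 * (K * g) * P) := by gcongr
        _ = 4 * K * (g * P) := by ring
        _ ≤ 4 * K * (√t / P) := by gcongr
    have hs₂0 : (0 : ℝ) < s₂ := by linarith
    have hs₂1 : 1 ≤ s₂ := by exact_mod_cast hs₂0
    set s₃ := max s₂ ⌈√t⌉₊ with hs₃
    have hs₃t : √t ≤ s₃ := (Nat.le_ceil _).trans (by exact_mod_cast le_max_right _ _)
    have hs₃u : (s₃ : ℝ) ≤ 4 * K * √t := by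
      rw [hs₃, Nat.cast_max]
      refine max_le ?_ ?_
      · refine hs₂u.trans ?_
        gcongr
        exact div_le_self hst.le hP1
      · have := Nat.ceil_lt_add_one (sqrt_nonneg t)
        calc (⌈√t⌉₊ : ℝ) ≤ 4 * 1 * √t := by linarith
          _ ≤ 4 * K * √t := by gcongr
    have hs₃1 : 1 ≤ s₃ := hs₂1.trans (le_max_left _ _)
    have hs₃0 : (0 : ℝ) < s₃ := by exact_mod_cast hs₃1
    have e : t = √t * √t := (mul_self_sqrt ht.le).symm
    have hA : ∀ s : ℕ, s₂ ≤ s →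
        ∑ U ∈ stars V E s, p ^ #U ≤ exp (-(L / 12 * s)) / (3 * n) := by
      intro s hs
      refine (h.sum_stars_le_exp (by omega) hD hn hnD h0 h1 hP1 (s := s) ?_).trans ?_
      · calc K * g * P ≤ s₁ * P := by gcongr
          _ ≤ s₂ := hs₂l
          _ ≤ s := by exact_mod_cast hs
      · gcongr
        rw [hlogP]
        linarith
    refine hfinish (√t * L / (192 * K₀ * K)) ?_ (h.prob_upper_tail_le (by omega) hD
      (by omega) h0 h1 hE ht hs₁1 hs₂1 hs₃1 (L₁ := 1) (L₂ := L / 12) (L₃ := L / 12) zero_le_one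
      (by positivity) ?_ (hA _ le_rfl) (hA _ (le_max_left _ _)) (Or.inr ?_) (Or.inr ?_) ?_)
    · calc c * min ψ (√t * L) ≤ 1 / (192 * K₀ * K) * (√t * L) := by
            gcongr
            · rw [hc]; gcongr; exact min_le_right _ _
            · exact min_le_right _ _
        _ = _ := by ring
    · have := h.sum_stars_le_exp (by omega) hD hn hnD h0 h1 (Q := 1) le_rfl (s := s₁) (by
        rw [mul_one]; exact hs₁l)
      rwa [log_one, add_zero] at this
    · calc √t * L / (192 * K₀ * K) ≤ √t * (12 * P) / (192 * K₀ * K) := by gcongr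
        _ = √t * √t / (4 * K₀ * (4 * K * (√t / P))) := by field_simp; norm_num
        _ ≤ √t * √t / (4 * K₀ * s₂) := by gcongr
        _ = 1 * (t / (4 * K₀ * s₂)) := by rw [one_mul, ← e]
    · calc √t * L / (192 * K₀ * K) = L / 12 * (√t * √t / (4 * K₀ * (4 * K * √t))) := by
            field_simp; norm_num
        _ ≤ L / 12 * (√t * √t / (4 * K₀ * s₃)) := by gcongr
        _ = L / 12 * (t / (4 * K₀ * s₃)) := by rw [← e]
    · calc √t * L / (192 * K₀ * K) ≤ √t * L / 12 := by
            gcongr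
            calc (12 : ℝ) ≤ 192 * K₀ := by linarith
              _ ≤ 192 * K₀ * K := le_mul_of_one_le_right (by positivity) hK1
        _ = L / 12 * √t := by ring
        _ ≤ L / 12 * s₃ := by gcongr

end BinomialSubset

/-! ### Estimates for the rate function, and bounded n. -/

namespace BinomialSubset

open Finset

lemma chernoffRate_le {x : ℝ} (hx : 0 ≤ x) : chernoffRate x ≤ x * log (1 + x) := by
  have := log_le_sub_one_of_pos (show 0 < 1 + x by linarith)
  rw [chernoffRate]; linarith

/-- With `chernoffRate_le` this allows φ(x) to be replaced by x log(1 + x) everywhere, at the cost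
of a factor 2. -/
lemma half_mul_log_le_chernoffRate {x : ℝ} (hx : 0 ≤ x) :
    x * log (1 + x) / 2 ≤ chernoffRate x := by
  have h := le_log_one_add_of_nonneg hx
  rw [div_le_iff₀ (by linarith)] at h
  rw [chernoffRate]
  linarith

lemma half_le_log_one_add {x : ℝ} (hx : 0 ≤ x) (hx1 : x ≤ 1) : x / 2 ≤ log (1 + x) := by
  refine le_trans ?_ (le_log_one_add_of_nonneg hx)
  rw [div_le_div_iff₀ (by norm_num) (by linarith)]
  nlinarith

lemma half_le_log_of_one_le {x : ℝ} (hx : 1 ≤ x) : 1 / 2 ≤ log (1 + x) := by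
  have := half_le_log_one_add zero_le_one le_rfl
  exact this.trans (log_le_log (by norm_num) (by linarith))

lemma eventually_mul_log_pow_le (C : ℝ) (j : ℕ) {y : ℝ} (hy : 0 < y) :
    ∀ᶠ n : ℕ in Filter.atTop, C * log n ^ j ≤ (n : ℝ) ^ y := by
  have h := (isLittleO_log_rpow_rpow_atTop (j : ℝ) hy).comp_tendsto tendsto_natCast_atTop_atTop
  have h2 := h.bound (show 0 < 1 / (|C| + 1) by positivity)
  filter_upwards [h2, Filter.eventually_ge_atTop 1] with n hn hn1
  have hn0 : (1 : ℝ) ≤ n := by exact_mod_cast hn1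
  have hl : 0 ≤ log (n : ℝ) := log_nonneg hn0
  simp only [Function.comp, rpow_natCast, norm_eq_abs] at hn
  rw [abs_of_nonneg (pow_nonneg hl j : 0 ≤ log (n : ℝ) ^ j), abs_of_nonneg (rpow_nonneg (by linarith) y),
    div_mul_eq_mul_div, one_mul, le_div_iff₀ (by positivity)] at hn
  have : 0 ≤ log (n : ℝ) ^ j := by positivity
  nlinarith [le_abs_self C]

/-- For `n` below a fixed bound, the upper bound holds with a small constant in the exponent. -/
lemma exists_prob_upper_tail_le_of_bounded {k : ℕ} (hk : 2 ≤ k) (a : ℝ) {D : ℝ} (hD : 1 ≤ D)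
    (n₁ : ℕ) : ∃ c > 0, ∀ {α : Type*} [DecidableEq α] {V : Finset α}
      {E : Finset (Finset α)} {n : ℕ} {p t : ℝ}, DenseAlmostLinear V E k a D n → 1 ≤ n →
      n ≤ n₁ → 0 < p → p ≤ 1 → 0 < t → 0 < #E →
      prob V p (fun S => #E * p ^ k + t ≤ count E S) ≤ (1 + (n : ℝ)⁻¹) *
        exp (-(c * (√t * (1 - log p)))) := by
  rcases Nat.eq_zero_or_pos n₁ with rfl | hn₁
  · exact ⟨1, one_pos, fun _ h h' => by omega⟩
  have hD0 : 0 < D := by linarith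
  have hn₁0 : (1 : ℝ) ≤ n₁ := by exact_mod_cast hn₁
  set A := D ^ 3 * (n₁ : ℝ) ^ 2 with hA
  have hA1 : 1 ≤ A := one_le_mul_of_one_le_of_one_le (one_le_pow₀ hD) (one_le_pow₀ hn₁0)
  have hA0 : 0 < A := by linarith
  set L₁ := 2 * (1 + log A) with hL₁
  have hL₁0 : 0 < L₁ := by have := log_nonneg hA1; positivity
  have hlog : 0 < log (1 + (n₁ : ℝ)⁻¹) := log_pos (by
    have : 0 < (n₁ : ℝ)⁻¹ := by positivity
    linarith)
  -- Only t ≤ A matters, since A bounds the number of edges. If log(e/p) ≤ L₁, the second entry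
  -- keeps the exponent below log(1 + 1/n₁), so the prefactor makes the bound trivial. For smaller p
  -- Markov's inequality gives probability at most A p, which the first entry is chosen to beat.
  set c := min (1 / (2 * √A)) (log (1 + (n₁ : ℝ)⁻¹) / (√A * L₁)) with hc
  have hsA : 0 < √A := sqrt_pos.2 hA0
  refine ⟨c, by positivity, ?_⟩
  intro α _ V E n p t h hn hnn h0 h1 ht hE
  have hn0 : (1 : ℝ) ≤ n := by exact_mod_cast hn
  have hnn0 : (n : ℝ) ≤ n₁ := by exact_mod_cast hnn
  have hEA : (#E : ℝ) ≤ A := (h.card_edges_le hk hD0.le).trans (by rw [hA]; gcongr)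
  have hE0 : (0 : ℝ) < #E := by exact_mod_cast hE
  set L := 1 - log p with hL
  have hL1 : 1 ≤ L := by linarith [log_nonpos h0.le h1]
  have hinv : (n₁ : ℝ)⁻¹ ≤ (n : ℝ)⁻¹ := inv_anti₀ (by linarith) hnn0
  by_cases hte : t ≤ A
  swap
  · have : prob V p (fun S => #E * p ^ k + t ≤ count E S) ≤ 0 := by
      refine (prob_le_expect_div h0.le h1 (f := fun _ => 0) (fun _ _ => le_rfl) one_pos ?_).trans
        (by rw [expect_const]; simp)
      intro S _ hS
      exfalso
      have h2 : (count E S : ℝ) ≤ #E := by exact_mod_cast card_filter_le _ _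
      have h3 : 0 ≤ #E * p ^ k := by positivity
      linarith
    exact this.trans (by positivity)
  have hst : √t ≤ √A := sqrt_le_sqrt hte
  by_cases hLL : L ≤ L₁
  · refine (prob_le_one h0.le h1 _).trans ?_
    have : c * (√t * L) ≤ log (1 + (n₁ : ℝ)⁻¹) := by
      calc c * (√t * L) ≤ log (1 + (n₁ : ℝ)⁻¹) / (√A * L₁) * (√A * L₁) := by
            gcongr
            exact min_le_right _ _
        _ = log (1 + (n₁ : ℝ)⁻¹) := by field_simp
    calc (1 : ℝ) = (1 + (n₁ : ℝ)⁻¹) * exp (-log (1 + (n₁ : ℝ)⁻¹)) := by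
          rw [exp_neg, exp_log (by positivity), mul_inv_cancel₀ (by positivity)]
      _ ≤ (1 + (n : ℝ)⁻¹) * exp (-(c * (√t * L))) := by gcongr
  · push Not at hLL
    have hP : prob V p (fun S => #E * p ^ k + t ≤ count E S) ≤ #E * p ^ k := by
      have := prob_le_expect_div (V := V) h0.le h1 (f := fun S => (count E S : ℝ))
        (fun _ _ => by positivity) one_pos (A := fun S => #E * p ^ k + t ≤ count E S) (by
          intro S _ hS
          have h2 : (0 : ℝ) < count E S := lt_of_lt_of_le (by positivity) hS
          have h3 : 0 < count E S := by exact_mod_cast h2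
          exact_mod_cast h3)
      rwa [div_one, expect_count h.subset, h.sum_pow_card] at this
    have hpL : p = exp (1 - L) := by rw [hL, sub_sub_cancel, exp_log h0]
    calc prob V p (fun S => #E * p ^ k + t ≤ count E S) ≤ #E * p ^ k := hP
      _ ≤ A * p := by
        gcongr
        exact pow_le_of_le_one h0.le h1 (by omega)
      _ = exp (log A + (1 - L)) := by rw [exp_add, exp_log hA0, ← hpL]
      _ ≤ exp (-(c * (√t * L))) := by
        apply exp_le_exp.2
        have : c * (√t * L) ≤ 1 / (2 * √A) * (√A * L) := by
          gcongr
          exact min_le_left _ _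
        have e : 1 / (2 * √A) * (√A * L) = L / 2 := by field_simp
        linarith
      _ ≤ (1 + (n : ℝ)⁻¹) * exp (-(c * (√t * L))) := by
        refine le_mul_of_one_le_left (exp_pos _).le ?_
        have : 0 ≤ (n : ℝ)⁻¹ := by positivity
        linarith

/-- In this range of `t` the large deviation rate is at least of order `√t * log n`. -/
lemma mul_sqrt_mul_log_le {t m g l δ : ℝ} (ht : 0 < t) (hm : 0 < m) (hl : 1 ≤ l) (hg0 : 0 < g)
    (hg : g ≤ 2 * l) (hδ : 0 < δ) (hδ1 : δ ≤ 1) (htm : δ * (m * l ^ 2) ≤ √t ^ 3) (hml : l ^ 4 ≤ m) :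
    δ / 4 * (√t * l) ≤ t * log (1 + t / m) / g := by
  have e : t = √t * √t := (mul_self_sqrt ht.le).symm
  have hl0 : 0 < l := by linarith
  have hst : 0 < √t := sqrt_pos.2 ht
  have hlog : 0 ≤ t * log (1 + t / m) := mul_nonneg ht.le (log_nonneg (by
    have : 0 < t / m := by positivity
    linarith))
  refine le_trans ?_ (div_le_div_of_nonneg_left hlog hg0 hg)
  rw [le_div_iff₀ (by positivity)]
  rcases le_total t m with h | h
  · have h1 := half_le_log_one_add (show 0 ≤ t / m by positivity) ((div_le_one hm).2 h)
    calc δ / 4 * (√t * l) * (2 * l) = √t * (δ * (m * l ^ 2)) / (2 * m) := by field_simp; ring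
      _ ≤ √t * √t ^ 3 / (2 * m) := by gcongr
      _ = t * (t / m / 2) := by
        have : √t * √t ^ 3 = t * t := by
          calc √t * √t ^ 3 = (√t * √t) * (√t * √t) := by ring
            _ = t * t := by rw [← e]
        rw [this]; field_simp
      _ ≤ t * log (1 + t / m) := by gcongr
  · have h1 := half_le_log_of_one_le ((one_le_div hm).2 h)
    have h2 : l ^ 2 ≤ √t := by
      apply le_sqrt_of_sq_le
      calc (l ^ 2) ^ 2 = l ^ 4 := by ring
        _ ≤ t := hml.trans h
    calc δ / 4 * (√t * l) * (2 * l) = δ * (√t * l ^ 2 / 2) := by ring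
      _ ≤ 1 * (√t * √t / 2) := by gcongr
      _ = t * (1 / 2) := by rw [← e]; ring
      _ ≤ t * log (1 + t / m) := by gcongr

end BinomialSubset

/-! ### Assembling the upper bound. -/

namespace BinomialSubset

open Finset

/-- Existence of a threshold beyond which the asymptotic comparisons used below hold. -/
lemma exists_threshold {k : ℕ} (hk : 3 ≤ k) {a D γ η ℓ : ℝ} (ha : 0 < a) (hγ : 0 < γ)
    (hη : 0 < η) :
    ∃ n₁ : ℕ, ∀ n : ℕ, n₁ ≤ n → 3 ≤ n ∧ 3 * D ≤ (n : ℝ) ^ 2 ∧ log n ^ 2 ≤ (n : ℝ) ^ (1 / 8 : ℝ) ∧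
      log n ^ 4 ≤ a * (n : ℝ) ^ (1 / 8 : ℝ) ∧ ℓ ≤ η * log n ∧
      log n ^ 2 ≤ (n : ℝ) ^ (γ / ((k : ℝ) - 1)) ∧
      2 * log n ≤ (n : ℝ) ^ (1 / ((k : ℝ) - 1)) := by
  have hk3 : (3 : ℝ) ≤ k := by exact_mod_cast hk
  have hk1 : (0 : ℝ) < k - 1 := by linarith
  have h1 := eventually_mul_log_pow_le 1 2 (y := 1 / 8) (by norm_num)
  have h2 := eventually_mul_log_pow_le (1 / a) 4 (y := 1 / 8) (by norm_num)
  have h3 : ∀ᶠ n : ℕ in Filter.atTop, ℓ / η ≤ log n :=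
    (tendsto_log_atTop.comp tendsto_natCast_atTop_atTop).eventually_ge_atTop _
  have h4 := eventually_mul_log_pow_le 1 2 (y := γ / ((k : ℝ) - 1)) (by positivity)
  have h5 := eventually_mul_log_pow_le 2 1 (y := 1 / ((k : ℝ) - 1)) (by positivity)
  have h6 : ∀ᶠ n : ℕ in Filter.atTop, 3 * D ≤ (n : ℝ) :=
    tendsto_natCast_atTop_atTop.eventually_ge_atTop _
  obtain ⟨n₁, hn₁⟩ := Filter.eventually_atTop.1 (h1.and (h2.and (h3.and (h4.and (h5.and (h6.and
    (Filter.eventually_ge_atTop 3)))))))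
  refine ⟨n₁, fun n hn => ?_⟩
  obtain ⟨g1, g2, g3, g4, g5, g6, g7⟩ := hn₁ n hn
  have hn0 : (3 : ℝ) ≤ n := by exact_mod_cast g7
  refine ⟨g7, by nlinarith, by simpa using g1, ?_, ?_, by simpa using g4, by simpa using g5⟩
  · rw [one_div_mul_eq_div, div_le_iff₀ ha] at g2; linarith
  · rw [div_le_iff₀ hη] at g3; linarith

/-- Used with x = Var X, which is at least μ/2 once p ≤ 1/2: the minimum in the conditions on t may
then be replaced by μ^(2/3). -/
lemma two_thirds_rpow_le {x m : ℝ} (hm : 0 ≤ m) (hx : m / 2 ≤ x) :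
    m ^ (2 / 3 : ℝ) / 2 ≤ min (x ^ (2 / 3 : ℝ)) (m ^ (2 / 3 : ℝ)) := by
  have h0 : 0 ≤ m ^ (2 / 3 : ℝ) := rpow_nonneg hm _
  refine le_min ?_ (by linarith)
  refine le_trans ?_ (rpow_le_rpow (by positivity) hx (by norm_num))
  rw [div_rpow hm (by norm_num)]
  apply div_le_div_of_nonneg_left h0 (by positivity)
  calc (2 : ℝ) ^ (2 / 3 : ℝ) ≤ 2 ^ (1 : ℝ) := rpow_le_rpow_of_exponent_le (by norm_num) (by norm_num)
    _ = 2 := rpow_one _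

lemma sqrt_pow_three {t : ℝ} (ht : 0 ≤ t) : √t ^ 3 = t ^ (3 / 2 : ℝ) := by
  rw [sqrt_eq_rpow, ← rpow_natCast, ← rpow_mul ht]; norm_num

lemma rate_le {t m q : ℝ} (ht : 0 < t) (hm : 0 < m) (hq : 0 ≤ q) :
    chernoffRate (t / m) * m ^ 2 / (m * (1 + q)) ≤ t * log (1 + t / m) / (1 + q) := by
  have h := chernoffRate_le (show 0 ≤ t / m by positivity)
  calc chernoffRate (t / m) * m ^ 2 / (m * (1 + q)) = chernoffRate (t / m) * m / (1 + q) := by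
        field_simp
    _ ≤ t / m * log (1 + t / m) * m / (1 + q) := by gcongr
    _ = t * log (1 + t / m) / (1 + q) := by field_simp

/-- If p is smaller than n^(-1/(k-1)) by a power of n, then n p^(k-1) is at most a positive power of
p, and stars of a constant size are already too expensive. -/
lemma exists_prob_upper_tail_le_of_le_rpow {k : ℕ} (hk : 3 ≤ k) {a D γ : ℝ} (ha : 0 < a)
    (hD : 1 ≤ D) (hγ : 0 < γ) : ∃ c > 0, ∃ n₁ : ℕ, ∀ {α : Type*} [DecidableEq α] {V : Finset α}
      {E : Finset (Finset α)} {n : ℕ} {p t : ℝ}, DenseAlmostLinear V E k a D n → n₁ ≤ n →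
      0 < p → p ≤ 1 → 0 < t → p ≤ (n : ℝ) ^ (-(1 / ((k : ℝ) - 1) + γ)) →
      prob V p (fun S => #E * p ^ k + t ≤ count E S) ≤ (1 + (n : ℝ)⁻¹) *
        exp (-(c * min (t * log (1 + t / (#E * p ^ k)) / (1 + n * p ^ (k - 1)))
          (√t * (1 - log p)))) := by
  have hk3 : (3 : ℝ) ≤ k := by exact_mod_cast hk
  have hk1 : (0 : ℝ) < k - 1 := by linarith
  have hD0 : 0 < D := by linarith
  set β := 1 / ((k : ℝ) - 1) + γ with hβ
  have hb0 : 0 < 1 / ((k : ℝ) - 1) := by positivity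
  have hβ0 : 0 < β := by positivity
  -- From p ≤ n^(-β) follows n ≤ p^(-1/β), so n p^(k-1) ≤ p^(k-1-1/β); the exponent is positive
  -- because β > 1/(k-1).
  set η := min 1 ((k - 1) - 1 / β) with hη
  have hη0 : 0 < η := by
    refine lt_min one_pos (sub_pos.2 ?_)
    rw [div_lt_iff₀ hβ0, hβ, mul_add, mul_one_div_cancel hk1.ne']
    have : 0 < (k - 1) * γ := by positivity
    linarith
  obtain ⟨n₁, hn₁⟩ := exists_threshold hk (D := D) (ℓ := 4 / η * (2 + 2 * log D + log (3 * D)))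
    ha hγ hβ0
  set K₀ : ℝ := k ^ 2 * D with hK₀
  have hK₀0 : 0 < K₀ := by positivity
  set s₀ := ⌈8 * k / η⌉₊ with hs₀
  have hs₀0 : (0 : ℝ) < s₀ := by exact_mod_cast Nat.ceil_pos.2 (by positivity)
  refine ⟨min (1 / (16 * K₀ * s₀)) (η / (32 * K₀)), by positivity, n₁, ?_⟩
  intro α _ V E n p t h hn h0 h1 ht hp
  obtain ⟨hn3, -, -, -, hℓ, -, -⟩ := hn₁ n hn
  have hn0 : (3 : ℝ) ≤ n := by exact_mod_cast hn3
  have hnpos : (0 : ℝ) < n := by linarith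
  have hE0 : (0 : ℝ) < #E := lt_of_lt_of_le (by positivity) h.le_card_edges
  have hE : 0 < #E := by exact_mod_cast hE0
  have hlogp : β * log n ≤ -log p := by
    have := log_le_log h0 hp
    rw [log_rpow hnpos] at this
    linarith
  have hnp : (n : ℝ) ≤ p ^ (-(1 / β)) := by
    have h2 : ((n : ℝ) ^ (-β)) ^ (-(1 / β)) ≤ p ^ (-(1 / β)) :=
      rpow_le_rpow_of_nonpos h0 hp (by
        have : 0 < 1 / β := by positivity
        linarith)
    rwa [← rpow_mul hnpos.le, neg_mul_neg, mul_one_div_cancel hβ0.ne', rpow_one] at h2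
  have hq : n * p ^ (k - 1) ≤ p ^ η := by
    calc n * p ^ (k - 1) ≤ p ^ (-(1 / β)) * p ^ (k - 1) := by gcongr
      _ = p ^ ((k - 1) - 1 / β) := by
        rw [← rpow_natCast, ← rpow_add h0, Nat.cast_sub (by omega)]
        congr 1
        push_cast; ring
      _ ≤ p ^ η := rpow_le_rpow_of_exponent_ge h0 h1 (min_le_right _ _)
  have hmain := h.prob_upper_tail_le_of_sparse (by omega) hD (by omega) h0 h1 hE ht hη0
    (min_le_left _ _) hq (hℓ.trans hlogp)
  refine hmain.trans ?_
  set m := #E * p ^ k with hm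
  have hm0 : 0 < m := by positivity
  have hlt : 0 ≤ log (1 + t / m) := log_nonneg (by
    have : 0 < t / m := by positivity
    linarith)
  have hL : 0 ≤ 1 - log p := by linarith [log_nonpos h0.le h1]
  set ψ := t * log (1 + t / m) with hψ
  have hψ0 : 0 ≤ ψ := by positivity
  set c := min (1 / (16 * K₀ * s₀)) (η / (32 * K₀)) with hc
  have hc0 : 0 < c := by positivity
  have hx : c * min (ψ / (1 + n * p ^ (k - 1))) (√t * (1 - log p)) ≤
      t / (16 * K₀ * s₀) * log (1 + t / m) := by
    calc c * min (ψ / (1 + n * p ^ (k - 1))) (√t * (1 - log p))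
        ≤ c * (ψ / (1 + n * p ^ (k - 1))) := by gcongr; exact min_le_left _ _
      _ ≤ c * ψ := by
        gcongr
        apply div_le_self hψ0
        have : 0 ≤ n * p ^ (k - 1) := by positivity
        linarith
      _ ≤ 1 / (16 * K₀ * s₀) * ψ := by gcongr; exact min_le_left _ _
      _ = t / (16 * K₀ * s₀) * log (1 + t / m) := by rw [hψ]; ring
  have hy : c * min (ψ / (1 + n * p ^ (k - 1))) (√t * (1 - log p)) ≤
      η / 4 * (1 - log p) * (√t / (8 * K₀)) := by
    calc c * min (ψ / (1 + n * p ^ (k - 1))) (√t * (1 - log p))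
        ≤ η / (32 * K₀) * (√t * (1 - log p)) := by
          gcongr
          · exact min_le_right _ _
          · exact min_le_right _ _
      _ = η / 4 * (1 - log p) * (√t / (8 * K₀)) := by field_simp; ring
  rw [add_mul, one_mul, inv_mul_eq_div]
  gcongr

/-- The assumptions on `t` that are used above the polynomially sparse range. -/
lemma sqrt_pow_three_ge {k n : ℕ} (hk : 3 ≤ k) {a γ β p t m x : ℝ} (ha : 0 < a) (hγ : 0 < γ)
    (hγ1 : γ < 1) (hβ : β = 1 / ((k : ℝ) - 1) + γ / (8 * ((k : ℝ) + 1) ^ 2)) (h0 : 0 < p)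
    (hp1 : p ≤ 1 / 2) (ht : 0 < t) (hn : 3 ≤ n)
    (hp : (n : ℝ) ^ (-β) ≤ p) (hm : 0 < m) (hma : a * (n ^ 2 * p ^ k) ≤ m)
    (hγn : log n ^ 2 ≤ (n : ℝ) ^ (γ / ((k : ℝ) - 1))) (hx : m * (1 - p) ≤ x)
    (hcond : γ * min (x ^ (2 / 3 : ℝ)) (m ^ (2 / 3 : ℝ)) * log n ^ (4 / 3 : ℝ) ≤ t ∨
      m * p ^ (((k : ℝ) - 2) / 3 - γ) ≤ t) :
    min 1 (min ((γ / 2) ^ (3 / 2 : ℝ)) √a) * (m * log n ^ 2) ≤ √t ^ 3 := by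
  have hk3 : (3 : ℝ) ≤ k := by exact_mod_cast hk
  have hk1 : (0 : ℝ) < k - 1 := by linarith
  have hn0 : (3 : ℝ) ≤ n := by exact_mod_cast hn
  have hnpos : (0 : ℝ) < n := by linarith
  have hlog : 1 ≤ log n := by
    rw [le_log_iff_exp_le (by linarith)]
    linarith [exp_one_lt_d9]
  have hl0 : 0 < log n := by linarith
  rw [sqrt_pow_three ht.le]
  rcases hcond with hc | hc
  · have h2 : γ / 2 * (m ^ (2 / 3 : ℝ) * log n ^ (4 / 3 : ℝ)) ≤ t := by
      refine le_trans ?_ hc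
      have := two_thirds_rpow_le hm.le (show m / 2 ≤ x by nlinarith)
      calc γ / 2 * (m ^ (2 / 3 : ℝ) * log n ^ (4 / 3 : ℝ))
          = γ * (m ^ (2 / 3 : ℝ) / 2) * log n ^ (4 / 3 : ℝ) := by ring
        _ ≤ _ := by gcongr
    have h3 := rpow_le_rpow (by positivity) h2 (show (0 : ℝ) ≤ 3 / 2 by norm_num)
    refine le_trans ?_ h3
    rw [mul_rpow (by positivity) (by positivity), mul_rpow (by positivity) (by positivity),
      ← rpow_mul hm.le, ← rpow_mul hl0.le]
    norm_num
    gcongr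
    exact (min_le_right _ _).trans (min_le_left _ _)
  · have h3 := rpow_le_rpow (by positivity) hc (show (0 : ℝ) ≤ 3 / 2 by norm_num)
    refine le_trans ?_ h3
    rw [mul_rpow hm.le (by positivity), ← rpow_mul h0.le]
    have e1 : m ^ (3 / 2 : ℝ) = m * √m := by
      rw [sqrt_eq_rpow]
      nth_rw 2 [← rpow_one m]
      rw [← rpow_add hm]; norm_num
    have e2 : √a * (n * p ^ ((k : ℝ) / 2)) ≤ √m := by
      refine le_trans (le_of_eq ?_) (sqrt_le_sqrt hma)
      rw [sqrt_mul ha.le, sqrt_mul (by positivity), sqrt_sq hnpos.le, sqrt_eq_rpow (p ^ k),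
        ← rpow_natCast, ← rpow_mul h0.le]
      congr 3; ring
    -- In terms of n the exponent is 1 - β(k-1) + 3βγ/2. The γ in condition (c) yields at least
    -- 3γ/(2(k-1)), the excess of β over 1/(k-1) costs at most γ/(2(k-1)), and γ/(k-1) is left to
    -- dominate the logarithms.
    have e3 : log n ^ 2 ≤ n * p ^ ((k : ℝ) - 1 - 3 * γ / 2) := by
      have hexp : 0 ≤ (k : ℝ) - 1 - 3 * γ / 2 := by linarith
      calc log n ^ 2 ≤ (n : ℝ) ^ (γ / ((k : ℝ) - 1)) := hγn
        _ ≤ (n : ℝ) ^ (1 + (-β) * ((k : ℝ) - 1 - 3 * γ / 2)) := by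
          apply rpow_le_rpow_of_exponent_le (by linarith)
          have hb : 1 / ((k : ℝ) - 1) * (k - 1) = 1 := by field_simp
          have hg : γ / (8 * ((k : ℝ) + 1) ^ 2) * (k - 1) ≤ γ * (1 / ((k : ℝ) - 1)) / 2 := by
            rw [div_mul_eq_mul_div, div_le_iff₀ (by positivity), mul_one_div, div_div, div_mul_eq_mul_div,
              le_div_iff₀ (by positivity)]
            nlinarith [mul_pos hγ hk1]
          have hγ0 : 0 ≤ γ / (8 * ((k : ℝ) + 1) ^ 2) := by positivity
          rw [hβ, div_eq_mul_one_div γ (k - 1)]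
          nlinarith [mul_nonneg hγ0 hγ.le]
        _ = n * ((n : ℝ) ^ (-β)) ^ ((k : ℝ) - 1 - 3 * γ / 2) := by
          rw [rpow_add hnpos, rpow_one, rpow_mul hnpos.le]
        _ ≤ n * p ^ ((k : ℝ) - 1 - 3 * γ / 2) := by gcongr
    have e4 : p ^ ((k : ℝ) - 1 - 3 * γ / 2) =
        p ^ ((k : ℝ) / 2) * p ^ ((((k : ℝ) - 2) / 3 - γ) * (3 / 2)) := by
      rw [← rpow_add h0]; congr 1; ring
    rw [e1]
    calc min 1 (min ((γ / 2) ^ (3 / 2 : ℝ)) √a) * (m * log n ^ 2)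
        ≤ √a * (m * (n * p ^ ((k : ℝ) - 1 - 3 * γ / 2))) := by
          gcongr
          exact (min_le_right _ _).trans (min_le_right _ _)
      _ = m * (√a * (n * p ^ ((k : ℝ) / 2))) * p ^ ((((k : ℝ) - 2) / 3 - γ) * (3 / 2)) := by
          rw [e4]; ring
      _ ≤ m * √m * p ^ ((((k : ℝ) - 2) / 3 - γ) * (3 / 2)) := by gcongr

end BinomialSubset

namespace BinomialSubset

open Finset

/-- Places p ≥ n^(-β) in the range of `exists_prob_upper_tail_le_of_dense`: (k + 1/2)/(k-1) ≤ 7/4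
for k ≥ 3, and the small part of β contributes at most 1/8, so 2 - β(k + 1/2) ≥ 1/8. -/
lemma rpow_bounds_of_le {k n : ℕ} (hk : 3 ≤ k) {γ β p : ℝ} (hγ : 0 < γ)
    (hγ1 : γ < 1) (hβ : β = 1 / ((k : ℝ) - 1) + γ / (8 * ((k : ℝ) + 1) ^ 2)) (h0 : 0 < p)
    (hn : 3 ≤ n) (hp : (n : ℝ) ^ (-β) ≤ p) :
    (n : ℝ) ^ (1 / 8 : ℝ) ≤ (n : ℝ) ^ 2 * p ^ k * √p ∧ 1 - log p ≤ 3 * log n := by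
  have hk3 : (3 : ℝ) ≤ k := by exact_mod_cast hk
  have hk1 : (0 : ℝ) < k - 1 := by linarith
  have hn0 : (3 : ℝ) ≤ n := by exact_mod_cast hn
  have hnpos : (0 : ℝ) < n := by linarith
  have hb : 1 / ((k : ℝ) - 1) * (k - 1) = 1 := by field_simp
  have hb2 : 1 / ((k : ℝ) - 1) ≤ 1 / 2 := by
    apply one_div_le_one_div_of_le <;> linarith
  have hγ0 : 0 ≤ γ / (8 * ((k : ℝ) + 1) ^ 2) := by positivity
  have hg : γ / (8 * ((k : ℝ) + 1) ^ 2) * (k + 1) ≤ 1 / 8 := by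
    rw [div_mul_eq_mul_div, div_le_div_iff₀ (by positivity) (by norm_num)]
    nlinarith
  constructor
  · have e : (n : ℝ) ^ 2 * p ^ k * √p = (n : ℝ) ^ (2 : ℝ) * p ^ ((k : ℝ) + 1 / 2) := by
      rw [rpow_add h0, rpow_natCast, sqrt_eq_rpow, mul_assoc]
      norm_num
    rw [e]
    calc (n : ℝ) ^ (1 / 8 : ℝ) ≤ (n : ℝ) ^ (2 + -β * ((k : ℝ) + 1 / 2)) := by
          apply rpow_le_rpow_of_exponent_le (by linarith)
          rw [hβ]
          nlinarith
      _ = (n : ℝ) ^ (2 : ℝ) * ((n : ℝ) ^ (-β)) ^ ((k : ℝ) + 1 / 2) := by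
          rw [rpow_add hnpos, rpow_mul hnpos.le]
      _ ≤ (n : ℝ) ^ (2 : ℝ) * p ^ ((k : ℝ) + 1 / 2) := by gcongr
  · have h1 := log_le_log (rpow_pos_of_pos hnpos _) hp
    rw [log_rpow hnpos] at h1
    have hlog : 1 ≤ log n := by
      rw [le_log_iff_exp_le (by linarith)]
      linarith [exp_one_lt_d9]
    have hβ1 : β ≤ 1 := by rw [hβ]; nlinarith
    nlinarith

lemma log_le_mul_pow_of_le {k n : ℕ} (hk : 3 ≤ k) {γ p : ℝ} (hγ : 0 < γ) (hn : 3 ≤ n)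
    (hp : γ * (n : ℝ) ^ (-1 / ((k : ℝ) - 1)) * log n ^ (1 / ((k : ℝ) - 1)) ≤ p) :
    γ ^ (k - 1) * log n ≤ n * p ^ (k - 1) := by
  have hk3 : (3 : ℝ) ≤ k := by exact_mod_cast hk
  have hk1 : (0 : ℝ) < k - 1 := by linarith
  have hn0 : (3 : ℝ) ≤ n := by exact_mod_cast hn
  have hnpos : (0 : ℝ) < n := by linarith
  have hl : 0 < log (n : ℝ) := log_pos (by linarith)
  have hc : ((k - 1 : ℕ) : ℝ) = k - 1 := by rw [Nat.cast_sub (by omega)]; simp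
  have h := pow_le_pow_left₀ (by positivity) hp (k - 1)
  rw [mul_pow, mul_pow, ← rpow_natCast ((n : ℝ) ^ _), ← rpow_natCast (log n ^ _),
    ← rpow_mul hnpos.le, ← rpow_mul hl.le, hc, div_mul_cancel₀ _ hk1.ne',
    div_mul_cancel₀ _ hk1.ne', rpow_one, rpow_neg_one] at h
  calc γ ^ (k - 1) * log n = n * (γ ^ (k - 1) * (n : ℝ)⁻¹ * log n) := by field_simp
    _ ≤ n * p ^ (k - 1) := by gcongr

lemma mul_pow_le_log_of_le {k n : ℕ} (hk : 3 ≤ k) {γ p : ℝ} (hγ1 : γ ≤ 1) (h0 : 0 < p)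
    (hn : 3 ≤ n)
    (hp : p ≤ γ * (n : ℝ) ^ (-1 / ((k : ℝ) - 1)) * log n ^ (1 / ((k : ℝ) - 1))) :
    n * p ^ (k - 1) ≤ log n := by
  have hk3 : (3 : ℝ) ≤ k := by exact_mod_cast hk
  have hk1 : (0 : ℝ) < k - 1 := by linarith
  have hn0 : (3 : ℝ) ≤ n := by exact_mod_cast hn
  have hnpos : (0 : ℝ) < n := by linarith
  have hl : 0 < log (n : ℝ) := log_pos (by linarith)
  have hc : ((k - 1 : ℕ) : ℝ) = k - 1 := by rw [Nat.cast_sub (by omega)]; simp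
  have hp' : p ≤ (n : ℝ) ^ (-1 / ((k : ℝ) - 1)) * log n ^ (1 / ((k : ℝ) - 1)) := by
    refine hp.trans ?_
    rw [mul_assoc]
    exact mul_le_of_le_one_left (by positivity) hγ1
  have h := pow_le_pow_left₀ h0.le hp' (k - 1)
  rw [mul_pow, ← rpow_natCast ((n : ℝ) ^ _), ← rpow_natCast (log n ^ _),
    ← rpow_mul hnpos.le, ← rpow_mul hl.le, hc, div_mul_cancel₀ _ hk1.ne',
    div_mul_cancel₀ _ hk1.ne', rpow_one, rpow_neg_one] at h
  calc n * p ^ (k - 1) ≤ n * ((n : ℝ)⁻¹ * log n) := by gcongr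
    _ = log n := by field_simp

set_option maxHeartbeats 1600000 in
/-- The upper bound on the upper tail. -/
theorem exists_prob_upper_tail_le {k : ℕ} (hk : 3 ≤ k) {a D γ : ℝ} (ha : 0 < a) (hD : 1 ≤ D)
    (hγ : 0 < γ) (hγ1 : γ < 1) : ∃ c > 0, ∀ {α : Type*} [DecidableEq α] {V : Finset α}
      {E : Finset (Finset α)} {n : ℕ} {p t m x : ℝ}, DenseAlmostLinear V E k a D n → 1 ≤ n →
      0 < p → p ≤ 1 → 0 < t → m = #E * p ^ k → m * (1 - p) ≤ x →
      (p ∉ Set.Ioo ((n : ℝ) ^ (-1 / ((k : ℝ) - 1) - γ))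
          (γ * (n : ℝ) ^ (-1 / ((k : ℝ) - 1)) * log n ^ (1 / ((k : ℝ) - 1))) ∨
        γ * min (x ^ (2 / 3 : ℝ)) (m ^ (2 / 3 : ℝ)) * log n ^ (4 / 3 : ℝ) ≤ t ∨
        m * p ^ (((k : ℝ) - 2) / 3 - γ) ≤ t) →
      prob V p (fun S => m + t ≤ count E S) ≤ (1 + (n : ℝ)⁻¹) *
        exp (-c * min (chernoffRate (t / m) * m ^ 2 / (m * (1 + n * p ^ (k - 1))))
          (√t * log (exp 1 / p))) := by
  have hk3 : (3 : ℝ) ≤ k := by exact_mod_cast hk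
  have hk1 : (0 : ℝ) < k - 1 := by linarith
  -- The sparse and dense arguments are separated at n^(-1/(k-1)-γ₀), not at the γ of condition (a):
  -- γ₀ must be small enough for the dense estimate to reach that far down.
  set γ₀ := γ / (8 * ((k : ℝ) + 1) ^ 2) with hγ₀
  have hγ₀0 : 0 < γ₀ := by positivity
  have hγ₀γ : γ₀ ≤ γ := div_le_self hγ.le (by nlinarith)
  set β := 1 / ((k : ℝ) - 1) + γ₀ with hβ
  obtain ⟨c₁, hc₁, n₁, hsparse⟩ := exists_prob_upper_tail_le_of_le_rpow hk ha hD hγ₀0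
  obtain ⟨c₂, hc₂, hdense⟩ := exists_prob_upper_tail_le_of_dense hk ha hD
  obtain ⟨n₂, hn₂⟩ := exists_threshold hk (D := D) (η := 1) (ℓ := 0) ha hγ one_pos
  obtain ⟨c₃, hc₃, hsmall⟩ := exists_prob_upper_tail_le_of_bounded (by omega : 2 ≤ k) a hD
    (max n₁ n₂)
  set M := 1 + (γ ^ (k - 1))⁻¹ with hM
  have hM1 : 1 ≤ M := by
    have : 0 < (γ ^ (k - 1))⁻¹ := by positivity
    linarith
  set δ := min 1 (min ((γ / 2) ^ (3 / 2 : ℝ)) √a) with hδ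
  have hδ0 : 0 < δ := lt_min one_pos (lt_min (by positivity) (sqrt_pos.2 ha))
  have hδ1 : δ ≤ 1 := min_le_left _ _
  set c := min (min c₁ c₃) (c₂ * min (1 / M) (δ / 12)) with hc
  have hc0 : 0 < c := by positivity
  refine ⟨c, hc0, ?_⟩
  intro α _ V E n p t m x h hn h0 h1 ht hm hx hcond
  have hn0 : (1 : ℝ) ≤ n := by exact_mod_cast hn
  have hE0 : (0 : ℝ) < #E := lt_of_lt_of_le (by positivity) h.le_card_edges
  have hE : 0 < #E := by exact_mod_cast hE0
  have hm0 : 0 < m := by rw [hm]; positivity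
  set q := n * p ^ (k - 1) with hq
  have hq0 : 0 < q := by positivity
  have hL : log (exp 1 / p) = 1 - log p := by rw [log_div (exp_pos 1).ne' h0.ne', log_exp]
  rw [hL]
  set L := 1 - log p with hLdef
  have hL0 : 0 < L := by linarith [log_nonpos h0.le h1]
  have hst : 0 < √t := sqrt_pos.2 ht
  have hlt : 0 ≤ log (1 + t / m) := log_nonneg (by
    have : 0 < t / m := by positivity
    linarith)
  set R := chernoffRate (t / m) * m ^ 2 / (m * (1 + q)) with hR
  have hRle : R ≤ t * log (1 + t / m) / (1 + q) := rate_le ht hm0 hq0.le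
  have hR0 : 0 ≤ R := by
    have h2 := half_mul_log_le_chernoffRate (show 0 ≤ t / m by positivity)
    have h3 : 0 ≤ chernoffRate (t / m) := le_trans (by positivity) h2
    positivity
  have hfin : ∀ y, c * min R (√t * L) ≤ y →
      prob V p (fun S => m + t ≤ count E S) ≤ (1 + (n : ℝ)⁻¹) * exp (-y) →
      prob V p (fun S => m + t ≤ count E S) ≤ (1 + (n : ℝ)⁻¹) * exp (-c * min R (√t * L)) := by
    intro y hy hP
    refine hP.trans ?_
    rw [neg_mul]
    gcongr
  have hmin0 : 0 ≤ min R (√t * L) := by positivity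
  -- The thresholds n₁ and n₂ depend on γ, whereas the statement has to hold for all n ≥ 1.
  by_cases hnn : n ≤ max n₁ n₂
  · refine hfin _ ?_ (by rw [hm]; exact hsmall h hn hnn h0 h1 ht hE)
    exact mul_le_mul ((min_le_left _ _).trans (min_le_right _ _)) (min_le_right _ _) hmin0 hc₃.le
  push Not at hnn
  have hn1' : n₁ ≤ n := (le_max_left _ _).trans hnn.le
  obtain ⟨hn3, hnD, hl2, hl4, -, hlγ, hlb⟩ := hn₂ n ((le_max_right _ _).trans hnn.le)
  have hn3' : (3 : ℝ) ≤ n := by exact_mod_cast hn3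
  have hnpos : (0 : ℝ) < n := by linarith
  have hlog : 1 ≤ log n := by
    rw [le_log_iff_exp_le (by linarith)]
    linarith [exp_one_lt_d9]
  by_cases hp : p ≤ (n : ℝ) ^ (-β)
  · refine hfin _ ?_ (by rw [hm]; exact hsparse h hn1' h0 h1 ht hp)
    rw [← hm]
    exact mul_le_mul ((min_le_left _ _).trans (min_le_left _ _)) (min_le_min_right _ hRle) hmin0
      hc₁.le
  push Not at hp
  obtain ⟨hb1, hb2⟩ := rpow_bounds_of_le hk hγ hγ1 hβ h0 hn3 hp.le
  have hdp := hdense h hn3 hnD h0 h1 ht (hl2.trans hb1)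
  rw [← hm] at hdp
  refine hfin _ ?_ hdp
  have hcc₂ : c ≤ c₂ := (min_le_right _ _).trans (mul_le_of_le_one_right hc₂.le
    ((min_le_left _ _).trans (by rw [div_le_one (by linarith)]; exact hM1)))
  have hkey : c * min R (√t * L) ≤ c₂ * (t * log (1 + t / m) / (q + log n)) := by
    -- The available rate has denominator q + log n instead of 1 + q. If q ≥ γ^(k-1) log n these are
    -- comparable. Otherwise p lies in the window of (a), so (b) or (c) holds and the weakened rate
    -- is at least a constant times √t log n, hence times √t log(e/p).
    by_cases hp2 : γ * (n : ℝ) ^ (-1 / ((k : ℝ) - 1)) * log n ^ (1 / ((k : ℝ) - 1)) ≤ p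
    · have hql := log_le_mul_pow_of_le hk hγ hn3 hp2
      have hgM : q + log n ≤ M * (1 + q) := by
        have : log n ≤ (γ ^ (k - 1))⁻¹ * q := by
          rw [inv_mul_eq_div, le_div_iff₀ (by positivity)]
          linarith
        have h3 : 0 < (γ ^ (k - 1))⁻¹ := by positivity
        rw [hM]; linarith
      calc c * min R (√t * L) ≤ (c₂ * (1 / M)) * (t * log (1 + t / m) / (1 + q)) := by
            gcongr
            · refine (min_le_right _ _).trans ?_
              gcongr
              exact min_le_left _ _
            · exact (min_le_left _ _).trans hRle
        _ = c₂ * (t * log (1 + t / m) / (M * (1 + q))) := by field_simp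
        _ ≤ c₂ * (t * log (1 + t / m) / (q + log n)) := by gcongr
    · push Not at hp2
      have hql := mul_pow_le_log_of_le hk hγ1.le h0 hn3 hp2.le
      have hcond' : γ * min (x ^ (2 / 3 : ℝ)) (m ^ (2 / 3 : ℝ)) * log n ^ (4 / 3 : ℝ) ≤ t ∨
          m * p ^ (((k : ℝ) - 2) / 3 - γ) ≤ t := by
        refine hcond.resolve_left fun hI => hI ⟨lt_of_le_of_lt ?_ hp, hp2⟩
        apply rpow_le_rpow_of_exponent_le (by linarith)
        rw [hβ, neg_div]; linarith
      have hp12 : p ≤ 1 / 2 := by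
        have h5 : (n : ℝ) ^ (-1 / ((k : ℝ) - 1)) = ((n : ℝ) ^ (1 / ((k : ℝ) - 1)))⁻¹ := by
          rw [← rpow_neg hnpos.le]; congr 1; ring
        have h6 : log n ^ (1 / ((k : ℝ) - 1)) ≤ log n := by
          conv_rhs => rw [← rpow_one (log n)]
          apply rpow_le_rpow_of_exponent_le hlog
          rw [div_le_one hk1]; linarith
        calc p ≤ γ * (n : ℝ) ^ (-1 / ((k : ℝ) - 1)) * log n ^ (1 / ((k : ℝ) - 1)) := hp2.le
          _ ≤ 1 * ((n : ℝ) ^ (1 / ((k : ℝ) - 1)))⁻¹ * log n := by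
            rw [h5]; gcongr
          _ ≤ 1 / 2 := by
            rw [one_mul, inv_mul_eq_div, div_le_div_iff₀ (by positivity) (by norm_num)]
            linarith
      have hma : a * (n ^ 2 * p ^ k) ≤ m := by
        rw [hm, ← mul_assoc]; exact mul_le_mul_of_nonneg_right h.le_card_edges (by positivity)
      have htm := sqrt_pow_three_ge hk ha hγ hγ1 hβ h0 hp12 ht hn3 hp.le hm0 hma hlγ hx hcond'
      have hml : log n ^ 4 ≤ m := by
        calc log n ^ 4 ≤ a * (n : ℝ) ^ (1 / 8 : ℝ) := hl4
          _ ≤ a * ((n : ℝ) ^ 2 * p ^ k * √p) := by gcongr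
          _ ≤ a * ((n : ℝ) ^ 2 * p ^ k * 1) := by gcongr; exact sqrt_le_one.2 h1
          _ ≤ m := by rw [mul_one]; exact hma
      have hcore := mul_sqrt_mul_log_le ht hm0 hlog (show 0 < q + log n by linarith)
        (by linarith) hδ0 hδ1 htm hml
      calc c * min R (√t * L) ≤ (c₂ * (δ / 12)) * (√t * (3 * log n)) := by
            gcongr
            · refine (min_le_right _ _).trans ?_
              gcongr
              exact min_le_right _ _
            · refine (min_le_right _ _).trans ?_
              gcongr
        _ = c₂ * (δ / 4 * (√t * log n)) := by ring
        _ ≤ c₂ * (t * log (1 + t / m) / (q + log n)) := by gcongr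
  rw [mul_min_of_nonneg _ _ hc₂.le]
  refine le_min hkey ?_
  exact mul_le_mul hcc₂ (min_le_right _ _) hmin0 hc₂.le

end BinomialSubset

/-! ### Variance upper bound and the lower bound from clusters. -/

namespace BinomialSubset

open Finset

variable {α : Type*} [DecidableEq α] {V : Finset α} {p : ℝ}

lemma AlmostLinear.card_two_common_le {E : Finset (Finset α)} {k : ℕ} {D : ℝ}
    (h : AlmostLinear V E k D) (hD : 0 ≤ D) (U : Finset α) :
    (#{f ∈ E | 2 ≤ #(f ∩ U)} : ℝ) ≤ #U ^ 2 * D := by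
  have hsub : {f ∈ E | 2 ≤ #(f ∩ U)} ⊆
      U.biUnion fun u => (U.erase u).biUnion fun v => {f ∈ E | u ∈ f ∧ v ∈ f} := by
    intro f hf
    obtain ⟨hfE, hf2⟩ := mem_filter.1 hf
    obtain ⟨u, hu, v, hv, huv⟩ := one_lt_card.1 (show 1 < #(f ∩ U) by omega)
    rw [mem_inter] at hu hv
    exact mem_biUnion.2 ⟨u, hu.2, mem_biUnion.2 ⟨v, mem_erase.2 ⟨huv.symm, hv.2⟩,
      mem_filter.2 ⟨hfE, hu.1, hv.1⟩⟩⟩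
  calc (#{f ∈ E | 2 ≤ #(f ∩ U)} : ℝ)
      ≤ ∑ u ∈ U, ∑ v ∈ U.erase u, (#{f ∈ E | u ∈ f ∧ v ∈ f} : ℝ) := by
        exact_mod_cast (card_le_card hsub).trans
          (card_biUnion_le.trans (sum_le_sum fun u _ => card_biUnion_le))
    _ ≤ ∑ u ∈ U, ∑ v ∈ U.erase u, D := sum_le_sum fun u _ => sum_le_sum fun v hv =>
        h.codegree u v (mem_erase.1 hv).1.symm
    _ ≤ ∑ u ∈ U, #U * D := by
        refine sum_le_sum fun u _ => ?_
        rw [sum_const, nsmul_eq_mul]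
        exact mul_le_mul_of_nonneg_right (by exact_mod_cast card_le_card (erase_subset _ _)) hD
    _ = #U ^ 2 * D := by rw [sum_const, nsmul_eq_mul]; ring

namespace DenseAlmostLinear

variable {E : Finset (Finset α)} {k n : ℕ} {a D : ℝ}

lemma card_meeting_le (h : DenseAlmostLinear V E k a D n) (hk : 2 ≤ k) (hD : 0 ≤ D)
    (U : Finset α) : (#{f ∈ E | ¬ Disjoint f U} : ℝ) ≤ #U * (D ^ 2 * n) := by
  have hsub : {f ∈ E | ¬ Disjoint f U} ⊆ U.biUnion fun u => {f ∈ E | u ∈ f} := by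
    intro f hf
    obtain ⟨hfE, hf2⟩ := mem_filter.1 hf
    obtain ⟨u, hu1, hu2⟩ := not_disjoint_iff.1 hf2
    exact mem_biUnion.2 ⟨u, hu2, mem_filter.2 ⟨hfE, hu1⟩⟩
  calc (#{f ∈ E | ¬ Disjoint f U} : ℝ) ≤ ∑ u ∈ U, (#{f ∈ E | u ∈ f} : ℝ) := by
        exact_mod_cast (card_le_card hsub).trans card_biUnion_le
    _ ≤ ∑ u ∈ U, (D ^ 2 * n) := sum_le_sum fun u _ => h.degree_le hk hD u
    _ = #U * (D ^ 2 * n) := by rw [sum_const, nsmul_eq_mul]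

/-- An edge meets at most kD²n others in one point, with joint probability p^(2k-1), and at most
k²D, itself included, in two or more, with joint probability at most p^k. The bound covers
subfamilies because it is applied to the edges not inside a planted set. -/
lemma variance_le (h : DenseAlmostLinear V E k a D n) (hk : 2 ≤ k) (hD : 1 ≤ D) (h0 : 0 ≤ p)
    (h1 : p ≤ 1) {F : Finset (Finset α)} (hF : F ⊆ E) :
    expect V p (fun S => ((count F S : ℝ) - ∑ f ∈ F, p ^ #f) ^ 2) ≤
      k ^ 2 * D ^ 2 * (#E * p ^ k * (1 + n * p ^ (k - 1))) := by
  have hD0 : 0 ≤ D := by linarith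
  have hk1 : (1 : ℝ) ≤ k := by exact_mod_cast (by omega : 1 ≤ k)
  refine (variance_count_le h0 fun f hf => h.subset f (hF hf)).trans ?_
  have key : ∀ e ∈ F, ∑ f ∈ F with ¬ Disjoint e f, p ^ #(e ∪ f) ≤
      k ^ 2 * D ^ 2 * (p ^ k * (1 + n * p ^ (k - 1))) := by
    intro e he
    have hek := h.card e (hF he)
    have hterm : ∀ f ∈ F, ¬ Disjoint e f →
        p ^ #(e ∪ f) ≤ p ^ (2 * k - 1) + if 2 ≤ #(f ∩ e) then p ^ k else 0 := by
      intro f hf hd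
      have hfk := h.card f (hF hf)
      have hcard := card_union_add_card_inter e f
      rw [inter_comm e f] at hcard
      have hpos : 0 < #(f ∩ e) := by
        rw [card_pos, ← not_disjoint_iff_nonempty_inter, disjoint_comm]
        exact hd
      split_ifs with h2
      · have : p ^ #(e ∪ f) ≤ p ^ k := by
          apply pow_le_pow_of_le_one h0 h1
          rw [← hek]
          exact card_le_card subset_union_left
        have h3 : 0 ≤ p ^ (2 * k - 1) := by positivity
        linarith
      · rw [add_zero]
        apply le_of_eq
        congr 1
        omega
    calc ∑ f ∈ F with ¬ Disjoint e f, p ^ #(e ∪ f)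
        ≤ ∑ f ∈ F with ¬ Disjoint e f,
          (p ^ (2 * k - 1) + if 2 ≤ #(f ∩ e) then p ^ k else 0) :=
          sum_le_sum fun f hf => hterm f (mem_filter.1 hf).1 (mem_filter.1 hf).2
      _ = #{f ∈ F | ¬ Disjoint e f} * p ^ (2 * k - 1) +
          ∑ f ∈ F with ¬ Disjoint e f, (if 2 ≤ #(f ∩ e) then p ^ k else 0) := by
          rw [sum_add_distrib, sum_const, nsmul_eq_mul]
      _ ≤ k * (D ^ 2 * n) * p ^ (2 * k - 1) + k ^ 2 * D * p ^ k := by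
          refine add_le_add (mul_le_mul_of_nonneg_right ?_ (by positivity)) ?_
          · rw [← hek]
            refine le_trans ?_ (h.card_meeting_le hk hD0 e)
            have : {f ∈ F | ¬ Disjoint e f} ⊆ {f ∈ E | ¬ Disjoint f e} := by
              intro f hf
              obtain ⟨hf1, hf2⟩ := mem_filter.1 hf
              exact mem_filter.2 ⟨hF hf1, by rwa [disjoint_comm]⟩
            exact_mod_cast card_le_card this
          · calc ∑ f ∈ F with ¬ Disjoint e f, (if 2 ≤ #(f ∩ e) then p ^ k else 0)
                ≤ ∑ f ∈ E, (if 2 ≤ #(f ∩ e) then p ^ k else 0) :=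
                  sum_le_sum_of_subset_of_nonneg ((filter_subset _ _).trans hF) fun _ _ _ => by
                    split_ifs <;> positivity
              _ = #{f ∈ E | 2 ≤ #(f ∩ e)} * p ^ k := by
                  rw [← sum_filter, sum_const, nsmul_eq_mul]
              _ ≤ k ^ 2 * D * p ^ k := by
                  refine mul_le_mul_of_nonneg_right ?_ (by positivity)
                  rw [← hek]
                  exact h.card_two_common_le hD0 e
      _ ≤ k ^ 2 * D ^ 2 * (p ^ k * (1 + n * p ^ (k - 1))) := by
          have e1 : p ^ (2 * k - 1) = p ^ k * p ^ (k - 1) := by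
            rw [← pow_add]; congr 1; omega
          rw [e1]
          have hk2 : (k : ℝ) ≤ k ^ 2 := by nlinarith
          have hD2 : D ≤ D ^ 2 := by nlinarith
          have a1 : k * (D ^ 2 * n) * (p ^ k * p ^ (k - 1)) ≤
              k ^ 2 * (D ^ 2 * n) * (p ^ k * p ^ (k - 1)) :=
            mul_le_mul_of_nonneg_right (mul_le_mul_of_nonneg_right hk2 (by positivity))
              (by positivity)
          have a2 : k ^ 2 * D * p ^ k ≤ k ^ 2 * D ^ 2 * p ^ k :=
            mul_le_mul_of_nonneg_right (mul_le_mul_of_nonneg_left hD2 (by positivity))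
              (by positivity)
          linarith
  calc ∑ e ∈ F, ∑ f ∈ F with ¬ Disjoint e f, p ^ #(e ∪ f)
      ≤ ∑ e ∈ F, k ^ 2 * D ^ 2 * (p ^ k * (1 + n * p ^ (k - 1))) := sum_le_sum key
    _ = #F * (k ^ 2 * D ^ 2 * (p ^ k * (1 + n * p ^ (k - 1)))) := by
        rw [sum_const, nsmul_eq_mul]
    _ ≤ #E * (k ^ 2 * D ^ 2 * (p ^ k * (1 + n * p ^ (k - 1)))) := by
        refine mul_le_mul_of_nonneg_right ?_ (by positivity)
        exact_mod_cast card_le_card hF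
    _ = _ := by ring

/-- The random set contains a fixed set `W` spanning many edges, and on top of that the number of
edges exceeds the mean. -/
lemma half_pow_le_expect (h : DenseAlmostLinear V E k a D n) (hk : 2 ≤ k) (hD : 1 ≤ D)
    (h0 : 0 ≤ p) (h1 : p ≤ 1) {W : Finset α} (hW : W ⊆ V) {t τ : ℝ} (hτ : 0 < τ)
    (ht : t + τ ≤ count E W * (1 - p))
    (hvar : 2 * (k ^ 2 * D ^ 2 * (#E * p ^ k * (1 + n * p ^ (k - 1)))) ≤ τ ^ 2)
    {A : Finset α → Prop} [DecidablePred A] (hA : ∀ S, #E * p ^ k + t ≤ count E S → A S) :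
    p ^ #W / 2 ≤ expect V p fun S => if A S then (if W ⊆ S then 1 else 0) else 0 := by
  classical
  -- Given W ⊆ S the random set is S ∪ W with S unconditioned. The edges inside W are certain, and
  -- Chebyshev is applied to the count of F in S alone. Keeping the indicator of W ⊆ S in the
  -- conclusion allows summation over many W later.
  set F := {e ∈ E | ¬ e ⊆ W} with hF
  have hFE : F ⊆ E := filter_subset _ _
  have hsum : ∑ f ∈ F, p ^ #f = #F * p ^ k := by
    rw [sum_congr rfl fun f hf => by rw [h.card f (hFE hf)], sum_const, nsmul_eq_mul]
  have hcard : (count E W : ℝ) + #F = #E := by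
    have := card_filter_add_card_filter_not (s := E) (fun e => e ⊆ W)
    rw [count]; exact_mod_cast this
  have hcount : ∀ S, (count F S : ℝ) + count E W ≤ count E (S ∪ W) := by
    intro S
    have hdis : Disjoint {e ∈ F | e ⊆ S} {e ∈ E | e ⊆ W} := by
      rw [disjoint_left]
      intro e he he'
      exact (mem_filter.1 (mem_filter.1 he).1).2 (mem_filter.1 he').2
    rw [count, count, count]
    norm_cast
    rw [← card_union_of_disjoint hdis]
    apply card_le_card
    apply union_subset
    · intro e he
      obtain ⟨he1, he2⟩ := mem_filter.1 he
      exact mem_filter.2 ⟨hFE he1, he2.trans subset_union_left⟩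
    · intro e he
      obtain ⟨he1, he2⟩ := mem_filter.1 he
      exact mem_filter.2 ⟨he1, he2.trans subset_union_right⟩
  have e1 : expect V p (fun S => if A S then (if W ⊆ S then 1 else 0) else 0) =
      p ^ #W * expect V p fun S => if A (S ∪ W) then 1 else 0 := by
    rw [← expect_ite_subset hW fun S => if A S then 1 else 0]
    refine expect_congr fun S _ => ?_
    by_cases hA : A S <;> by_cases hS : W ⊆ S <;> simp [hA, hS]
  have h2 := one_sub_le_prob (V := V) h0 h1 (fun S => (count F S : ℝ)) (∑ f ∈ F, p ^ #f) hτ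
  have h3 : expect V p (fun S => ((count F S : ℝ) - ∑ f ∈ F, p ^ #f) ^ 2) / τ ^ 2 ≤ 1 / 2 := by
    rw [div_le_iff₀ (by positivity)]
    have := h.variance_le hk hD h0 h1 hFE
    linarith
  have h4 : prob V p (fun S => ∑ f ∈ F, p ^ #f - τ ≤ count F S) ≤
      expect V p fun S => if A (S ∪ W) then 1 else 0 := by
    refine expect_mono h0 h1 fun S _ => ?_
    by_cases hS : ∑ f ∈ F, p ^ #f - τ ≤ count F S
    · rw [if_pos hS, if_pos]
      apply hA
      refine le_trans ?_ (hcount S)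
      rw [hsum] at hS
      -- The mean of F misses `count E W * p ^ k`, at most `count E W * p`, while W contributes
      -- `count E W`; the net gain is at least `count E W * (1 - p)`.
      have hpk : p ^ k ≤ p := pow_le_of_le_one h0 h1 (by omega)
      have hc0 : (0 : ℝ) ≤ count E W := by positivity
      rw [← hcard]
      nlinarith
    · rw [if_neg hS]; split_ifs <;> norm_num
  rw [e1, div_eq_mul_one_div]
  refine mul_le_mul_of_nonneg_left ?_ (by positivity)
  linarith

lemma half_pow_le_prob (h : DenseAlmostLinear V E k a D n) (hk : 2 ≤ k) (hD : 1 ≤ D)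
    (h0 : 0 ≤ p) (h1 : p ≤ 1) {W : Finset α} (hW : W ⊆ V) {t τ : ℝ} (hτ : 0 < τ)
    (ht : t + τ ≤ count E W * (1 - p))
    (hvar : 2 * (k ^ 2 * D ^ 2 * (#E * p ^ k * (1 + n * p ^ (k - 1)))) ≤ τ ^ 2) :
    p ^ #W / 2 ≤ prob V p fun S => #E * p ^ k + t ≤ count E S := by
  classical
  refine (h.half_pow_le_expect hk hD h0 h1 hW hτ ht hvar
    (A := fun S => #E * p ^ k + t ≤ count E S) fun _ h => h).trans ?_
  refine expect_mono h0 h1 fun S _ => ?_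
  by_cases hS : #E * p ^ k + t ≤ count E S
  · simp only [hS, if_true]; split_ifs <;> norm_num
  · simp [hS]

lemma pow_le_prob (h0 : 0 ≤ p) (h1 : p ≤ 1) {W : Finset α} (hW : W ⊆ V)
    {x : ℝ} (hx : x ≤ count E W) : p ^ #W ≤ prob V p fun S => x ≤ count E S := by
  rw [← expect_subset hW]
  refine expect_mono h0 h1 fun S _ => ?_
  by_cases hS : W ⊆ S
  · rw [if_pos hS, if_pos]
    refine hx.trans ?_
    rw [count, count]
    norm_cast
    refine card_le_card fun e he => ?_
    obtain ⟨he1, he2⟩ := mem_filter.1 he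
    exact mem_filter.2 ⟨he1, he2.trans hS⟩
  · rw [if_neg hS]; split_ifs <;> norm_num

/-- A cluster of edges gives a lower bound on the upper tail. -/
lemma cluster_le_prob (h : DenseAlmostLinear V E k a D n) (hk : 2 ≤ k) (hD : 1 ≤ D)
    (h0 : 0 < p) {γ B t₀ t lam : ℝ} (hγ : 0 < γ) (h1 : p ≤ 1 - γ) (hB : 0 < B) (ht₀ : 0 < t₀)
    (ht : t₀ ≤ t) (hΛ : #E * p ^ k * (1 + n * p ^ (k - 1)) ≤ B * t ^ 2)
    (hlam : (1 + √(2 * (k ^ 2 * D ^ 2) * B)) / γ ≤ lam)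
    (hW : ∃ W ⊆ V, (#W : ℝ) ≤ D * max √(min (lam * t) (#E * p ^ k + t)) 1 ∧
      min (lam * t) (#E * p ^ k + t) ≤ count E W) :
    1 / 2 * exp (-(D * (√lam + 1 / √t₀)) * (√t * log (1 / p))) ≤
      prob V p fun S => #E * p ^ k + t ≤ count E S := by
  obtain ⟨W, hWV, hWc, hWe⟩ := hW
  have hp1 : p ≤ 1 := by linarith
  have ht0 : 0 < t := by linarith
  have hst : 0 < √t := sqrt_pos.2 ht0
  have hst₀ : 0 < √t₀ := sqrt_pos.2 ht₀
  have hlog : 0 ≤ -log p := by linarith [log_nonpos h0.le hp1]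
  -- The summand 1/√t₀ takes care of the 1 in the maximum, since t ≥ t₀.
  have hWc' : (#W : ℝ) ≤ D * (√lam + 1 / √t₀) * √t := by
    refine hWc.trans ?_
    rw [mul_assoc]
    refine mul_le_mul_of_nonneg_left (max_le ?_ ?_) (by linarith)
    · have hlam0 : 0 ≤ lam := le_trans (by positivity) hlam
      calc √(min (lam * t) (#E * p ^ k + t)) ≤ √(lam * t) := sqrt_le_sqrt (min_le_left _ _)
        _ = √lam * √t := sqrt_mul hlam0 _
        _ ≤ (√lam + 1 / √t₀) * √t := by
          gcongr
          have : 0 < 1 / √t₀ := by positivity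
          linarith
    · calc (1 : ℝ) = 1 / √t₀ * √t₀ := by field_simp
        _ ≤ (√lam + 1 / √t₀) * √t := by
          gcongr
          linarith [sqrt_nonneg lam]
  have hpW : exp (-(D * (√lam + 1 / √t₀)) * (√t * log (1 / p))) ≤ p ^ #W := by
    have e1 : p ^ #W = exp (-(#W * (-log p))) := by
      rw [← exp_log (pow_pos h0 _), log_pow]; congr 1; ring
    rw [e1]
    apply exp_le_exp.2
    rw [one_div p, log_inv]
    nlinarith
  -- If the cluster has λt edges, λγ ≥ 1 + r leaves t for the deviation and rt for the Chebyshev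
  -- error. If it has μ + t edges, it suffices on its own.
  rcases le_total (lam * t) (#E * p ^ k + t) with hc | hc
  · rw [min_eq_left hc] at hWe
    set r := √(2 * (k ^ 2 * D ^ 2) * B) with hr
    have hk0 : (0 : ℝ) < k := by exact_mod_cast (by omega : 0 < k)
    have hr0 : 0 < r := sqrt_pos.2 (by positivity)
    have hr2 : r ^ 2 = 2 * (k ^ 2 * D ^ 2) * B := sq_sqrt (by positivity)
    have := h.half_pow_le_prob hk hD h0.le hp1 hWV (t := t) (τ := r * t) (by positivity) ?_ ?_
    · linarith
    · rw [div_le_iff₀ hγ] at hlam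
      calc t + r * t = (1 + r) * t := by ring
        _ ≤ lam * γ * t := by gcongr
        _ = lam * t * γ := by ring
        _ ≤ count E W * (1 - p) := by
          gcongr
          linarith
    · rw [mul_pow, hr2]
      calc 2 * (k ^ 2 * D ^ 2 * (#E * p ^ k * (1 + n * p ^ (k - 1))))
          ≤ 2 * (k ^ 2 * D ^ 2 * (B * t ^ 2)) := by gcongr
        _ = _ := by ring
  · rw [min_eq_right hc] at hWe
    have := pow_le_prob (V := V) h0.le hp1 hWV hWe
    have h2 : 0 ≤ p ^ #W := by positivity
    linarith

end DenseAlmostLinear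

end BinomialSubset

/-! ### Variance lower bound and comparison with a larger density. -/

namespace BinomialSubset

open Finset

lemma covariance_nonneg {α : Type*} [DecidableEq α] {p : ℝ} (h0 : 0 ≤ p) (h1 : p ≤ 1)
    (e f : Finset α) : 0 ≤ p ^ #(e ∪ f) - p ^ #e * p ^ #f := by
  rw [← pow_add, sub_nonneg]
  exact pow_le_pow_of_le_one h0 h1 (card_union_le e f)

namespace DenseAlmostLinear

variable {α : Type*} [DecidableEq α] {V : Finset α} {p : ℝ}
variable {E : Finset (Finset α)} {k n : ℕ} {a D : ℝ}

/-- All covariances are nonnegative; only the diagonal terms are kept. -/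
lemma mean_mul_le_variance (h : DenseAlmostLinear V E k a D n) (hk : 1 ≤ k)
    (h0 : 0 ≤ p) (h1 : p ≤ 1) : #E * p ^ k * (1 - p) ≤
      expect V p fun S => ((count E S : ℝ) - ∑ f ∈ E, p ^ #f) ^ 2 := by
  rw [variance_count h.subset]
  calc #E * p ^ k * (1 - p) = ∑ e ∈ E, p ^ k * (1 - p) := by
        rw [sum_const, nsmul_eq_mul, mul_assoc]
    _ ≤ ∑ e ∈ E, ∑ f ∈ E, (p ^ #(e ∪ f) - p ^ #e * p ^ #f) := by
      refine sum_le_sum fun e he => ?_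
      refine le_trans ?_ (single_le_sum (fun f _ => covariance_nonneg h0 h1 e f) he)
      rw [union_self, h.card e he]
      have h2 : p ^ k ≤ p := pow_le_of_le_one h0 h1 (by omega)
      have h3 : 0 ≤ p ^ k := by positivity
      nlinarith

/-- Cauchy-Schwarz for the degrees: they sum to k|E| over at most Dn vertices, and the sum of their
squares, being the sum of |e ∩ f| over ordered pairs, is at most k times the number of meeting
pairs. Then |E| ≥ an² is used. -/
lemma le_card_meeting_pairs (h : DenseAlmostLinear V E k a D n) (hk : 1 ≤ k) (hD : 0 < D)
    (hn : 1 ≤ n) : #E * (a / D * n) ≤ ∑ e ∈ E, (#{f ∈ E | ¬ Disjoint e f} : ℝ) := by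
  set T := ∑ e ∈ E, (#{f ∈ E | ¬ Disjoint e f} : ℝ) with hT
  have hn0 : (0 : ℝ) < n := by exact_mod_cast hn
  have hk1 : (1 : ℝ) ≤ k := by exact_mod_cast hk
  have hdeg : ∀ v, (#{e ∈ E | v ∈ e} : ℝ) = ∑ e ∈ E, if v ∈ e then 1 else 0 := by
    intro v; rw [card_filter]; push_cast; rfl
  have h1 : ∑ v ∈ V, (#{e ∈ E | v ∈ e} : ℝ) = k * #E := by
    simp only [hdeg]
    rw [sum_comm]
    calc ∑ e ∈ E, ∑ v ∈ V, (if v ∈ e then (1 : ℝ) else 0) = ∑ e ∈ E, (k : ℝ) := by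
          refine sum_congr rfl fun e he => ?_
          rw [sum_ite_mem, sum_const, nsmul_eq_mul, mul_one,
            inter_eq_right.2 (h.subset e he), h.card e he]
      _ = k * #E := by rw [sum_const, nsmul_eq_mul, mul_comm]
  have h2 : ∑ v ∈ V, (#{e ∈ E | v ∈ e} : ℝ) ^ 2 ≤ k * T := by
    have e1 : ∑ v ∈ V, (#{e ∈ E | v ∈ e} : ℝ) ^ 2 =
        ∑ e ∈ E, ∑ f ∈ E, (#(e ∩ f) : ℝ) := by
      simp only [hdeg, sq, sum_mul_sum]
      rw [sum_comm]
      refine sum_congr rfl fun e he => ?_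
      rw [sum_comm]
      refine sum_congr rfl fun f hf => ?_
      have : ∀ v, (if v ∈ e then (1 : ℝ) else 0) * (if v ∈ f then 1 else 0) =
          if v ∈ e ∩ f then 1 else 0 := by
        intro v; by_cases h1 : v ∈ e <;> by_cases h2 : v ∈ f <;> simp [h1, h2]
      simp only [this]
      rw [sum_ite_mem, sum_const, nsmul_eq_mul, mul_one,
        inter_eq_right.2 (inter_subset_left.trans (h.subset e he))]
    rw [e1, hT, mul_sum]
    refine sum_le_sum fun e he => ?_
    calc ∑ f ∈ E, (#(e ∩ f) : ℝ) ≤ ∑ f ∈ E, if Disjoint e f then 0 else (k : ℝ) := by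
          refine sum_le_sum fun f _ => ?_
          split_ifs with hd
          · rw [disjoint_iff_inter_eq_empty] at hd
            simp [hd]
          · rw [← h.card e he]
            exact_mod_cast card_le_card inter_subset_left
      _ = k * #{f ∈ E | ¬ Disjoint e f} := by
          simp only [sum_ite, sum_const_zero, zero_add, sum_const, nsmul_eq_mul, mul_comm]
  have h3 := sq_sum_le_card_mul_sum_sq (s := V) (f := fun v => (#{e ∈ E | v ∈ e} : ℝ))
  rw [h1] at h3
  have hT0 : 0 ≤ T := sum_nonneg fun _ _ => by positivity
  have h4 : (k * #E : ℝ) ^ 2 ≤ D * n * (k * T) := by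
    refine h3.trans ?_
    exact mul_le_mul h.card_vertices_le h2 (sum_nonneg fun _ _ => by positivity) (by positivity)
  have hE0 : (0 : ℝ) ≤ #E := by positivity
  have h5 : (#E : ℝ) ^ 2 ≤ D * n * T := by
    have : k * (k * (#E : ℝ) ^ 2) ≤ k * (D * n * T) := by nlinarith
    have h6 := le_of_mul_le_mul_left this (by linarith)
    nlinarith [sq_nonneg (#E : ℝ)]
  have h6 : #E * (a * n ^ 2) ≤ D * n * T := by nlinarith [h.le_card_edges]
  have h7 : n * (#E * (a * n)) ≤ n * (D * T) := by nlinarith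
  have h8 := le_of_mul_le_mul_left h7 hn0
  rw [div_mul_eq_mul_div, mul_div_assoc', div_le_iff₀ hD]
  linarith

/-- Averages the diagonal bound with the bound from meeting pairs, each of covariance at least
(1-p)p^(2k-1). Away from p = 1 it makes Var X and Λ comparable. -/
lemma le_variance (h : DenseAlmostLinear V E k a D n) (hk : 1 ≤ k) (hD : 0 < D) (hn : 1 ≤ n)
    (h0 : 0 ≤ p) (h1 : p ≤ 1) :
    (1 - p) * (min 1 (a / D) / 2) * (#E * p ^ k * (1 + n * p ^ (k - 1))) ≤
      expect V p fun S => ((count E S : ℝ) - ∑ f ∈ E, p ^ #f) ^ 2 := by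
  have hv1 := h.mean_mul_le_variance hk h0 h1
  have hv2 : (1 - p) * (#E * (a / D * n)) * (p ^ k * p ^ (k - 1)) ≤
      expect V p fun S => ((count E S : ℝ) - ∑ f ∈ E, p ^ #f) ^ 2 := by
    rw [variance_count h.subset]
    calc (1 - p) * (#E * (a / D * n)) * (p ^ k * p ^ (k - 1))
        ≤ (1 - p) * (∑ e ∈ E, (#{f ∈ E | ¬ Disjoint e f} : ℝ)) * (p ^ k * p ^ (k - 1)) := by
          refine mul_le_mul_of_nonneg_right (mul_le_mul_of_nonneg_left
            (h.le_card_meeting_pairs hk hD hn) (by linarith)) (by positivity)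
      _ = ∑ e ∈ E, ∑ f ∈ E with ¬ Disjoint e f, (1 - p) * (p ^ k * p ^ (k - 1)) := by
          rw [mul_sum, sum_mul]
          refine sum_congr rfl fun e _ => ?_
          rw [sum_const, nsmul_eq_mul]; ring
      _ ≤ ∑ e ∈ E, ∑ f ∈ E, (p ^ #(e ∪ f) - p ^ #e * p ^ #f) := by
          refine sum_le_sum fun e he => ?_
          rw [sum_filter]
          refine sum_le_sum fun f hf => ?_
          split_ifs with hd
          · exact covariance_nonneg h0 h1 e f
          · have hc := card_union_add_card_inter e f
            rw [h.card e he, h.card f hf] at hc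
            have hpos : 0 < #(e ∩ f) := by
              rw [card_pos, ← not_disjoint_iff_nonempty_inter]; exact hd
            have h3 : p ^ k * p ^ (k - 1) ≤ p ^ #(e ∪ f) := by
              rw [← pow_add]
              exact pow_le_pow_of_le_one h0 h1 (by omega)
            rw [h.card e he, h.card f hf]
            have h4 : p ^ k = p ^ (k - 1) * p := by
              rw [← pow_succ]; congr 1; omega
            have h5 : p ^ k * p ^ k = p ^ k * p ^ (k - 1) * p := by
              nth_rw 2 [h4]; ring
            rw [h5]
            linarith
  set v := expect V p fun S => ((count E S : ℝ) - ∑ f ∈ E, p ^ #f) ^ 2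
  have h1p : 0 ≤ 1 - p := by linarith
  have b1 : min 1 (a / D) * (#E * p ^ k * (1 - p)) ≤ v := by
    refine le_trans ?_ hv1
    exact mul_le_of_le_one_left (by positivity) (min_le_left _ _)
  have b2 : min 1 (a / D) * ((1 - p) * (#E * n) * (p ^ k * p ^ (k - 1))) ≤ v := by
    refine le_trans ?_ hv2
    calc min 1 (a / D) * ((1 - p) * (#E * n) * (p ^ k * p ^ (k - 1)))
        ≤ a / D * ((1 - p) * (#E * n) * (p ^ k * p ^ (k - 1))) :=
          mul_le_mul_of_nonneg_right (min_le_right _ _) (by positivity)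
      _ = _ := by ring
  linarith

/-- Comparison with a slightly larger density. -/
lemma exp_le_prob_of_tilt (h : DenseAlmostLinear V E k a D n) (hk : 2 ≤ k) (hD : 1 ≤ D)
    (h0 : 0 < p) {γ B t K : ℝ} (hγ : 0 < γ) (hγ1 : γ < 1) (h1 : p ≤ 1 - γ)
    (ht : 0 < t) (hm : 0 < #E * p ^ k) (hK1 : 1 ≤ K)
    (hK : 2 * (k ^ 2 * D ^ 2 * 4 ^ k * B) ≤ K ^ 2)
    (hΛ : #E * p ^ k * (1 + n * p ^ (k - 1)) ≤ B * t ^ 2)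
    (hθ : K * t / (#E * p ^ k) ≤ γ) :
    1 / 4 * exp (-(D * n * (p * (K * t / (#E * p ^ k)) ^ 2 / γ))) ≤
      prob V p fun S => #E * p ^ k + t ≤ count E S := by
  set m := #E * p ^ k with hmdef
  set θ := K * t / m with hθdef
  have hk2 : (2 : ℝ) ≤ k := by exact_mod_cast hk
  have hθ0 : 0 < θ := by positivity
  have hp1 : p < 1 := by linarith
  set p' := p * (1 + θ) with hp'
  have hp'0 : 0 < p' := by positivity
  have hp'1 : p' ≤ 1 := by rw [hp']; nlinarith
  have hp'2 : p' ≤ 2 * p := by rw [hp']; nlinarith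
  -- Since k ≥ 2, the mean rises by at least 2mθ = 2Kt. One Kt is lost to Chebyshev at density p',
  -- the other covers t.
  have hm' : m + 2 * (K * t) ≤ #E * p' ^ k := by
    have hb := one_add_mul_le_pow (show (-2 : ℝ) ≤ θ by linarith) k
    have hKt : m * θ = K * t := by rw [hθdef]; field_simp
    calc m + 2 * (K * t) = m * (1 + 2 * θ) := by rw [← hKt]; ring
      _ ≤ m * (1 + k * θ) := by gcongr
      _ ≤ m * (1 + θ) ^ k := by gcongr
      _ = #E * p' ^ k := by rw [hmdef, hp', mul_pow]; ring
  have hvar := h.variance_le hk hD hp'0.le hp'1 (subset_refl E)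
  have hΛ' : #E * p' ^ k * (1 + n * p' ^ (k - 1)) ≤ 4 ^ k * (B * t ^ 2) := by
    calc #E * p' ^ k * (1 + n * p' ^ (k - 1))
        ≤ #E * (2 * p) ^ k * (1 + n * (2 * p) ^ (k - 1)) := by gcongr
      _ = 2 ^ k * m * (1 + 2 ^ (k - 1) * (n * p ^ (k - 1))) := by
        rw [mul_pow, mul_pow, hmdef]; ring
      _ ≤ 2 ^ k * m * (2 ^ k * (1 + n * p ^ (k - 1))) := by
        gcongr
        have h2 : (1 : ℝ) ≤ 2 ^ k := one_le_pow₀ (by norm_num)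
        have h3 : (2 : ℝ) ^ (k - 1) ≤ 2 ^ k := pow_le_pow_right₀ (by norm_num) (by omega)
        have h4 : 0 ≤ n * p ^ (k - 1) := by positivity
        nlinarith
      _ = 4 ^ k * (m * (1 + n * p ^ (k - 1))) := by
        have : (4 : ℝ) ^ k = 2 ^ k * 2 ^ k := by rw [← mul_pow]; norm_num
        rw [this]; ring
      _ ≤ 4 ^ k * (B * t ^ 2) := by gcongr
  have hcheb := one_sub_le_prob (V := V) hp'0.le hp'1 (fun S => (count E S : ℝ))
    (∑ f ∈ E, p' ^ #f) (show 0 < K * t by positivity)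
  have hhalf : 1 / 2 ≤ prob V p' fun S => m + t ≤ count E S := by
    have h3 : expect V p' (fun S => ((count E S : ℝ) - ∑ f ∈ E, p' ^ #f) ^ 2) / (K * t) ^ 2 ≤
        1 / 2 := by
      rw [div_le_iff₀ (by positivity)]
      calc expect V p' (fun S => ((count E S : ℝ) - ∑ f ∈ E, p' ^ #f) ^ 2)
          ≤ k ^ 2 * D ^ 2 * (4 ^ k * (B * t ^ 2)) := hvar.trans (by gcongr)
        _ = 1 / 2 * (2 * (k ^ 2 * D ^ 2 * 4 ^ k * B) * t ^ 2) := by ring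
        _ ≤ 1 / 2 * (K ^ 2 * t ^ 2) := by gcongr
        _ = 1 / 2 * (K * t) ^ 2 := by ring
    have h4 : (prob V p' fun S => ∑ f ∈ E, p' ^ #f - K * t ≤ count E S) ≤
        prob V p' fun S => m + t ≤ count E S := by
      refine prob_mono hp'0.le hp'1 fun S _ hS => ?_
      rw [h.sum_pow_card] at hS
      have : t ≤ K * t := le_mul_of_one_le_left ht.le hK1
      linarith
    linarith
  have hcs := sq_prob_le_prob_mul (V := V) h0 hp1 (p' := p') (fun S => m + t ≤ count E S)
  -- The price of returning to density p: each of the at most Dn points contributes a factor 1 +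
  -- pθ²/(1-p).
  have hpow : (1 + (p' - p) ^ 2 / (p * (1 - p))) ^ #V ≤ exp (D * n * (p * θ ^ 2 / γ)) := by
    have e1 : (p' - p) ^ 2 / (p * (1 - p)) = p * θ ^ 2 / (1 - p) := by
      have : 1 - p ≠ 0 := by linarith
      rw [hp']; field_simp; ring
    have e2 : p * θ ^ 2 / (1 - p) ≤ p * θ ^ 2 / γ := by
      gcongr
      linarith
    rw [e1]
    have h1p : 0 < 1 - p := by linarith
    calc (1 + p * θ ^ 2 / (1 - p)) ^ #V ≤ (exp (p * θ ^ 2 / γ)) ^ #V := by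
          gcongr
          linarith [add_one_le_exp (p * θ ^ 2 / γ)]
      _ = exp (#V * (p * θ ^ 2 / γ)) := by rw [← exp_nat_mul]
      _ ≤ exp (D * n * (p * θ ^ 2 / γ)) := by
          gcongr
          exact h.card_vertices_le
  have hP0 := prob_nonneg (V := V) h0.le hp1.le (fun S => m + t ≤ count E S)
  have h5 : 1 / 4 ≤ prob V p (fun S => m + t ≤ count E S) * exp (D * n * (p * θ ^ 2 / γ)) := by
    calc (1 : ℝ) / 4 = (1 / 2) ^ 2 := by norm_num
      _ ≤ (prob V p' fun S => m + t ≤ count E S) ^ 2 := by gcongr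
      _ ≤ _ := hcs.trans (by gcongr)
  rw [exp_neg, ← div_eq_mul_inv, div_le_iff₀ (exp_pos _)]
  exact h5

end DenseAlmostLinear

end BinomialSubset

/-! ### The lower bound in the dense range. -/

namespace BinomialSubset

open Finset

lemma le_rate {t m q : ℝ} (ht : 0 < t) (hm : 0 < m) (hq : 0 ≤ q) :
    t * log (1 + t / m) / 2 / (1 + q) ≤ chernoffRate (t / m) * m ^ 2 / (m * (1 + q)) := by
  have h := half_mul_log_le_chernoffRate (show 0 ≤ t / m by positivity)
  calc t * log (1 + t / m) / 2 / (1 + q) = t / m * log (1 + t / m) / 2 * m / (1 + q) := by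
        field_simp
    _ ≤ chernoffRate (t / m) * m / (1 + q) := by gcongr
    _ = chernoffRate (t / m) * m ^ 2 / (m * (1 + q)) := by field_simp

lemma log_one_div_le {p : ℝ} (h0 : 0 < p) : log (1 / p) ≤ 2 / √p := by
  have hs : 0 < √p := sqrt_pos.2 h0
  have h := log_le_sub_one_of_pos (show 0 < 1 / √p by positivity)
  have e : log (1 / p) = 2 * log (1 / √p) := by
    rw [one_div, one_div, log_inv, log_inv, log_sqrt h0.le]; ring
  rw [e]
  have : 2 / √p = 2 * (1 / √p) := by ring
  linarith

/-- Combining the two lower bounds. -/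
lemma mul_exp_neg_min_le {d₁ d₂ d C C₁ C₂ x y z P : ℝ} (hx : d₁ * exp (-(C₁ * x)) ≤ P)
    (hy : d₂ * exp (-(C₂ * y)) ≤ P) (hd1 : d ≤ d₁) (hd2 : d ≤ d₂) (hd : 0 < d)
    (hC1 : C₁ ≤ C) (hC2 : C₂ ≤ C) (hx0 : 0 ≤ x) (hy0 : 0 ≤ y) (hz : z = min x y) :
    d * exp (-C * z) ≤ P := by
  rcases min_choice x y with h | h
  · refine le_trans ?_ hx
    rw [hz, h, neg_mul]
    have := hd.le.trans hd1
    gcongr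
  · refine le_trans ?_ hy
    rw [hz, h, neg_mul]
    have := hd.le.trans hd2
    gcongr

/-- In the dense range `t ≥ c₀ * m` the clustering term is the smaller one. -/
lemma sqrt_mul_log_le_rate {k n : ℕ} (hk : 3 ≤ k) {a p t m c₀ M : ℝ} (ha : 0 < a) (h0 : 0 < p)
    (h1 : p ≤ 1) (hn : 1 ≤ n) (ht : 0 < t) (hm : 0 < m) (hma : a * (n ^ 2 * p ^ k) ≤ m)
    (hc₀ : 0 < c₀) (hc₀1 : c₀ ≤ 1) (htm : c₀ * m ≤ t) (hM : 0 < M)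
    (hqM : 1 + n * p ^ (k - 1) ≤ M * (n * p ^ (k - 1))) :
    c₀ * √(c₀ * a) / (8 * M) * (√t * log (1 / p)) ≤
      chernoffRate (t / m) * m ^ 2 / (m * (1 + n * p ^ (k - 1))) := by
  have hn0 : (0 : ℝ) < n := by exact_mod_cast hn
  set q := n * p ^ (k - 1) with hq
  have hq0 : 0 < q := by positivity
  refine le_trans ?_ (le_rate ht hm hq0.le)
  have hsp : 0 < √p := sqrt_pos.2 h0
  have hst : 0 < √t := sqrt_pos.2 ht
  have e : t = √t * √t := (mul_self_sqrt ht.le).symm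
  have hlog : c₀ / 2 ≤ log (1 + t / m) := by
    refine (half_le_log_one_add hc₀.le hc₀1).trans (log_le_log (by linarith) ?_)
    have : c₀ ≤ t / m := by rwa [le_div_iff₀ hm]
    linarith
  -- As t is at least of order n²p^k, √t dominates n p^(k/2), and this is at least n p^(k-1)/√p
  -- exactly because k ≥ 3. Together with log(1/p) ≤ 2/√p it bounds q log(1/p) by O(√t).
  have hsq : √(c₀ * a) * (q / √p) ≤ √t := by
    have h2 : √(c₀ * a) * (n * √(p ^ k)) ≤ √t := by
      have : √(c₀ * a) * (n * √(p ^ k)) = √(c₀ * (a * (n ^ 2 * p ^ k))) := by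
        rw [← mul_assoc c₀, sqrt_mul (show 0 ≤ c₀ * a by positivity),
          sqrt_mul (show 0 ≤ (n : ℝ) ^ 2 by positivity), sqrt_sq hn0.le]
      rw [this]
      exact sqrt_le_sqrt (le_trans (by gcongr) htm)
    refine le_trans ?_ h2
    gcongr
    rw [hq, mul_div_assoc]
    gcongr
    rw [div_le_iff₀ hsp, ← sqrt_mul (by positivity), ← pow_succ]
    apply le_sqrt_of_sq_le
    rw [← pow_mul]
    exact pow_le_pow_of_le_one h0.le h1 (by omega)
  have hlogp := log_one_div_le h0
  have hlt : √(c₀ * a) * (q * log (1 / p)) ≤ 2 * √t := by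
    calc √(c₀ * a) * (q * log (1 / p)) ≤ √(c₀ * a) * (q * (2 / √p)) := by gcongr
      _ = 2 * (√(c₀ * a) * (q / √p)) := by ring
      _ ≤ 2 * √t := by gcongr
  rw [le_div_iff₀ (by linarith)]
  have hlp : 0 ≤ log (1 / p) := log_nonneg (one_le_one_div h0 h1)
  calc c₀ * √(c₀ * a) / (8 * M) * (√t * log (1 / p)) * (1 + q)
      ≤ c₀ * √(c₀ * a) / (8 * M) * (√t * log (1 / p)) * (M * q) := by gcongr
    _ = c₀ / 8 * √t * (√(c₀ * a) * (q * log (1 / p))) := by field_simp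
    _ ≤ c₀ / 8 * √t * (2 * √t) := by gcongr
    _ = t * (c₀ / 2) / 2 := by
      rw [e, sqrt_mul_self hst.le]; ring
    _ ≤ t * log (1 + t / m) / 2 := by gcongr

set_option maxHeartbeats 1000000 in
/-- The lower bound for densities of order at least `n ^ (-1 / (k - 1))`. -/
theorem exists_le_prob_of_dense {k : ℕ} (hk : 3 ≤ k) {a D γ B : ℝ} (ha : 0 < a) (hD : 1 ≤ D)
    (hγ : 0 < γ) (hγ1 : γ < 1) (hB : 1 ≤ B) : ∃ lam₀ : ℝ, ∀ lam : ℝ, lam₀ ≤ lam →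
      ∃ C > 0, ∃ d > 0, ∀ {α : Type*} [DecidableEq α] {V : Finset α}
      {E : Finset (Finset α)} {n : ℕ} {p t m : ℝ}, DenseAlmostLinear V E k a D n → 1 ≤ n →
      0 < p → p ≤ 1 - γ → 0 < t → m = #E * p ^ k → γ ^ (k - 1) ≤ n * p ^ (k - 1) → 1 ≤ m + t →
      m * (1 + n * p ^ (k - 1)) ≤ B * t ^ 2 →
      (∃ W ⊆ V, (#W : ℝ) ≤ D * max √(min (lam * t) (m + t)) 1 ∧
        min (lam * t) (m + t) ≤ count E W) →
      d * exp (-C * min (chernoffRate (t / m) * m ^ 2 / (m * (1 + n * p ^ (k - 1))))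
          (√t * log (1 / p))) ≤ prob V p fun S => m + t ≤ count E S := by
  have hk2 : (2 : ℝ) ≤ k := by exact_mod_cast (by omega : 2 ≤ k)
  have hD0 : 0 < D := by linarith
  have hB0 : 0 < B := by linarith
  refine ⟨(1 + √(2 * (k ^ 2 * D ^ 2) * B)) / γ, fun lam hlam => ?_⟩
  set M := 1 + (γ ^ (k - 1))⁻¹ with hM
  have hM0 : 0 < M := by positivity
  set K := 1 + 2 * (k ^ 2 * D ^ 2 * 4 ^ k * B) with hK
  have hK1 : 1 ≤ K := by
    have : 0 < 2 * (k ^ 2 * D ^ 2 * 4 ^ k * B) := by positivity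
    linarith
  have hK2 : 2 * (k ^ 2 * D ^ 2 * 4 ^ k * B) ≤ K ^ 2 := by
    rw [hK]
    have : 0 < 2 * (k ^ 2 * D ^ 2 * 4 ^ k * B) := by positivity
    nlinarith
  -- Tilting is possible while θ = Kt/μ ≤ γ, that is, t ≤ c₀μ; beyond that the clustering term is
  -- the smaller one up to a constant.
  set c₀ := γ / K with hc₀
  have hc₀0 : 0 < c₀ := by positivity
  have hc₀1 : c₀ ≤ 1 := by rw [hc₀, div_le_one (by linarith)]; linarith
  -- The conditions μ + t ≥ 1 and μ ≤ Bt² exclude smaller t.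
  set t₀ := 1 / (2 * B) with ht₀
  have ht₀0 : 0 < t₀ := by positivity
  set C₁ := D * (√lam + 1 / √t₀) with hC₁
  have hC₁0 : 0 < C₁ := by
    have : 0 < √t₀ := sqrt_pos.2 ht₀0
    positivity
  set κ := c₀ * √(c₀ * a) / (8 * M) with hκ
  have hκ0 : 0 < κ := by
    have : 0 < √(c₀ * a) := sqrt_pos.2 (by positivity)
    positivity
  set C₂ := 4 * D * K ^ 2 * M / (γ * a) with hC₂
  have hC₂0 : 0 < C₂ := by positivity
  refine ⟨C₁ + C₁ / κ + C₂, by positivity, 1 / 4, by norm_num, ?_⟩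
  intro α _ V E n p t m h hn h0 h1 ht hm hq hmt hΛ hW
  have hn0 : (0 : ℝ) < n := by exact_mod_cast hn
  have hp1 : p ≤ 1 := by linarith
  have hE0 : (0 : ℝ) < #E := lt_of_lt_of_le (by positivity) h.le_card_edges
  have hm0 : 0 < m := by rw [hm]; positivity
  have hma : a * (n ^ 2 * p ^ k) ≤ m := by
    rw [hm, ← mul_assoc]; exact mul_le_mul_of_nonneg_right h.le_card_edges (by positivity)
  have hq0 : 0 < n * p ^ (k - 1) := by positivity
  have hqM : 1 + n * p ^ (k - 1) ≤ M * (n * p ^ (k - 1)) := by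
    have h2 : 1 ≤ (γ ^ (k - 1))⁻¹ * (n * p ^ (k - 1)) := by
      rw [inv_mul_eq_div, le_div_iff₀ (by positivity)]; linarith
    rw [hM]; linarith
  have htt : t₀ ≤ t := by
    by_contra! hlt
    rw [ht₀, lt_div_iff₀ (by positivity)] at hlt
    have h2 : m ≤ B * t ^ 2 := le_trans (le_mul_of_one_le_right hm0.le (by linarith)) hΛ
    nlinarith
  have hclus : 1 / 2 * exp (-(C₁ * (√t * log (1 / p)))) ≤
      prob V p fun S => m + t ≤ count E S := by
    have := h.cluster_le_prob (by omega) hD h0 hγ h1 hB0 ht₀0 htt (by rwa [← hm]) hlam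
      (by rwa [← hm])
    rwa [← hm, neg_mul] at this
  have hlp : 0 ≤ √t * log (1 / p) := mul_nonneg (sqrt_nonneg _) (log_nonneg (one_le_one_div h0 hp1))
  have hR0 : 0 ≤ chernoffRate (t / m) * m ^ 2 / (m * (1 + n * p ^ (k - 1))) := by
    refine le_trans ?_ (le_rate ht hm0 hq0.le)
    have : 0 ≤ log (1 + t / m) := log_nonneg (by
      have : 0 < t / m := by positivity
      linarith)
    positivity
  rcases le_total t (c₀ * m) with htm | htm
  · have hθ : K * t / m ≤ γ := by
      rw [div_le_iff₀ hm0]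
      calc K * t ≤ K * (c₀ * m) := by gcongr
        _ = γ * m := by rw [hc₀]; field_simp
    have htilt := h.exp_le_prob_of_tilt (by omega) hD h0 hγ hγ1 h1 ht (by rwa [← hm]) hK1 hK2
      (by rwa [← hm]) (by rwa [← hm])
    rw [← hm] at htilt
    have hexp : D * n * (p * (K * t / m) ^ 2 / γ) ≤
        C₂ * (chernoffRate (t / m) * m ^ 2 / (m * (1 + n * p ^ (k - 1)))) := by
      have hl := half_le_log_one_add (show 0 ≤ t / m by positivity)
        (by rw [div_le_one hm0]; exact htm.trans (mul_le_of_le_one_left hm0.le hc₀1))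
      -- As q is bounded below, np(1 + q) is of order npq = n²p^k, at most of order μ. Thus the
      -- tilting cost npθ² is of order t²/(μ(1 + q)), the Gaussian form of the rate.
      have hnpq : n * p * (1 + n * p ^ (k - 1)) ≤ M / a * m := by
        calc n * p * (1 + n * p ^ (k - 1)) ≤ n * p * (M * (n * p ^ (k - 1))) := by gcongr
          _ = M / a * (a * (n ^ 2 * (p * p ^ (k - 1)))) := by field_simp
          _ = M / a * (a * (n ^ 2 * p ^ k)) := by
            rw [← pow_succ']; congr 5; omega
          _ ≤ M / a * m := by gcongr
      calc D * n * (p * (K * t / m) ^ 2 / γ)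
          = D * K ^ 2 / γ * (t ^ 2 / m ^ 2) * (n * p * (1 + n * p ^ (k - 1))) /
              (1 + n * p ^ (k - 1)) := by field_simp
        _ ≤ D * K ^ 2 / γ * (t ^ 2 / m ^ 2) * (M / a * m) / (1 + n * p ^ (k - 1)) := by gcongr
        _ = C₂ * (t * (t / m / 2) / 2 / (1 + n * p ^ (k - 1))) := by
          rw [hC₂]; field_simp; norm_num
        _ ≤ C₂ * (t * log (1 + t / m) / 2 / (1 + n * p ^ (k - 1))) := by gcongr
        _ ≤ _ := mul_le_mul_of_nonneg_left (le_rate ht hm0 hq0.le) hC₂0.le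
    have hx : 1 / 4 * exp (-(C₂ * (chernoffRate (t / m) * m ^ 2 /
        (m * (1 + n * p ^ (k - 1)))))) ≤ prob V p fun S => m + t ≤ count E S := by
      exact le_trans (mul_le_mul_of_nonneg_left (exp_le_exp.2 (neg_le_neg hexp))
        (by norm_num)) htilt
    have h3 : 0 < C₁ / κ := by positivity
    exact mul_exp_neg_min_le hx hclus le_rfl (by norm_num) (by norm_num) (by linarith)
      (by linarith) hR0 hlp rfl
  · have hkap := sqrt_mul_log_le_rate hk ha h0 hp1 hn ht hm0 hma hc₀0 hc₀1 htm hM0 hqM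
    have hx : 1 / 2 * exp (-(C₁ / κ * (chernoffRate (t / m) * m ^ 2 /
        (m * (1 + n * p ^ (k - 1)))))) ≤ prob V p fun S => m + t ≤ count E S := by
      refine le_trans (mul_le_mul_of_nonneg_left (exp_le_exp.2 (neg_le_neg ?_)) (by norm_num)) hclus
      rw [div_mul_eq_mul_div, le_div_iff₀ hκ0]
      calc C₁ * (√t * log (1 / p)) * κ = C₁ * (κ * (√t * log (1 / p))) := by ring
        _ ≤ _ := mul_le_mul_of_nonneg_left hkap hC₁0.le
    exact mul_exp_neg_min_le hx hclus (by norm_num) (by norm_num) (by norm_num) (by linarith)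
      (by linarith [div_pos hC₁0 hκ0]) hR0 hlp rfl

end BinomialSubset

/-! ### Planted induced matchings. -/

namespace BinomialSubset

open Finset

variable {α : Type*} [DecidableEq α] {V : Finset α} {p : ℝ}

/-- The union of a list of finite sets. -/
def listUnion (l : List (Finset α)) : Finset α := l.foldr (· ∪ ·) ∅

@[simp] lemma listUnion_nil : listUnion ([] : List (Finset α)) = ∅ := rfl

@[simp] lemma listUnion_cons (e : Finset α) (l : List (Finset α)) :
    listUnion (e :: l) = e ∪ listUnion l := rfl

open Classical in
/-- The edges disjoint from `U` whose addition to `U` spans no further edge. -/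
noncomputable def isolatedEdges (E : Finset (Finset α)) (U : Finset α) : Finset (Finset α) :=
  {e ∈ E | Disjoint e U ∧ ∀ f ∈ E, f ⊆ e ∪ U → f ⊆ U ∨ f = e}

lemma mem_isolatedEdges {E : Finset (Finset α)} {U e : Finset α} : e ∈ isolatedEdges E U ↔
    e ∈ E ∧ Disjoint e U ∧ ∀ f ∈ E, f ⊆ e ∪ U → f ⊆ U ∨ f = e := by
  rw [isolatedEdges, mem_filter]

open Classical in
/-- The ordered induced matchings with `M` edges. -/
noncomputable def inducedMatchings (E : Finset (Finset α)) : ℕ → Finset (List (Finset α))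
  | 0 => {[]}
  | M + 1 => ((inducedMatchings E M ×ˢ E).filter
      fun x => x.2 ∈ isolatedEdges E (listUnion x.1)).image fun x => x.2 :: x.1

lemma mem_inducedMatchings_succ {E : Finset (Finset α)} {M : ℕ} {l : List (Finset α)} :
    l ∈ inducedMatchings E (M + 1) ↔ ∃ l' ∈ inducedMatchings E M,
      ∃ e ∈ isolatedEdges E (listUnion l'), e :: l' = l := by
  classical
  rw [inducedMatchings, mem_image]
  constructor
  · rintro ⟨⟨l', e⟩, hx, rfl⟩
    obtain ⟨h1, h2⟩ := mem_filter.1 hx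
    exact ⟨l', (mem_product.1 h1).1, e, h2, rfl⟩
  · rintro ⟨l', hl', e, he, rfl⟩
    exact ⟨(l', e), mem_filter.2 ⟨mem_product.2 ⟨hl', (mem_isolatedEdges.1 he).1⟩, he⟩, rfl⟩

lemma sum_inducedMatchings_succ (E : Finset (Finset α)) (M : ℕ) (f : List (Finset α) → ℝ) :
    ∑ l ∈ inducedMatchings E (M + 1), f l =
      ∑ l ∈ inducedMatchings E M, ∑ e ∈ isolatedEdges E (listUnion l), f (e :: l) := by
  classical
  rw [inducedMatchings, sum_image, sum_filter, sum_product]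
  · refine sum_congr rfl fun l _ => ?_
    rw [← sum_filter]
    refine sum_congr ?_ fun _ _ => rfl
    ext e
    rw [mem_filter]
    exact ⟨fun h => h.2, fun h => ⟨(mem_isolatedEdges.1 h).1, h⟩⟩
  · rintro ⟨l, e⟩ _ ⟨l', e'⟩ _ h
    simp only [List.cons.injEq] at h
    rw [h.1, h.2]

namespace AlmostLinear

variable {E : Finset (Finset α)} {k : ℕ} {D : ℝ}

/-- Each added edge brings k new points and, being isolated, spans no edge with the old ones other
than itself. -/
lemma of_mem_inducedMatchings (h : AlmostLinear V E k D) (hk : 1 ≤ k) {M : ℕ} :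
    ∀ {l}, l ∈ inducedMatchings E M →
      listUnion l ⊆ V ∧ #(listUnion l) = k * M ∧ count E (listUnion l) = M := by
  induction M with
  | zero =>
    intro l hl
    rw [inducedMatchings, mem_singleton] at hl
    subst hl
    refine ⟨empty_subset _, by simp, ?_⟩
    rw [count, listUnion_nil, card_eq_zero, filter_eq_empty_iff]
    intro e he hsub
    have := h.card e he
    rw [subset_empty.1 hsub, card_empty] at this
    omega
  | succ M ih =>
    intro l hl
    obtain ⟨l, hl', e, he, rfl⟩ := mem_inducedMatchings_succ.1 hl
    obtain ⟨h1, h2, h3⟩ := ih hl'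
    obtain ⟨heE, hd, hiso⟩ := mem_isolatedEdges.1 he
    rw [listUnion_cons]
    refine ⟨union_subset (h.subset e heE) h1, ?_, ?_⟩
    · rw [card_union_of_disjoint hd, h2, h.card e heE]; ring
    · have hnot : e ∉ {f ∈ E | f ⊆ listUnion l} := by
        intro hc
        have h4 := (disjoint_iff_inter_eq_empty.1 hd)
        rw [inter_eq_left.2 (mem_filter.1 hc).2] at h4
        have := h.card e heE
        rw [h4, card_empty] at this
        omega
      have heq : {f ∈ E | f ⊆ e ∪ listUnion l} = insert e {f ∈ E | f ⊆ listUnion l} := by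
        ext f
        simp only [mem_filter, mem_insert]
        constructor
        · rintro ⟨hf, hs⟩
          rcases hiso f hf hs with h5 | h5
          · exact Or.inr ⟨hf, h5⟩
          · exact Or.inl h5
        · rintro (hf | ⟨hf, hs⟩)
          · rw [hf]; exact ⟨heE, subset_union_left⟩
          · exact ⟨hf, hs.trans subset_union_right⟩
      rw [count, heq, card_insert_of_notMem hnot, ← count, h3]

/-- Edges of a matching are disjoint, so the weights multiply; dropping the isolation condition
leaves an M-th power. -/
lemma sum_inducedMatchings_pow_le (h0 : 0 ≤ p) (E : Finset (Finset α)) (U : Finset α) (M : ℕ) :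
    ∑ l ∈ inducedMatchings E M, p ^ #(listUnion l \ U) ≤ (∑ e ∈ E, p ^ #(e \ U)) ^ M := by
  induction M with
  | zero => simp [inducedMatchings]
  | succ M ih =>
    rw [sum_inducedMatchings_succ, pow_succ]
    have hs : 0 ≤ ∑ e ∈ E, p ^ #(e \ U) := sum_nonneg fun _ _ => by positivity
    refine le_trans ?_ (mul_le_mul_of_nonneg_right ih hs)
    rw [sum_mul]
    refine sum_le_sum fun l _ => ?_
    rw [mul_sum]
    calc ∑ e ∈ isolatedEdges E (listUnion l), p ^ #(listUnion (e :: l) \ U)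
        = ∑ e ∈ isolatedEdges E (listUnion l), p ^ #(listUnion l \ U) * p ^ #(e \ U) := by
          refine sum_congr rfl fun e he => ?_
          obtain ⟨_, hd, _⟩ := mem_isolatedEdges.1 he
          rw [listUnion_cons, union_sdiff_distrib, card_union_of_disjoint
            (disjoint_of_subset_left sdiff_subset (disjoint_of_subset_right sdiff_subset hd)),
            pow_add, mul_comm]
      _ ≤ ∑ e ∈ E, p ^ #(listUnion l \ U) * p ^ #(e \ U) :=
          sum_le_sum_of_subset_of_nonneg (fun e he => (mem_isolatedEdges.1 he).1)
            fun _ _ _ => by positivity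

end AlmostLinear

namespace DenseAlmostLinear

variable {E : Finset (Finset α)} {k n : ℕ} {a D : ℝ}

/-- An edge e that is not isolated either meets U or lies with U around some other edge f meeting
both. Since k ≥ 3, such an f has two points in U, or one point in U and at least two in e. In the
first case there are O(M²) choices of f and O(n) of e for each; in the second O(Mn) and O(1). -/
lemma card_not_isolated_le (h : DenseAlmostLinear V E k a D n) (hk : 3 ≤ k) (hD : 1 ≤ D)
    {U : Finset α} {M : ℕ} (hU : #U ≤ k * M) (hM : 1 ≤ M) :
    (#E : ℝ) - 3 * k ^ 3 * D ^ 3 * M ^ 2 * n ≤ #(isolatedEdges E U) := by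
  classical
  have hD0 : 0 ≤ D := by linarith
  have hk1 : (1 : ℝ) ≤ k := by exact_mod_cast (by omega : 1 ≤ k)
  have hM1 : (1 : ℝ) ≤ M := by exact_mod_cast hM
  have hU' : (#U : ℝ) ≤ k * M := by exact_mod_cast hU
  have hsub : E ⊆ isolatedEdges E U ∪ ({e ∈ E | ¬ Disjoint e U} ∪
      (({f ∈ E | 2 ≤ #(f ∩ U)}.biUnion fun f => {e ∈ E | ¬ Disjoint e f}) ∪
        ({f ∈ E | ¬ Disjoint f U}.biUnion fun f => {e ∈ E | 2 ≤ #(e ∩ f)}))) := by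
    intro e he
    by_cases hiso : e ∈ isolatedEdges E U
    · exact mem_union_left _ hiso
    refine mem_union_right _ ?_
    by_cases hd : Disjoint e U
    swap
    · exact mem_union_left _ (mem_filter.2 ⟨he, hd⟩)
    refine mem_union_right _ ?_
    rw [mem_isolatedEdges] at hiso
    push Not at hiso
    obtain ⟨f, hf, hfs, hfU, hfe⟩ := hiso he hd
    have hfk := h.card f hf
    have hek := h.card e he
    have hsum : #f ≤ #(f ∩ e) + #(f ∩ U) := by
      refine le_trans (le_of_eq ?_) (card_union_le _ _)
      rw [← inter_union_distrib_left, inter_eq_left.2 hfs]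
    have hfe0 : #(f ∩ e) < k := by
      rw [← hfk]
      refine card_lt_card (ssubset_of_subset_of_ne inter_subset_left fun hc => hfe ?_)
      exact eq_of_subset_of_card_le (inter_eq_left.1 hc) (by omega)
    have hfU0 : #(f ∩ U) < k := by
      rw [← hfk]
      refine card_lt_card (ssubset_of_subset_of_ne inter_subset_left fun hc => hfU ?_)
      exact inter_eq_left.1 hc
    by_cases h2 : 2 ≤ #(f ∩ U)
    · refine mem_union_left _ (mem_biUnion.2 ⟨f, mem_filter.2 ⟨hf, h2⟩, mem_filter.2 ⟨he, ?_⟩⟩)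
      rw [disjoint_comm, disjoint_iff_inter_eq_empty, ← card_eq_zero]
      omega
    · refine mem_union_right _ (mem_biUnion.2 ⟨f, mem_filter.2 ⟨hf, ?_⟩, mem_filter.2 ⟨he, ?_⟩⟩)
      · rw [disjoint_iff_inter_eq_empty, ← card_eq_zero]
        omega
      · rw [inter_comm]; omega
  have c1 := h.card_meeting_le (by omega) hD0 U
  have c2 : ((#({f ∈ E | 2 ≤ #(f ∩ U)}.biUnion fun f => {e ∈ E | ¬ Disjoint e f}) : ℕ) : ℝ) ≤
      (k * M) ^ 2 * D * (k * (D ^ 2 * n)) := by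
    calc ((#({f ∈ E | 2 ≤ #(f ∩ U)}.biUnion fun f => {e ∈ E | ¬ Disjoint e f}) : ℕ) : ℝ)
        ≤ ∑ f ∈ E with 2 ≤ #(f ∩ U), (#{e ∈ E | ¬ Disjoint e f} : ℝ) := by
          exact_mod_cast card_biUnion_le
      _ ≤ ∑ f ∈ E with 2 ≤ #(f ∩ U), (k * (D ^ 2 * n) : ℝ) := by
          refine sum_le_sum fun f hf => ?_
          rw [← h.card f (mem_filter.1 hf).1]
          exact h.card_meeting_le (by omega) hD0 f
      _ = #{f ∈ E | 2 ≤ #(f ∩ U)} * (k * (D ^ 2 * n)) := by rw [sum_const, nsmul_eq_mul]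
      _ ≤ (k * M) ^ 2 * D * (k * (D ^ 2 * n)) := by
          refine mul_le_mul_of_nonneg_right ?_ (by positivity)
          refine (h.card_two_common_le hD0 U).trans ?_
          gcongr
  have c3 : ((#({f ∈ E | ¬ Disjoint f U}.biUnion fun f => {e ∈ E | 2 ≤ #(e ∩ f)}) : ℕ) : ℝ) ≤
      k * M * (D ^ 2 * n) * (k ^ 2 * D) := by
    calc ((#({f ∈ E | ¬ Disjoint f U}.biUnion fun f => {e ∈ E | 2 ≤ #(e ∩ f)}) : ℕ) : ℝ)
        ≤ ∑ f ∈ E with ¬ Disjoint f U, (#{e ∈ E | 2 ≤ #(e ∩ f)} : ℝ) := by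
          exact_mod_cast card_biUnion_le
      _ ≤ ∑ f ∈ E with ¬ Disjoint f U, (k ^ 2 * D : ℝ) := by
          refine sum_le_sum fun f hf => ?_
          rw [← h.card f (mem_filter.1 hf).1]
          exact h.card_two_common_le hD0 f
      _ = #{f ∈ E | ¬ Disjoint f U} * (k ^ 2 * D) := by rw [sum_const, nsmul_eq_mul]
      _ ≤ k * M * (D ^ 2 * n) * (k ^ 2 * D) := by
          refine mul_le_mul_of_nonneg_right ?_ (by positivity)
          refine c1.trans ?_
          gcongr
  have c1' : (#{e ∈ E | ¬ Disjoint e U} : ℝ) ≤ k * M * (D ^ 2 * n) := c1.trans (by gcongr)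
  have htot : (#E : ℝ) ≤ #(isolatedEdges E U) + (#{e ∈ E | ¬ Disjoint e U} +
      (#({f ∈ E | 2 ≤ #(f ∩ U)}.biUnion fun f => {e ∈ E | ¬ Disjoint e f}) +
        #({f ∈ E | ¬ Disjoint f U}.biUnion fun f => {e ∈ E | 2 ≤ #(e ∩ f)}))) := by
    exact_mod_cast (card_le_card hsub).trans ((card_union_le _ _).trans (Nat.add_le_add_left
      ((card_union_le _ _).trans (Nat.add_le_add_left (card_union_le _ _) _)) _))
  set X : ℝ := k ^ 3 * D ^ 3 * M ^ 2 * n with hX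
  have b1 : k * M * (D ^ 2 * n) ≤ X := by
    calc k * M * (D ^ 2 * n) = k ^ 1 * D ^ 2 * M ^ 1 * n := by ring
      _ ≤ k ^ 3 * D ^ 3 * M ^ 2 * n := by
        gcongr <;> first | assumption | norm_num
  have b3 : k * M * (D ^ 2 * n) * (k ^ 2 * D) ≤ X := by
    calc k * M * (D ^ 2 * n) * (k ^ 2 * D) = k ^ 3 * D ^ 3 * M ^ 1 * n := by ring
      _ ≤ k ^ 3 * D ^ 3 * M ^ 2 * n := by
        gcongr; norm_num
  have b2 : (k * M) ^ 2 * D * (k * (D ^ 2 * n)) = X := by rw [hX]; ring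
  have b4 : 3 * k ^ 3 * D ^ 3 * M ^ 2 * n = 3 * X := by rw [hX]; ring
  rw [b4]
  linarith

lemma pow_le_card_inducedMatchings (h : DenseAlmostLinear V E k a D n) (hk : 3 ≤ k) (hD : 1 ≤ D)
    {M₀ : ℕ} (hM₀ : 1 ≤ M₀) (hE : 3 * k ^ 3 * D ^ 3 * M₀ ^ 2 * n ≤ #E) {M : ℕ} (hM : M ≤ M₀) :
    (#E - 3 * k ^ 3 * D ^ 3 * M₀ ^ 2 * n : ℝ) ^ M ≤ #(inducedMatchings E M) := by
  induction M with
  | zero => simp [inducedMatchings]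
  | succ M ih =>
    have hsum := sum_inducedMatchings_succ E M fun _ => 1
    simp only [sum_const, nsmul_eq_mul, mul_one] at hsum
    rw [hsum, pow_succ]
    calc (#E - 3 * k ^ 3 * D ^ 3 * M₀ ^ 2 * n : ℝ) ^ M * (#E - 3 * k ^ 3 * D ^ 3 * M₀ ^ 2 * n)
        ≤ #(inducedMatchings E M) * (#E - 3 * k ^ 3 * D ^ 3 * M₀ ^ 2 * n) :=
          mul_le_mul_of_nonneg_right (ih (by omega)) (by linarith)
      _ = ∑ l ∈ inducedMatchings E M, (#E - 3 * k ^ 3 * D ^ 3 * M₀ ^ 2 * n : ℝ) := by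
          rw [sum_const, nsmul_eq_mul]
      _ ≤ _ := by
          refine sum_le_sum fun l hl => h.card_not_isolated_le hk hD ?_ hM₀
          rw [(h.of_mem_inducedMatchings (by omega) hl).2.1]
          exact Nat.mul_le_mul_left _ (by omega)

/-- Bernoulli's inequality: each of the M choices loses a proportion of at most 1/(2M) of the edges.
-/
lemma half_pow_le_card_inducedMatchings (h : DenseAlmostLinear V E k a D n) (hk : 3 ≤ k)
    (hD : 1 ≤ D) {M : ℕ} (hM : 1 ≤ M) (hE : 6 * k ^ 3 * D ^ 3 * M ^ 3 * n ≤ #E) :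
    (#E : ℝ) ^ M / 2 ≤ #(inducedMatchings E M) := by
  have hM1 : (1 : ℝ) ≤ M := by exact_mod_cast hM
  set β : ℝ := 3 * k ^ 3 * D ^ 3 * M ^ 2 * n with hβ
  have hβ0 : 0 ≤ β := by positivity
  have hβ1 : 2 * (M * β) ≤ #E := by rw [hβ]; linarith
  have hβE : β ≤ #E := by nlinarith
  refine le_trans ?_ (h.pow_le_card_inducedMatchings hk hD hM hβE le_rfl)
  rw [← hβ]
  rcases eq_or_lt_of_le (show (0 : ℝ) ≤ #E by positivity) with h0 | h0
  · rw [← h0] at hβE ⊢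
    have : β = 0 := le_antisymm hβE hβ0
    rw [this, sub_zero, zero_pow (by omega), zero_div]
  have e1 : (#E - β : ℝ) = #E * (1 + -(β / #E)) := by field_simp; ring
  rw [e1, mul_pow, div_eq_mul_one_div]
  refine mul_le_mul_of_nonneg_left ?_ (by positivity)
  have h1 : β / #E ≤ 1 := by rwa [div_le_one h0]
  have hb := one_add_mul_le_pow (show (-2 : ℝ) ≤ -(β / #E) by linarith) M
  refine le_trans ?_ hb
  have h2 : M * (β / #E) ≤ 1 / 2 := by
    rw [mul_div_assoc', div_le_iff₀ h0]; linarith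
  linarith

/-- The expected number of edges once a matching U is planted. Edges meeting U contribute O(M² p) if
in two or more points, O(Mnp^(k-1)) if in one, and M if inside U; the two smallness conditions
reduce everything to O(M). -/
lemma sum_pow_card_sdiff_le (h : DenseAlmostLinear V E k a D n) (hk : 3 ≤ k) (hD : 1 ≤ D)
    (h0 : 0 ≤ p) (h1 : p ≤ 1) {U : Finset α} {M : ℕ} (hU : #U = k * M) (hc : count E U = M)
    (hq : n * p ^ (k - 1) ≤ 1) (hMp : M * p ≤ 1) :
    ∑ e ∈ E, p ^ #(e \ U) ≤ #E * p ^ k + (1 + k * D ^ 2 + k ^ 2 * D) * M := by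
  have hD0 : 0 ≤ D := by linarith
  have hU' : (#U : ℝ) = k * M := by exact_mod_cast hU
  have hterm : ∀ e ∈ E, p ^ #(e \ U) ≤ p ^ k + (if ¬ Disjoint e U then p ^ (k - 1) else 0) +
      (if 2 ≤ #(e ∩ U) then p else 0) + if e ⊆ U then 1 else 0 := by
    intro e he
    have hek := h.card e he
    have hs := card_sdiff_add_card_inter e U
    have n1 : 0 ≤ p ^ k := by positivity
    have n2 : 0 ≤ (if ¬ Disjoint e U then p ^ (k - 1) else 0) := by split_ifs <;> positivity
    have n3 : 0 ≤ (if 2 ≤ #(e ∩ U) then p else 0) := by split_ifs <;> positivity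
    have n4 : (0 : ℝ) ≤ if e ⊆ U then 1 else 0 := by split_ifs <;> norm_num
    by_cases c4 : e ⊆ U
    · have : p ^ #(e \ U) ≤ 1 := pow_le_one₀ h0 h1
      rw [if_pos c4]
      linarith
    have c5 : 0 < #(e \ U) := by
      rw [card_pos, sdiff_nonempty]; exact c4
    by_cases c3 : 2 ≤ #(e ∩ U)
    · have : p ^ #(e \ U) ≤ p := pow_le_of_le_one h0 h1 (by omega)
      rw [if_pos c3]
      linarith
    by_cases c2 : Disjoint e U
    · rw [disjoint_iff_inter_eq_empty] at c2
      have : #(e \ U) = k := by rw [c2, card_empty] at hs; omega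
      rw [this]
      linarith
    · have c6 : 0 < #(e ∩ U) := by
        rw [card_pos, ← not_disjoint_iff_nonempty_inter]; exact c2
      have : #(e \ U) = k - 1 := by omega
      rw [this, if_pos c2]
      linarith
  have s1 : ∑ e ∈ E, (if ¬ Disjoint e U then p ^ (k - 1) else 0) ≤ k * D ^ 2 * M := by
    rw [← sum_filter, sum_const, nsmul_eq_mul]
    calc #{e ∈ E | ¬ Disjoint e U} * p ^ (k - 1) ≤ #U * (D ^ 2 * n) * p ^ (k - 1) :=
          mul_le_mul_of_nonneg_right (h.card_meeting_le (by omega) hD0 U) (by positivity)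
      _ = k * D ^ 2 * M * (n * p ^ (k - 1)) := by rw [hU']; ring
      _ ≤ k * D ^ 2 * M := mul_le_of_le_one_right (by positivity) hq
  have s2 : ∑ e ∈ E, (if 2 ≤ #(e ∩ U) then p else 0) ≤ k ^ 2 * D * M := by
    rw [← sum_filter, sum_const, nsmul_eq_mul]
    calc #{e ∈ E | 2 ≤ #(e ∩ U)} * p ≤ #U ^ 2 * D * p :=
          mul_le_mul_of_nonneg_right (h.card_two_common_le hD0 U) h0
      _ = k ^ 2 * D * M * (M * p) := by rw [hU']; ring
      _ ≤ k ^ 2 * D * M := mul_le_of_le_one_right (by positivity) hMp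
  have s3 : ∑ e ∈ E, (if e ⊆ U then (1 : ℝ) else 0) = M := by
    rw [← hc, count_eq_sum]
  calc ∑ e ∈ E, p ^ #(e \ U) ≤ ∑ e ∈ E, (p ^ k + (if ¬ Disjoint e U then p ^ (k - 1) else 0) +
      (if 2 ≤ #(e ∩ U) then p else 0) + if e ⊆ U then 1 else 0) := sum_le_sum hterm
    _ = #E * p ^ k + ∑ e ∈ E, (if ¬ Disjoint e U then p ^ (k - 1) else 0) +
        ∑ e ∈ E, (if 2 ≤ #(e ∩ U) then p else 0) + M := by
      rw [sum_add_distrib, sum_add_distrib, sum_add_distrib, s3, sum_const, nsmul_eq_mul]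
    _ ≤ _ := by linarith

/-- The lower bound obtained by planting an induced matching with `M` edges. -/
lemma exp_le_prob_of_matching (h : DenseAlmostLinear V E k a D n) (hk : 3 ≤ k) (hD : 1 ≤ D)
    (h0 : 0 < p) (h1 : p ≤ 1) (hm : 0 < #E * p ^ k) {t τ : ℝ} {M : ℕ} (hM : 1 ≤ M)
    (hE : 6 * k ^ 3 * D ^ 3 * M ^ 3 * n ≤ #E) (hq : n * p ^ (k - 1) ≤ 1) (hMp : M * p ≤ 1)
    (hτ : 0 < τ) (ht : t + τ ≤ M * (1 - p))
    (hvar : 2 * (k ^ 2 * D ^ 2 * (#E * p ^ k * (1 + n * p ^ (k - 1)))) ≤ τ ^ 2) :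
    1 / 8 * exp (-(M * log (1 + (1 + k * D ^ 2 + k ^ 2 * D) * M / (#E * p ^ k)))) ≤
      prob V p fun S => #E * p ^ k + t ≤ count E S := by
  classical
  set m : ℝ := #E * p ^ k with hmdef
  set C' : ℝ := 1 + k * D ^ 2 + k ^ 2 * D with hC'
  have hC'0 : 0 < C' := by positivity
  have hM0 : (0 : ℝ) < M := by exact_mod_cast hM
  set 𝒢 := inducedMatchings E M with h𝒢
  have hG := h.half_pow_le_card_inducedMatchings hk hD hM hE
  have hmem := fun l hl => h.of_mem_inducedMatchings (M := M) (by omega) (l := l) hl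
  -- Z counts the planted matchings present. With x = p^(kM), E[Z; A] ≥ |𝒢| x/2 because A is likely
  -- once a matching is planted, and E[Z²] ≤ |𝒢| x (m + C'M)^M. Cauchy-Schwarz and |𝒢| ≥ |E|^M/2
  -- give P(A) ≥ (m/(m + C'M))^M/8.
  set Z : Finset α → ℝ := fun S => ∑ l ∈ 𝒢, if listUnion l ⊆ S then 1 else 0 with hZ
  set A : Finset α → Prop := fun S => m + t ≤ count E S with hA
  have hlow : #𝒢 * (p ^ (k * M) / 2) ≤ expect V p fun S => if A S then Z S else 0 := by
    have e1 : (expect V p fun S => if A S then Z S else 0) =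
        ∑ l ∈ 𝒢, expect V p fun S => if A S then (if listUnion l ⊆ S then 1 else 0) else 0 := by
      rw [← expect_sum]
      refine expect_congr fun S _ => ?_
      by_cases hS : A S
      · simp only [hS, if_true, hZ]
      · simp [hS]
    rw [e1, ← nsmul_eq_mul, ← sum_const]
    refine sum_le_sum fun l hl => ?_
    obtain ⟨g1, g2, g3⟩ := hmem l hl
    rw [← g2]
    refine h.half_pow_le_expect (by omega) hD h0.le h1 g1 hτ ?_ hvar fun S hS => hS
    rw [g3]; exact ht
  have hup : (expect V p fun S => Z S ^ 2) ≤ #𝒢 * (p ^ (k * M) * (m + C' * M) ^ M) := by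
    have e1 : (expect V p fun S => Z S ^ 2) =
        ∑ l ∈ 𝒢, ∑ l' ∈ 𝒢, p ^ #(listUnion l' ∪ listUnion l) := by
      rw [sum_congr rfl fun l hl => sum_congr rfl fun l' hl' => (expect_subset (p := p)
        (union_subset (hmem l' hl').1 (hmem l hl).1)).symm]
      rw [sum_congr rfl fun l hl => (expect_sum _ _).symm, ← expect_sum]
      refine expect_congr fun S _ => ?_
      rw [sq, hZ, sum_mul_sum]
      refine sum_congr rfl fun l _ => sum_congr rfl fun l' _ => ?_
      by_cases c1 : listUnion l ⊆ S <;> by_cases c2 : listUnion l' ⊆ S <;>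
        simp [c1, c2, union_subset_iff]
    rw [e1, ← nsmul_eq_mul, ← sum_const]
    refine sum_le_sum fun l hl => ?_
    obtain ⟨g1, g2, g3⟩ := hmem l hl
    calc ∑ l' ∈ 𝒢, p ^ #(listUnion l' ∪ listUnion l)
        = p ^ (k * M) * ∑ l' ∈ 𝒢, p ^ #(listUnion l' \ listUnion l) := by
          rw [mul_sum]
          refine sum_congr rfl fun l' _ => ?_
          rw [← sdiff_union_self_eq_union, card_union_of_disjoint sdiff_disjoint, g2, pow_add,
            mul_comm]
      _ ≤ p ^ (k * M) * (∑ e ∈ E, p ^ #(e \ listUnion l)) ^ M :=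
          mul_le_mul_of_nonneg_left (AlmostLinear.sum_inducedMatchings_pow_le h0.le E _ M)
            (by positivity)
      _ ≤ p ^ (k * M) * (m + C' * M) ^ M := by
          refine mul_le_mul_of_nonneg_left (pow_le_pow_left₀
            (sum_nonneg fun _ _ => by positivity)
            (h.sum_pow_card_sdiff_le hk hD h0.le h1 g2 g3 hq hMp) M) (by positivity)
  have hcs := sq_expect_ite_le (V := V) h0.le h1 Z A
  have hP0 := prob_nonneg (V := V) h0.le h1 A
  set P := prob V p A with hP
  set x : ℝ := p ^ (k * M) with hx
  have hx0 : 0 < x := by positivity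
  have hE0 : (0 : ℝ) < #E := pos_of_mul_pos_left hm (by positivity)
  have hG0 : (0 : ℝ) < #𝒢 := lt_of_lt_of_le (by positivity) hG
  have hy0 : 0 < (m + C' * M) ^ M := by positivity
  have h5 : (#𝒢 * (x / 2)) ^ 2 ≤ P * (#𝒢 * (x * (m + C' * M) ^ M)) :=
    ((pow_le_pow_left₀ (by positivity) hlow 2).trans hcs).trans
      (mul_le_mul_of_nonneg_left hup hP0)
  have h6 : #𝒢 * x / 4 ≤ P * (m + C' * M) ^ M := by
    have e1 : (#𝒢 * (x / 2)) ^ 2 = (#𝒢 * x) * (#𝒢 * x / 4) := by ring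
    have e2 : P * (#𝒢 * (x * (m + C' * M) ^ M)) = (#𝒢 * x) * (P * (m + C' * M) ^ M) := by ring
    rw [e1, e2] at h5
    exact le_of_mul_le_mul_left h5 (by positivity)
  have h7 : m ^ M / 8 ≤ P * (m + C' * M) ^ M := by
    refine le_trans ?_ h6
    have e1 : m ^ M = #E ^ M * x := by rw [hmdef, mul_pow, hx, pow_mul]
    rw [e1]
    nlinarith
  have e3 : exp (-(M * log (1 + C' * M / m))) = m ^ M / (m + C' * M) ^ M := by
    rw [exp_neg, exp_nat_mul, exp_log (by positivity), ← div_pow, ← inv_pow]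
    congr 1
    field_simp
  rw [e3, mul_div_assoc', div_le_iff₀ hy0]
  linarith

end DenseAlmostLinear

end BinomialSubset

/-! ### The lower bound for small densities. -/

namespace BinomialSubset

open Finset

lemma log_one_add_mul_le {c x : ℝ} (hc : 1 ≤ c) (hx : 0 ≤ x) :
    log (1 + c * x) ≤ c * log (1 + x) := by
  rw [← log_rpow (by linarith)]
  exact log_le_log (by positivity) (one_add_mul_self_le_rpow_one_add (by linarith) hc)

/-- The constant in the lower bound obtained from induced matchings. -/
noncomputable def matchingConst (k : ℕ) (D : ℝ) : ℝ :=
  4 * (2 + 4 * k ^ 2 * D ^ 2) ^ 2 * (1 + k * D ^ 2 + k ^ 2 * D)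

lemma matchingConst_pos {k : ℕ} {D : ℝ} (hD : 0 ≤ D) : 0 < matchingConst k D := by
  rw [matchingConst]; positivity

namespace DenseAlmostLinear

variable {α : Type*} [DecidableEq α] {V : Finset α} {p : ℝ}
variable {E : Finset (Finset α)} {k n : ℕ} {a D : ℝ}

/-- Plants M = ⌈Ks⌉ edges. Since p ≤ 1/2, half of Ks = 2s + 4k²D²s remains: s covers t, and 2k²D²s
covers the Chebyshev error because μ ≤ s². The parameter s stands for t, or for √μ when t is
smaller. -/
lemma exp_le_prob_of_sparse (h : DenseAlmostLinear V E k a D n) (hk : 3 ≤ k) (hD : 1 ≤ D)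
    (h0 : 0 < p) {m t s T : ℝ} (hm0 : 0 < m) (hm : m = #E * p ^ k) (hts : t ≤ s)
    (hs : 1 / 2 ≤ s) (hms : m ≤ s ^ 2) (hsT : s ≤ T) (hT : 1 ≤ T)
    (hE : 6 * k ^ 3 * D ^ 3 * (2 * (2 + 4 * k ^ 2 * D ^ 2) * T) ^ 3 * n ≤ #E)
    (hTp : 2 * (2 + 4 * k ^ 2 * D ^ 2) * T * p ≤ 1) (hq : n * p ^ (k - 1) ≤ 1) :
    1 / 8 * exp (-(matchingConst k D * (s * log (1 + s / m)))) ≤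
      prob V p fun S => m + t ≤ count E S := by
  have hD0 : 0 < D := by linarith
  have hk0 : (0 : ℝ) < k := by exact_mod_cast (by omega : 0 < k)
  have hk1 : (1 : ℝ) ≤ k := by exact_mod_cast (by omega : 1 ≤ k)
  set K := 2 + 4 * k ^ 2 * D ^ 2 with hK
  have hK2 : 2 ≤ K := by
    have : 0 < 4 * k ^ 2 * D ^ 2 := by positivity
    linarith
  set C' := 1 + k * D ^ 2 + k ^ 2 * D with hC'
  have hC'1 : 1 ≤ C' := by
    have : 0 < k * D ^ 2 + k ^ 2 * D := by positivity
    linarith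
  have hs0 : 0 < s := by linarith
  have hp2 : p ≤ 1 / 2 := by
    have : 4 * 1 * p ≤ 2 * K * T * p := by gcongr; linarith
    linarith
  have hp1 : p ≤ 1 := by linarith
  set M := ⌈K * s⌉₊ with hM
  have hKs : K * s ≤ M := Nat.le_ceil _
  have hKs1 : 1 ≤ K * s := by nlinarith
  have hMle : (M : ℝ) ≤ 2 * K * s := by
    have := Nat.ceil_lt_add_one (show 0 ≤ K * s by positivity)
    linarith
  have hM1 : 1 ≤ M := by
    have : (1 : ℝ) ≤ M := hKs1.trans hKs
    exact_mod_cast this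
  have hM0 : (0 : ℝ) < M := by linarith
  have hMT : (M : ℝ) ≤ 2 * K * T := hMle.trans (by gcongr)
  have key := h.exp_le_prob_of_matching hk hD h0 hp1 (by rwa [← hm]) (t := t)
    (τ := 2 * k ^ 2 * D ^ 2 * s) (M := M) hM1 (le_trans (by gcongr) hE) hq
    (le_trans (by gcongr) hTp) (by positivity) ?_ ?_
  · rw [← hm] at key
    refine le_trans (mul_le_mul_of_nonneg_left (exp_le_exp.2 (neg_le_neg ?_)) (by norm_num)) key
    have hC2 : 1 ≤ 2 * K * C' := by nlinarith
    have hl : log (1 + C' * M / m) ≤ 2 * K * C' * log (1 + s / m) := by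
      refine le_trans (log_le_log (by positivity) ?_)
        (log_one_add_mul_le hC2 (show 0 ≤ s / m by positivity))
      have : C' * M / m ≤ 2 * K * C' * (s / m) := by
        calc C' * M / m ≤ C' * (2 * K * s) / m := by gcongr
          _ = _ := by ring
      linarith
    have hl0 : 0 ≤ log (1 + C' * M / m) := log_nonneg (by
      have : 0 < C' * M / m := by positivity
      linarith)
    calc M * log (1 + C' * M / m) ≤ 2 * K * s * (2 * K * C' * log (1 + s / m)) :=
          mul_le_mul hMle hl hl0 (by positivity)
      _ = matchingConst k D * (s * log (1 + s / m)) := by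
          rw [matchingConst, ← hK, ← hC']; ring
  · calc t + 2 * k ^ 2 * D ^ 2 * s ≤ s + 2 * k ^ 2 * D ^ 2 * s := by linarith
      _ = K * s * (1 - 1 / 2) := by rw [hK]; ring
      _ ≤ M * (1 - p) := by
        apply mul_le_mul hKs (by linarith) (by norm_num) hM0.le
  · rw [← hm]
    have h2 : m * (1 + n * p ^ (k - 1)) ≤ 2 * s ^ 2 := by
      calc m * (1 + n * p ^ (k - 1)) ≤ m * 2 := by gcongr; linarith
        _ ≤ 2 * s ^ 2 := by linarith
    have h3 : 1 ≤ (k : ℝ) ^ 2 * D ^ 2 :=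
      one_le_mul_of_one_le_of_one_le (one_le_pow₀ hk1) (one_le_pow₀ hD)
    calc 2 * (k ^ 2 * D ^ 2 * (m * (1 + n * p ^ (k - 1))))
        ≤ 2 * (k ^ 2 * D ^ 2 * (2 * s ^ 2)) := by gcongr
      _ = 4 * 1 * (k ^ 2 * D ^ 2 * s ^ 2) := by ring
      _ ≤ 4 * (k ^ 2 * D ^ 2) * (k ^ 2 * D ^ 2 * s ^ 2) := by gcongr
      _ = _ := by ring

end DenseAlmostLinear

set_option maxHeartbeats 1000000 in
/-- The lower bound for small densities, under explicit conditions on the parameters. -/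
theorem exists_le_prob_of_sparse {k : ℕ} (hk : 3 ≤ k) {a D : ℝ} (ha : 0 < a) (hD : 1 ≤ D) :
    ∃ lam₀ : ℝ, ∀ lam : ℝ, lam₀ ≤ lam →
      ∃ C > 0, ∃ d > 0, ∀ {α : Type*} [DecidableEq α] {V : Finset α}
      {E : Finset (Finset α)} {n : ℕ} {p t m T : ℝ}, DenseAlmostLinear V E k a D n → 1 ≤ n →
      0 < p → 0 < t → m = #E * p ^ k → 1 ≤ m + t →
      6 * k ^ 3 * D ^ 3 * (2 * (2 + 4 * k ^ 2 * D ^ 2) * T) ^ 3 * n ≤ #E →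
      2 * (2 + 4 * k ^ 2 * D ^ 2) * T * p ≤ 1 → n * p ^ (k - 1) ≤ 1 → m ≤ T → D ^ 3 ≤ T →
      log n ≤ √T →
      (∃ W ⊆ V, (#W : ℝ) ≤ D * max √(min (lam * t) (m + t)) 1 ∧
        min (lam * t) (m + t) ≤ count E W) →
      d * exp (-C * min (chernoffRate (t / m) * m ^ 2 / (m * (1 + n * p ^ (k - 1))))
          (√t * log (1 / p))) ≤ prob V p fun S => m + t ≤ count E S := by
  have hD0 : 0 < D := by linarith
  refine ⟨(1 + √(2 * (k ^ 2 * D ^ 2) * 2)) / (1 / 2), fun lam hlam => ?_⟩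
  set c₁ := matchingConst k D with hc₁
  have hc₁0 : 0 < c₁ := matchingConst_pos hD0.le
  set c₂ := D * (√lam + 1 / √(1 / 2 : ℝ)) with hc₂
  have hc₂0 : 0 < c₂ := by
    have : 0 < √(1 / 2 : ℝ) := sqrt_pos.2 (by norm_num)
    positivity
  refine ⟨4 * c₁ + 8 * c₂, by positivity, 1 / 8 * exp (-c₁), by positivity, ?_⟩
  intro α _ V E n p t m T h hn h0 ht hm hmt hE hTp hq hmT hDT hlogT hW
  have hT1 : 1 ≤ T := le_trans (one_le_pow₀ hD) hDT
  have hn0 : (0 : ℝ) < n := by exact_mod_cast hn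
  have hE0 : (0 : ℝ) < #E := lt_of_lt_of_le (by positivity) h.le_card_edges
  have hm0 : 0 < m := by rw [hm]; positivity
  have hp2 : p ≤ 1 / 2 := by
    have hK2 : 2 ≤ 2 + 4 * (k : ℝ) ^ 2 * D ^ 2 := by
      have : 0 ≤ 4 * (k : ℝ) ^ 2 * D ^ 2 := by positivity
      linarith
    have : 2 * 2 * 1 * p ≤ 2 * (2 + 4 * k ^ 2 * D ^ 2) * T * p := by gcongr
    linarith
  have hp1 : p ≤ 1 := by linarith
  have hq0 : 0 < n * p ^ (k - 1) := by positivity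
  have hexp1 : exp (-c₁) ≤ 1 := exp_le_one_iff.2 (by linarith)
  have hlp0 : 0 ≤ log (1 / p) := log_nonneg (one_le_one_div h0 hp1)
  have hlp : 0 ≤ √t * log (1 / p) := mul_nonneg (sqrt_nonneg _) hlp0
  have hl0 : 0 ≤ log (1 + t / m) := log_nonneg (by
    have : 0 < t / m := by positivity
    linarith)
  set R := chernoffRate (t / m) * m ^ 2 / (m * (1 + n * p ^ (k - 1))) with hR
  have hR4 : t * log (1 + t / m) / 4 ≤ R := by
    refine le_trans ?_ (le_rate ht hm0 hq0.le)
    rw [div_div]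
    gcongr
    linarith
  have hR0 : 0 ≤ R := le_trans (by positivity) hR4
  -- Below √m even the deviation √m has probability bounded below.
  rcases lt_or_ge t √m with htm | htm
  · have hs : 1 / 2 ≤ √m := by
      apply le_sqrt_of_sq_le
      by_contra! hc
      have : √m < 1 / 2 := by rw [sqrt_lt' (by norm_num)]; linarith
      linarith
    have hs0 : 0 < √m := by linarith
    have hsT : √m ≤ T := by
      rw [sqrt_le_left (by linarith)]
      exact hmT.trans (le_self_pow₀ hT1 two_ne_zero)
    have key := h.exp_le_prob_of_sparse hk hD h0 hm0 hm htm.le hs (sq_sqrt hm0.le).ge hsT hT1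
      hE hTp hq
    refine le_trans ?_ key
    have hlog : √m * log (1 + √m / m) ≤ 1 := by
      have e1 : √m / m = 1 / √m := by
        rw [div_eq_div_iff hm0.ne' hs0.ne', mul_self_sqrt hm0.le, one_mul]
      have h1 := log_le_sub_one_of_pos (show 0 < 1 + 1 / √m by positivity)
      calc √m * log (1 + √m / m) ≤ √m * (1 + 1 / √m - 1) := by rw [e1]; gcongr
        _ = 1 := by field_simp; ring
    calc 1 / 8 * exp (-c₁) * exp (-(4 * c₁ + 8 * c₂) * min R (√t * log (1 / p)))
        ≤ 1 / 8 * exp (-c₁) * 1 := by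
          refine mul_le_mul_of_nonneg_left (exp_le_one_iff.2 ?_) (by positivity)
          have := mul_nonneg (show 0 ≤ 4 * c₁ + 8 * c₂ by positivity) (le_min hR0 hlp)
          linarith
      _ ≤ 1 / 8 * exp (-(c₁ * (√m * log (1 + √m / m)))) := by
          rw [mul_one]
          refine mul_le_mul_of_nonneg_left (exp_le_exp.2 ?_) (by norm_num)
          linarith [mul_le_of_le_one_right hc₁0.le hlog]
  have hmt2 : m ≤ t ^ 2 := (sqrt_le_left ht.le).1 htm
  have ht2 : 1 / 2 ≤ t := by
    by_contra! hc
    have : t ^ 2 ≤ (1 / 2) ^ 2 := by gcongr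
    linarith
  have hΛ : m * (1 + n * p ^ (k - 1)) ≤ 2 * t ^ 2 := by
    calc m * (1 + n * p ^ (k - 1)) ≤ m * 2 := by gcongr; linarith
      _ ≤ 2 * t ^ 2 := by linarith
  have hclus : 1 / 2 * exp (-(c₂ * (√t * log (1 / p)))) ≤
      prob V p fun S => m + t ≤ count E S := by
    have := h.cluster_le_prob (by omega) hD h0 (γ := 1 / 2) (by norm_num) (by linarith)
      (B := 2) (by norm_num) (t₀ := 1 / 2) (by norm_num) ht2 (by rwa [← hm]) hlam
      (by rwa [← hm])
    rwa [← hm, neg_mul] at this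
  -- Up to T matchings of the required size exist and give the first term. Beyond T the clustering
  -- term is at most 8R.
  rcases le_total t T with htT | htT
  · have key := h.exp_le_prob_of_sparse hk hD h0 hm0 hm le_rfl ht2 hmt2 htT hT1 hE hTp hq
    have hx : 1 / 8 * exp (-(4 * c₁ * R)) ≤ prob V p fun S => m + t ≤ count E S := by
      refine le_trans (mul_le_mul_of_nonneg_left (exp_le_exp.2 (neg_le_neg ?_)) (by norm_num)) key
      linarith [mul_le_mul_of_nonneg_left hR4 hc₁0.le]
    exact mul_exp_neg_min_le hx hclus (by linarith) (by linarith) (by positivity) (by linarith)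
      (by linarith) hR0 hlp rfl
  · have hkap : √t * log (1 / p) ≤ 8 * R := by
      have hst : 0 < √t := sqrt_pos.2 ht
      have ht1 : 1 ≤ √t := one_le_sqrt.2 (hT1.trans htT)
      have e : t = √t * √t := (mul_self_sqrt ht.le).symm
      suffices log (1 / p) ≤ 2 * (√t * log (1 + t / m)) by
        calc √t * log (1 / p) ≤ √t * (2 * (√t * log (1 + t / m))) := by gcongr
          _ = 8 * (√t * √t * log (1 + t / m) / 4) := by ring
          _ ≤ 8 * R := by rw [← e]; gcongr
      -- If p ≥ 1/n, then log(1/p) ≤ log n ≤ √t and t ≥ μ. If p ≤ 1/n, then μ ≤ D³p and t ≥ D³, so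
      -- t/μ ≥ 1/p.
      rcases le_total (1 / (n : ℝ)) p with hpn | hpn
      · have h2 : 1 / 2 ≤ log (1 + t / m) := by
          refine (half_le_log_of_one_le (x := t / m) ?_)
          rw [le_div_iff₀ hm0]; linarith
        have h3 : log (1 / p) ≤ log n := by
          refine log_le_log (by positivity) ?_
          rw [div_le_iff₀ h0]
          rwa [div_le_iff₀ hn0, mul_comm] at hpn
        have h4 : log n ≤ √t := hlogT.trans (sqrt_le_sqrt htT)
        linarith [mul_le_mul_of_nonneg_left h2 hst.le]
      · have h2 : m ≤ D ^ 3 * p := by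
          calc m ≤ D ^ 3 * n ^ 2 * p ^ k := by
                rw [hm]
                exact mul_le_mul_of_nonneg_right (h.card_edges_le (by omega) hD0.le) (by positivity)
            _ = D ^ 3 * (p * ((n * p) ^ 2 * p ^ (k - 3))) := by
                obtain ⟨j, rfl⟩ : ∃ j, k = j + 3 := ⟨k - 3, by omega⟩
                rw [Nat.add_sub_cancel]; ring
            _ ≤ D ^ 3 * (p * (1 ^ 2 * 1)) := by
                gcongr
                · rwa [le_div_iff₀ hn0, mul_comm] at hpn
                · exact pow_le_one₀ h0.le hp1
            _ = D ^ 3 * p := by ring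
        have h3 : log (1 / p) ≤ log (1 + t / m) := by
          refine log_le_log (by positivity) ?_
          have : 1 / p ≤ t / m := by
            rw [div_le_div_iff₀ h0 hm0]
            calc 1 * m ≤ D ^ 3 * p := by linarith
              _ ≤ t * p := by
                gcongr
                linarith
          linarith
        linarith [le_mul_of_one_le_left hl0 ht1]
    have hx : 1 / 2 * exp (-(8 * c₂ * R)) ≤ prob V p fun S => m + t ≤ count E S := by
      refine le_trans (mul_le_mul_of_nonneg_left (exp_le_exp.2 (neg_le_neg ?_)) (by norm_num)) hclus
      calc c₂ * (√t * log (1 / p)) ≤ c₂ * (8 * R) := by gcongr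
        _ = 8 * c₂ * R := by ring
    exact mul_exp_neg_min_le hx hclus (by linarith) (by linarith) (by positivity) (by linarith)
      (by linarith) hR0 hlp rfl

end BinomialSubset

/-! ### The lower bound under conditions (i) and (ii). -/

namespace BinomialSubset

open Finset

/-- The lower bound for densities at most `n ^ (-2 / (k + 1 / 3))`. -/
theorem exists_le_prob_of_le_rpow {k : ℕ} (hk : 3 ≤ k) {a D : ℝ} (ha : 0 < a) (hD : 1 ≤ D) :
    ∃ n₀ : ℕ, ∃ lam₀ : ℝ, ∀ lam : ℝ, lam₀ ≤ lam →
      ∃ C > 0, ∃ d > 0, ∀ {α : Type*} [DecidableEq α] {V : Finset α}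
      {E : Finset (Finset α)} {n : ℕ} {p t m : ℝ}, DenseAlmostLinear V E k a D n → n₀ ≤ n →
      0 < p → 0 < t → m = #E * p ^ k → 1 ≤ m + t → p ≤ (n : ℝ) ^ (-2 / ((k : ℝ) + 1 / 3)) →
      (∃ W ⊆ V, (#W : ℝ) ≤ D * max √(min (lam * t) (m + t)) 1 ∧
        min (lam * t) (m + t) ≤ count E W) →
      d * exp (-C * min (chernoffRate (t / m) * m ^ 2 / (m * (1 + n * p ^ (k - 1))))
          (√t * log (1 / p))) ≤ prob V p fun S => m + t ≤ count E S := by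
  have hD0 : 0 < D := by linarith
  have hk3 : (3 : ℝ) ≤ k := by exact_mod_cast hk
  -- The previous theorem is applied with T = n^θ. Here p ≤ n^(-2θ) gives n²p^k ≤ n^(2θ/3), so μ ≤ T
  -- for large n, and 3θ < 1 makes T³n negligible against n².
  set θ : ℝ := 1 / (k + 1 / 3) with hθ
  have hθ0 : 0 < θ := by positivity
  have hθk : θ * k = 1 - θ / 3 := by rw [hθ]; field_simp; ring
  have hθ3 : 3 * θ < 1 := by nlinarith
  set K : ℝ := 2 + 4 * k ^ 2 * D ^ 2 with hK
  have e1 := eventually_mul_log_pow_le (2 * K) 0 hθ0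
  have e2 := eventually_mul_log_pow_le (6 * k ^ 3 * D ^ 3 * (2 * K) ^ 3 / a) 0
    (show 0 < 1 - 3 * θ by linarith)
  have e3 := eventually_mul_log_pow_le (D ^ 3) 0 (show 0 < θ / 3 by positivity)
  have e4 := eventually_mul_log_pow_le 1 1 (show 0 < θ / 2 by positivity)
  obtain ⟨n₀, hn₀⟩ := Filter.eventually_atTop.1
    ((((e1.and e2).and e3).and e4).and (Filter.eventually_ge_atTop 1))
  obtain ⟨lam₀, hlam₀⟩ := exists_le_prob_of_sparse hk ha hD
  refine ⟨n₀, lam₀, fun lam hlam => ?_⟩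
  obtain ⟨C, hC, d, hd, key⟩ := hlam₀ lam hlam
  refine ⟨C, hC, d, hd, ?_⟩
  intro α _ V E n p t m h hn h0 ht hm hmt hp hW
  obtain ⟨⟨⟨⟨f1, f2⟩, f3⟩, f4⟩, hn1⟩ := hn₀ n hn
  simp only [pow_zero, mul_one, pow_one, one_mul] at f1 f2 f3 f4
  have hn1' : (1 : ℝ) ≤ n := by exact_mod_cast hn1
  have hn0 : (0 : ℝ) < n := by linarith
  have hpθ : p ≤ (n : ℝ) ^ (-(2 * θ)) := by
    refine hp.trans (le_of_eq ?_)
    congr 1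
    rw [hθ]; ring
  have hpow : ∀ j : ℕ, p ^ j ≤ (n : ℝ) ^ (-(2 * θ) * j) := by
    intro j
    rw [rpow_mul hn0.le, rpow_natCast]
    exact pow_le_pow_left₀ h0.le hpθ j
  have hT0 : 0 < (n : ℝ) ^ θ := by positivity
  have hθ1 : (n : ℝ) ^ (θ / 3) ≤ (n : ℝ) ^ θ := rpow_le_rpow_of_exponent_le hn1' (by linarith)
  refine key (T := (n : ℝ) ^ θ) h hn1 h0 ht hm hmt ?_ ?_ ?_ ?_ (f3.trans hθ1) ?_ hW
  · refine le_trans ?_ h.le_card_edges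
    rw [div_le_iff₀ ha] at f2
    have e5 : (n : ℝ) ^ (1 - 3 * θ) * ((n : ℝ) ^ θ) ^ 3 = n := by
      rw [← rpow_natCast, ← rpow_mul hn0.le, ← rpow_add hn0]
      have : 1 - 3 * θ + θ * (3 : ℕ) = 1 := by push_cast; ring
      rw [this, rpow_one]
    calc 6 * k ^ 3 * D ^ 3 * (2 * K * (n : ℝ) ^ θ) ^ 3 * n
        = 6 * k ^ 3 * D ^ 3 * (2 * K) ^ 3 * ((n : ℝ) ^ θ) ^ 3 * n := by ring
      _ ≤ (n : ℝ) ^ (1 - 3 * θ) * a * ((n : ℝ) ^ θ) ^ 3 * n := by gcongr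
      _ = a * ((n : ℝ) ^ (1 - 3 * θ) * ((n : ℝ) ^ θ) ^ 3) * n := by ring
      _ = a * n ^ 2 := by rw [e5]; ring
  · calc 2 * K * (n : ℝ) ^ θ * p ≤ (n : ℝ) ^ θ * (n : ℝ) ^ θ * (n : ℝ) ^ (-(2 * θ)) := by gcongr
      _ = 1 := by
        rw [← rpow_add hn0, ← rpow_add hn0]
        have : θ + θ + -(2 * θ) = 0 := by ring
        rw [this, rpow_zero]
  · calc n * p ^ (k - 1) ≤ (n : ℝ) ^ (1 : ℝ) * (n : ℝ) ^ (-(2 * θ) * (k - 1 : ℕ)) := by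
          rw [rpow_one]
          exact mul_le_mul_of_nonneg_left (hpow _) hn0.le
      _ = (n : ℝ) ^ (1 + -(2 * θ) * (k - 1 : ℕ)) := (rpow_add hn0 _ _).symm
      _ ≤ 1 := by
        apply rpow_le_one_of_one_le_of_nonpos hn1'
        rw [Nat.cast_sub (by omega)]
        push_cast
        nlinarith
  · calc m ≤ D ^ 3 * n ^ 2 * p ^ k := by
          rw [hm]
          exact mul_le_mul_of_nonneg_right (h.card_edges_le (by omega) hD0.le) (by positivity)
      _ ≤ (n : ℝ) ^ (θ / 3) * (n : ℝ) ^ (2 : ℝ) * (n : ℝ) ^ (-(2 * θ) * k) := by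
          have := hpow k
          rw [rpow_two]
          gcongr
      _ = (n : ℝ) ^ θ := by
          rw [← rpow_add hn0, ← rpow_add hn0]
          congr 1
          linarith
  · rw [sqrt_eq_rpow, ← rpow_mul hn0.le, mul_one_div]
    exact f4

lemma sq_mul_sq_le_of_rpow {m t x L : ℝ} (hm : 0 ≤ m) (hL : 0 ≤ L) (hx : m / 2 ≤ x)
    (ht : min (x ^ (2 / 3 : ℝ)) (m ^ (2 / 3 : ℝ)) * L ^ (2 / 3 : ℝ) ≤ t) :
    m ^ 2 * L ^ 2 ≤ 8 * t ^ 3 := by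
  have h1 : m ^ (2 / 3 : ℝ) / 2 * L ^ (2 / 3 : ℝ) ≤ t :=
    le_trans (mul_le_mul_of_nonneg_right (two_thirds_rpow_le hm hx) (by positivity)) ht
  have h2 := pow_le_pow_left₀ (by positivity) h1 3
  have e : ∀ y : ℝ, 0 ≤ y → (y ^ (2 / 3 : ℝ)) ^ 3 = y ^ 2 := by
    intro y hy
    rw [← rpow_natCast, ← rpow_mul hy, ← rpow_natCast]; norm_num
  rw [mul_pow, div_pow, e m hm, e L hL] at h2
  linarith

/-- With L = log n ≥ log(1/p), this says that under (ii) the clustering term is the smaller one up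
to a constant when q is bounded. For t ≤ m the hypothesis is t^(3/2) ≳ mL and log(1 + t/m) ≥ t/(2m);
for t ≥ m, L ≤ √t. -/
lemma sqrt_mul_le_rate {m t L : ℝ} (hm : 0 < m) (ht : 0 < t)
    (hmL : L ^ 2 ≤ m) (h : m ^ 2 * L ^ 2 ≤ 8 * t ^ 3) :
    √t * L ≤ 8 * (t * log (1 + t / m)) := by
  have hst : 0 < √t := sqrt_pos.2 ht
  have e : t = √t ^ 2 := (sq_sqrt ht.le).symm
  rcases le_total m t with hmt | hmt
  · have h1 : 1 / 2 ≤ log (1 + t / m) :=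
      half_le_log_of_one_le (x := t / m) (by rw [le_div_iff₀ hm]; linarith)
    have h2 : L ≤ √t := le_sqrt_of_sq_le (hmL.trans hmt)
    nlinarith
  · have h1 := half_le_log_one_add (x := t / m) (by positivity) (by rwa [div_le_one hm])
    have h2 : m * L ≤ 4 * √t ^ 3 := by
      refine le_of_pow_le_pow_left₀ two_ne_zero (by positivity) ?_
      calc (m * L) ^ 2 = m ^ 2 * L ^ 2 := by ring
        _ ≤ 8 * t ^ 3 := h
        _ ≤ 16 * t ^ 3 := by have : 0 < t ^ 3 := by positivity
                             linarith
        _ = (4 * √t ^ 3) ^ 2 := by nth_rw 1 [e]; ring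
    calc √t * L = √t * (m * L) / m := by field_simp
      _ ≤ √t * (4 * √t ^ 3) / m := by gcongr
      _ = 8 * (√t ^ 2 * (√t ^ 2 / m / 2)) := by ring
      _ = 8 * (t * (t / m / 2)) := by rw [← e]
      _ ≤ 8 * (t * log (1 + t / m)) := by gcongr

set_option maxHeartbeats 1000000 in
/-- The lower bound for densities at most `n ^ (-1 / (k - 1)) * log n` and large deviations. -/
theorem exists_le_prob_of_le_rpow_mul_log {k : ℕ} (hk : 3 ≤ k) {a D : ℝ} (ha : 0 < a)
    (hD : 1 ≤ D) : ∃ n₀ : ℕ, ∃ lam₀ : ℝ, ∀ lam : ℝ, lam₀ ≤ lam →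
      ∃ C > 0, ∃ d > 0, ∀ {α : Type*} [DecidableEq α] {V : Finset α}
      {E : Finset (Finset α)} {n : ℕ} {p t m x : ℝ}, DenseAlmostLinear V E k a D n → n₀ ≤ n →
      0 < p → 0 < t → m = #E * p ^ k → 1 ≤ m + t → m * (1 - p) ≤ x →
      min (x ^ (2 / 3 : ℝ)) (m ^ (2 / 3 : ℝ)) * log n ^ (2 / 3 : ℝ) ≤ t →
      p ≤ (n : ℝ) ^ (-1 / ((k : ℝ) - 1)) * log n →
      (n : ℝ) ^ (-2 / ((k : ℝ) + 1 / 3)) < p →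
      (∃ W ⊆ V, (#W : ℝ) ≤ D * max √(min (lam * t) (m + t)) 1 ∧
        min (lam * t) (m + t) ≤ count E W) →
      d * exp (-C * min (chernoffRate (t / m) * m ^ 2 / (m * (1 + n * p ^ (k - 1))))
          (√t * log (1 / p))) ≤ prob V p fun S => m + t ≤ count E S := by
  have hD0 : 0 < D := by linarith
  have hk3 : (3 : ℝ) ≤ k := by exact_mod_cast hk
  set θ : ℝ := 1 / (k + 1 / 3) with hθ
  have hθ0 : 0 < θ := by positivity
  have hθk : θ * k = 1 - θ / 3 := by rw [hθ]; field_simp; ring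
  have hθ3 : 3 * θ < 1 := by nlinarith
  have e1 := eventually_mul_log_pow_le (512 / a) (3 * (k - 1)) (show 0 < 2 * θ / 3 by positivity)
  have e2 := eventually_mul_log_pow_le 2 1 (show 0 < 1 / ((k : ℝ) - 1) from
    one_div_pos.2 (by linarith))
  obtain ⟨n₀, hn₀⟩ := Filter.eventually_atTop.1
    ((e1.and e2).and (Filter.eventually_ge_atTop 3))
  obtain ⟨lam₁, hlam₁⟩ := exists_le_prob_of_dense hk ha hD (γ := 1 / 4) (B := 1) (by norm_num)
    (by norm_num) le_rfl
  refine ⟨n₀, max lam₁ ((1 + √(2 * (k ^ 2 * D ^ 2) * 1)) / (1 / 2)), fun lam hlam => ?_⟩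
  obtain ⟨C₁, hC₁, d₁, hd₁, key⟩ := hlam₁ lam ((le_max_left _ _).trans hlam)
  set c₂ := D * (√lam + 1 / √(1 : ℝ)) with hc₂
  have hc₂0 : 0 < c₂ := by
    rw [hc₂, sqrt_one]
    positivity
  refine ⟨C₁ + 32 * c₂, by positivity, min d₁ (1 / 2), by positivity, ?_⟩
  intro α _ V E n p t m x h hn h0 ht hm hmt hx htx hp hpθ hW
  obtain ⟨⟨f1, f2⟩, hn3⟩ := hn₀ n hn
  rw [pow_one] at f2
  have hn3' : (3 : ℝ) ≤ n := by exact_mod_cast hn3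
  have hn0 : (0 : ℝ) < n := by linarith
  set L := log (n : ℝ) with hL
  have hL1 : 1 ≤ L := by
    rw [hL, le_log_iff_exp_le hn0]
    exact exp_one_lt_three.le.trans hn3'
  have hp2 : p ≤ 1 / 2 := by
    refine hp.trans ?_
    rw [neg_div, rpow_neg hn0.le, inv_mul_le_iff₀ (by positivity)]
    linarith
  have hp1 : p ≤ 1 := by linarith
  have hE0 : (0 : ℝ) < #E := lt_of_lt_of_le (by positivity) h.le_card_edges
  have hm0 : 0 < m := by rw [hm]; positivity
  have hq0 : 0 < n * p ^ (k - 1) := by positivity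
  have hma : 512 * L ^ (3 * (k - 1)) ≤ m := by
    have h1 : (n : ℝ) ^ (-(2 * θ) * k) ≤ p ^ k := by
      rw [rpow_mul hn0.le, rpow_natCast]
      refine pow_le_pow_left₀ (by positivity) (le_trans (le_of_eq ?_) hpθ.le) k
      congr 1
      rw [hθ]; ring
    rw [div_mul_eq_mul_div, div_le_iff₀ ha] at f1
    calc 512 * L ^ (3 * (k - 1)) ≤ (n : ℝ) ^ (2 * θ / 3) * a := f1
      _ = a * ((n : ℝ) ^ (2 : ℝ) * (n : ℝ) ^ (-(2 * θ) * k)) := by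
        rw [← rpow_add hn0, mul_comm]
        congr 2
        linarith
      _ ≤ a * (n ^ 2 * p ^ k) := by
        rw [rpow_two]
        gcongr
      _ ≤ m := by
        rw [hm, ← mul_assoc]
        exact mul_le_mul_of_nonneg_right h.le_card_edges (by positivity)
  have hLk : (1 : ℝ) ≤ L ^ (k - 1) := one_le_pow₀ hL1
  have hqL : n * p ^ (k - 1) ≤ L ^ (k - 1) := by
    calc n * p ^ (k - 1) ≤ n * ((n : ℝ) ^ (-1 / ((k : ℝ) - 1)) * L) ^ (k - 1) := by gcongr
      _ = L ^ (k - 1) := by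
        rw [mul_pow, ← rpow_natCast ((n : ℝ) ^ (-1 / ((k : ℝ) - 1))), ← rpow_mul hn0.le,
          Nat.cast_sub (by omega), Nat.cast_one, div_mul_cancel₀ _ (by linarith : (k : ℝ) - 1 ≠ 0),
          rpow_neg_one]
        field_simp
  have hF := sq_mul_sq_le_of_rpow hm0.le (by linarith) (x := x) (le_trans (by linarith [mul_le_mul_of_nonneg_left hp2 hm0.le]) hx) htx
  have hL2 : L ^ 2 ≤ m := by
    have : L ^ 2 ≤ L ^ (3 * (k - 1)) := pow_le_pow_right₀ hL1 (by omega)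
    linarith [pow_pos (zero_lt_one.trans_le hL1) (3 * (k - 1))]
  -- Condition (ii) gives t³ ≥ m²/8, so t² exceeds m by the factor m^(1/3)/4, and m is large enough
  -- for this to absorb 1 + q ≤ 2(log n)^(k-1).
  have hΛ : m * (1 + n * p ^ (k - 1)) ≤ 1 * t ^ 2 := by
    rw [one_mul]
    have h1 : m * (1 + n * p ^ (k - 1)) ≤ 2 * m * L ^ (k - 1) := by
      calc m * (1 + n * p ^ (k - 1)) ≤ m * (2 * L ^ (k - 1)) := by gcongr; linarith
        _ = _ := by ring
    refine h1.trans ?_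
    refine le_of_pow_le_pow_left₀ (n := 3) (by norm_num) (by positivity) ?_
    have h2 : m ^ 2 ≤ 8 * t ^ 3 := by
      refine le_trans ?_ hF
      exact le_mul_of_one_le_right (by positivity) (one_le_pow₀ hL1)
    have h3 : m ^ 4 ≤ 64 * t ^ 6 := by
      calc m ^ 4 = (m ^ 2) ^ 2 := by ring
        _ ≤ (8 * t ^ 3) ^ 2 := by gcongr
        _ = _ := by ring
    calc (2 * m * L ^ (k - 1)) ^ 3 = m ^ 3 * (512 * L ^ (3 * (k - 1))) / 64 := by
          rw [mul_comm 3, pow_mul]; ring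
      _ ≤ m ^ 3 * m / 64 := by gcongr
      _ ≤ (t ^ 2) ^ 3 := by linarith [show m ^ 3 * m = m ^ 4 by ring, show (t ^ 2) ^ 3 = t ^ 6 by ring]
  set R := chernoffRate (t / m) * m ^ 2 / (m * (1 + n * p ^ (k - 1))) with hR
  have hl0 : 0 ≤ log (1 + t / m) := log_nonneg (by
    have : 0 < t / m := by positivity
    linarith)
  have hRl := le_rate ht hm0 hq0.le
  have hR0 : 0 ≤ R := le_trans (by positivity) hRl
  have hlp : 0 ≤ √t * log (1 / p) := mul_nonneg (sqrt_nonneg _) (log_nonneg (one_le_one_div h0 hp1))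
  -- For q ≥ 1 the dense theorem applies; for q ≤ 1 clustering alone gives both terms.
  rcases le_total 1 (n * p ^ (k - 1)) with hq | hq
  · have h1 := key h (by omega) h0 (by linarith) ht hm
      (le_trans (pow_le_one₀ (by norm_num) (by norm_num)) hq) hmt hΛ hW
    refine le_trans ?_ h1
    have hmin : 0 ≤ min R (√t * log (1 / p)) := le_min hR0 hlp
    refine mul_le_mul (min_le_left _ _) (exp_le_exp.2 ?_) (exp_pos _).le hd₁.le
    linarith [mul_nonneg (show 0 ≤ 32 * c₂ by positivity) hmin]
  · have hm1 : 1 ≤ m := by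
      have : (1 : ℝ) ≤ L ^ 2 := one_le_pow₀ hL1
      linarith
    have ht1 : 1 ≤ t := by
      have : m ≤ t ^ 2 := by
        rw [one_mul] at hΛ
        exact le_trans (le_mul_of_one_le_right hm0.le (by linarith)) hΛ
      exact (one_le_sq_iff₀ ht.le).1 (hm1.trans this)
    have hclus : 1 / 2 * exp (-(c₂ * (√t * log (1 / p)))) ≤
        prob V p fun S => m + t ≤ count E S := by
      have := h.cluster_le_prob (by omega) hD h0 (γ := 1 / 2) (by norm_num) (by linarith)
        (B := 1) (by norm_num) (t₀ := 1) (by norm_num) ht1 (by rwa [← hm])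
        ((le_max_right _ _).trans hlam) (by rwa [← hm])
      rwa [← hm, neg_mul] at this
    have hlogp : log (1 / p) ≤ L := by
      refine log_le_log (by positivity) ?_
      rw [div_le_iff₀ h0]
      have h1 : (n : ℝ) ^ (-1 : ℝ) ≤ p := by
        refine le_trans (rpow_le_rpow_of_exponent_le (by linarith) ?_) hpθ.le
        rw [le_div_iff₀ (by linarith)]
        linarith
      rw [rpow_neg_one, inv_le_iff_one_le_mul₀ hn0] at h1
      linarith
    have hkap : √t * log (1 / p) ≤ 32 * R := by
      calc √t * log (1 / p) ≤ √t * L := by gcongr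
        _ ≤ 8 * (t * log (1 + t / m)) := sqrt_mul_le_rate hm0 ht hL2 hF
        _ = 32 * (t * log (1 + t / m) / 2 / 2) := by ring
        _ ≤ 32 * (t * log (1 + t / m) / 2 / (1 + n * p ^ (k - 1))) := by
          gcongr
          linarith
        _ ≤ 32 * R := by gcongr
    have hx : 1 / 2 * exp (-(32 * c₂ * R)) ≤ prob V p fun S => m + t ≤ count E S := by
      refine le_trans (mul_le_mul_of_nonneg_left (exp_le_exp.2 (neg_le_neg ?_)) (by norm_num)) hclus
      calc c₂ * (√t * log (1 / p)) ≤ c₂ * (32 * R) := by gcongr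
        _ = 32 * c₂ * R := by ring
    exact mul_exp_neg_min_le hx hclus (min_le_right _ _) (min_le_right _ _) (by positivity)
      (by linarith) (by linarith) hR0 hlp rfl

end BinomialSubset

/-! ### From hypergraphs and `setBernoulli` to finite sums. -/

namespace BinomialSubset

open Finset

variable {α : Type*} [Fintype α]

/-- The binomial random subset of a finite set as an instance of `setBernoulli`. -/
lemma integral_setBernoulli [DecidableEq α] (V : Finset α) (p : unitInterval) (g : Set α → ℝ) :
    ∫ W, g W ∂(setBernoulli (V : Set α) p) = expect V p fun S => g S := by
  classical
  rw [integral_fintype .of_finite, ← Fintype.finsetEquivSet.sum_comp, expect]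
  refine (sum_subset_zero_on_sdiff (subset_univ _) ?_ ?_).symm
  · intro S hS
    have hSV : ¬ S ⊆ V := by
      rw [mem_sdiff, mem_powerset] at hS; exact hS.2
    rw [Fintype.finsetEquivSet_apply, measureReal_def,
      setBernoulli_singleton_of_not_subset p (by exact_mod_cast hSV), ENNReal.toReal_zero, zero_smul]
  · intro S hS
    rw [mem_powerset] at hS
    rw [Fintype.finsetEquivSet_apply,
      setBernoulli_real_singleton p (by exact_mod_cast hS) (Set.toFinite _), Set.ncard_coe_finset,
      ← Finset.coe_sdiff, Set.ncard_coe_finset, smul_eq_mul, weight]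

lemma setBernoulli_real_eq_prob [DecidableEq α] (V : Finset α) (p : unitInterval) (A : Set α → Prop) :
    (setBernoulli (V : Set α) p).real {W | A W} = prob V p fun S => A S := by
  classical
  have h := integral_indicator_one (μ := setBernoulli (V : Set α) p)
    (s := {W | A W}) (Set.toFinite _).measurableSet
  rw [← h, integral_setBernoulli, prob]
  refine expect_congr fun S _ => ?_
  by_cases hS : A S <;> simp [hS]

/-- The vertex set of a hypergraph on a finite type. -/
noncomputable def vertices (H : Hypergraph α) : Finset α := (Set.toFinite V(H)).toFinset

open Classical in
/-- The edge set of a hypergraph on a finite type. -/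
noncomputable def edges (H : Hypergraph α) : Finset (Finset α) := {e | (e : Set α) ∈ E(H)}

variable (H : Hypergraph α)

lemma coe_vertices : (vertices H : Set α) = V(H) := Set.Finite.coe_toFinset _

variable {H} in
lemma mem_edges {e : Finset α} : e ∈ edges H ↔ (e : Set α) ∈ E(H) := by
  classical
  simp [edges]

lemma ncard_edgeSet_filter (P : Set α → Prop) (Q : Finset α → Prop) [DecidablePred Q]
    (hPQ : ∀ f, Q f ↔ P f) : {e | e ∈ E(H) ∧ P e}.ncard = #{f ∈ edges H | Q f} := by
  rw [← Set.ncard_coe_finset, ← Set.ncard_image_of_injective _ (Finset.coe_injective (α := α))]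
  congr 1
  ext e
  simp only [Set.mem_ofPred_eq, Set.mem_image, mem_coe, mem_filter, mem_edges, hPQ]
  constructor
  · rintro ⟨he, hP⟩
    refine ⟨(Set.toFinite e).toFinset, ?_, Set.Finite.coe_toFinset _⟩
    rw [Set.Finite.coe_toFinset]
    exact ⟨he, hP⟩
  · rintro ⟨f, hf, rfl⟩
    exact hf

lemma edgeCount_eq : H.edgeCount = #(edges H) := by
  have := ncard_edgeSet_filter H (fun _ => True) (fun _ => True) fun _ => Iff.rfl
  simpa [Hypergraph.edgeCount] using this

lemma edges_subset {e : Finset α} (he : e ∈ edges H) : e ⊆ vertices H := by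
  rw [← Finset.coe_subset, coe_vertices]
  exact H.subset_vertexSet_of_mem_edgeSet (mem_edges.1 he)

variable [DecidableEq α]

lemma inducedEdges_coe (S : Finset α) : H.inducedEdges S = count (edges H) S := by
  have := ncard_edgeSet_filter H (fun e => e ⊆ (S : Set α)) (fun e => e ⊆ S)
    fun e => Finset.coe_subset.symm
  rw [Hypergraph.inducedEdges, Hypergraph.edgeCount, count]
  exact_mod_cast this

lemma card_codegree_le {u v : α} (huv : u ≠ v) :
    #{e ∈ edges H | u ∈ e ∧ v ∈ e} ≤ H.maxDegree 2 := by
  by_cases h : u ∈ V(H) ∧ v ∈ V(H)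
  -- The number of edges bounds the set of codegrees, so the supremum does not take its default
  -- value 0.
  · refine le_csSup ⟨E(H).ncard, ?_⟩ ⟨{u, v}, ?_, Set.ncard_pair huv, ?_⟩
    · rintro m ⟨S, -, -, rfl⟩
      exact Set.ncard_le_ncard (fun f hf => hf.1) (Set.toFinite _)
    · rintro w (rfl | rfl)
      · exact h.1
      · exact h.2
    · refine (ncard_edgeSet_filter H (fun e => {u, v} ⊆ e) (fun e => u ∈ e ∧ v ∈ e)
        fun f => ?_).symm
      simp only [Set.insert_subset_iff, Set.singleton_subset_iff, mem_coe]
  · have : {e ∈ edges H | u ∈ e ∧ v ∈ e} = ∅ := by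
      rw [filter_eq_empty_iff]
      rintro e he ⟨hu, hv⟩
      have hs := H.subset_vertexSet_of_mem_edgeSet (mem_edges.1 he)
      exact h ⟨hs hu, hs hv⟩
    rw [this, card_empty]
    exact Nat.zero_le _

variable {H} {k n : ℕ} {a D : ℝ}

lemma denseAlmostLinear (hH : H.IsUniform k) (hV : (H.vertexCount : ℝ) ≤ D * n)
    (hE : a * (n : ℝ) ^ 2 ≤ H.edgeCount) (hΔ : (H.maxDegree 2 : ℝ) ≤ D) :
    DenseAlmostLinear (vertices H) (edges H) k a D n where
  subset _ he := edges_subset H he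
  card e he := by
    rw [← Set.ncard_coe_finset]
    exact hH _ (mem_edges.1 he)
  codegree u v huv := le_trans (by exact_mod_cast card_codegree_le H huv) hΔ
  card_vertices_le := by
    rwa [Hypergraph.vertexCount, ← coe_vertices, Set.ncard_coe_finset] at hV
  le_card_edges := by rwa [← edgeCount_eq]

lemma upperTail_eq (p : unitInterval) (s : ℝ) :
    H.upperTail p s = prob (vertices H) p fun S => s ≤ count (edges H) S := by
  rw [Hypergraph.upperTail, Hypergraph.randomVertexSet, ← coe_vertices,
    setBernoulli_real_eq_prob _ p fun W => s ≤ H.inducedEdges W]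
  simp only [inducedEdges_coe]

lemma meanEdges_eq (hH : H.IsUniform k) (p : unitInterval) :
    H.meanEdges p = #(edges H) * (p : ℝ) ^ k := by
  rw [Hypergraph.meanEdges, Hypergraph.randomVertexSet, ← coe_vertices, integral_setBernoulli]
  simp only [inducedEdges_coe]
  rw [expect_count fun e he => edges_subset H he, sum_congr rfl fun f hf => ?_, sum_const,
    nsmul_eq_mul]
  rw [← Set.ncard_coe_finset, hH _ (mem_edges.1 hf)]

lemma varEdges_eq (p : unitInterval) : H.varEdges p = expect (vertices H) p
    fun S => ((count (edges H) S : ℝ) - ∑ f ∈ edges H, (p : ℝ) ^ #f) ^ 2 := by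
  rw [Hypergraph.varEdges, Hypergraph.randomVertexSet, ← coe_vertices,
    variance_eq_integral (measurable_of_finite _).aemeasurable, integral_setBernoulli,
    integral_setBernoulli]
  simp only [inducedEdges_coe]
  rw [expect_count fun e he => edges_subset H he]

lemma exists_subset_of_clusterProperty {x : ℝ} (h : H.ClusterProperty D x) :
    ∃ W ⊆ vertices H, (#W : ℝ) ≤ D * max √x 1 ∧ x ≤ count (edges H) W := by
  obtain ⟨W, hW, hc, he⟩ := h
  have hfin : ((Set.toFinite W).toFinset : Set α) = W := Set.Finite.coe_toFinset _
  refine ⟨(Set.toFinite W).toFinset, ?_, ?_, ?_⟩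
  · rwa [← Finset.coe_subset, coe_vertices, hfin]
  · rwa [← Set.ncard_coe_finset, hfin]
  · rw [← inducedEdges_coe, hfin]; exact he

end BinomialSubset

/-! ### The conditions of the theorem and the final assembly. -/

namespace BinomialSubset

open Finset

lemma mul_exp_neg_le_of_le {d d' C C' z P : ℝ} (hd : d ≤ d') (hd0 : 0 ≤ d') (hC : C' ≤ C)
    (hz : 0 ≤ z) (h : d' * exp (-C' * z) ≤ P) : d * exp (-C * z) ≤ P := by
  refine (mul_le_mul hd (exp_le_exp.2 ?_) (exp_pos _).le hd0).trans h
  nlinarith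

/-- The condition on `t` in the dense range, in terms of `μ * (1 + n * p ^ (k - 1))`. -/
lemma DenseAlmostLinear.mean_mul_le_of_min_sqrt_le {α : Type*} [DecidableEq α] {V : Finset α}
    {E : Finset (Finset α)} {k n : ℕ} {a D γ p t m x : ℝ} (h : DenseAlmostLinear V E k a D n)
    (hk : 1 ≤ k) (ha : 0 < a) (hD : 0 < D) (hγ : 0 < γ) (hn : 1 ≤ n) (h0 : 0 < p)
    (h1 : p ≤ 1 - γ) (ht : 0 < t) (hm : m = #E * p ^ k)
    (hx : x = expect V p fun S => ((count E S : ℝ) - ∑ f ∈ E, p ^ #f) ^ 2)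
    (hmin : min √x √(m * (1 + n * p ^ (k - 1))) ≤ t) :
    m * (1 + n * p ^ (k - 1)) ≤ max 1 (2 / (γ * min 1 (a / D))) * t ^ 2 := by
  have hκ : 0 < min 1 (a / D) := lt_min one_pos (by positivity)
  have hΛ0 : 0 ≤ m * (1 + n * p ^ (k - 1)) := by rw [hm]; positivity
  rcases min_le_iff.1 hmin with hc | hc
  · have hv := h.le_variance hk hD hn h0.le (by linarith)
    rw [← hx, ← hm] at hv
    have h2 : γ * (min 1 (a / D) / 2) * (m * (1 + n * p ^ (k - 1))) ≤ t ^ 2 := by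
      refine le_trans (le_trans ?_ hv) ((sqrt_le_left ht.le).1 hc)
      gcongr
      linarith
    calc m * (1 + n * p ^ (k - 1))
        = 2 / (γ * min 1 (a / D)) * (γ * (min 1 (a / D) / 2) * (m * (1 + n * p ^ (k - 1)))) := by
          field_simp
      _ ≤ 2 / (γ * min 1 (a / D)) * t ^ 2 := mul_le_mul_of_nonneg_left h2 (by positivity)
      _ ≤ _ := mul_le_mul_of_nonneg_right (le_max_right _ _) (by positivity)
  · refine ((sqrt_le_left ht.le).1 hc).trans ?_
    exact le_mul_of_one_le_left (by positivity) (le_max_left _ _)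

lemma pow_le_mul_pow_of_rpow_le {k n : ℕ} (hk : 2 ≤ k) (hn : 1 ≤ n) {γ p : ℝ} (hγ : 0 < γ)
    (hp : γ * (n : ℝ) ^ (-1 / ((k : ℝ) - 1)) ≤ p) : γ ^ (k - 1) ≤ n * p ^ (k - 1) := by
  have hn0 : (0 : ℝ) < n := by exact_mod_cast hn
  have hk2 : (2 : ℝ) ≤ k := by exact_mod_cast hk
  calc γ ^ (k - 1) = n * (γ * (n : ℝ) ^ (-1 / ((k : ℝ) - 1))) ^ (k - 1) := by
        rw [mul_pow, ← rpow_natCast ((n : ℝ) ^ (-1 / ((k : ℝ) - 1))), ← rpow_mul hn0.le,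
          Nat.cast_sub (by omega), Nat.cast_one, div_mul_cancel₀ _ (by linarith : (k : ℝ) - 1 ≠ 0),
          rpow_neg_one]
        field_simp
    _ ≤ n * p ^ (k - 1) := by gcongr

end BinomialSubset

theorem mainTheorem2 (k : ℕ) (hk : 3 ≤ k) (a : ℝ) (ha : 0 < a) (D : ℝ) (hD : 1 ≤ D) :
    ∃ n₀ : ℕ, 0 < n₀ ∧ ∀ γ : ℝ, 0 < γ → γ < 1 →
      ∃ c C d lam : ℝ, 0 < c ∧ 0 < C ∧ 0 < d ∧ 1 ≤ lam ∧
        ∀ n : ℕ, n₀ ≤ n → ∀ (α : Type*) [Finite α] (H : Hypergraph α),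
          H.IsUniform k →
          (H.vertexCount : ℝ) ≤ D * n →
          a * (n : ℝ) ^ 2 ≤ (H.edgeCount : ℝ) →
          (H.maxDegree 2 : ℝ) ≤ D →
          ∀ p : unitInterval, 0 < (p : ℝ) → ∀ t : ℝ, 0 < t →
            let μ : ℝ := H.meanEdges p
            let V : ℝ := H.varEdges p
            let Λ : ℝ := μ * (1 + n * (p : ℝ) ^ (k - 1))
            -- upper bound, under one of (a), (b), (c)
            (((p : ℝ) ∉ Set.Ioo ((n : ℝ) ^ (-1 / ((k : ℝ) - 1) - γ))
                  (γ * (n : ℝ) ^ (-1 / ((k : ℝ) - 1)) * log n ^ (1 / ((k : ℝ) - 1))) ∨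
                γ * min (V ^ (2 / 3 : ℝ)) (μ ^ (2 / 3 : ℝ)) * log n ^ (4 / 3 : ℝ) ≤ t ∨
                μ * (p : ℝ) ^ (((k : ℝ) - 2) / 3 - γ) ≤ t) →
              H.upperTail p (μ + t) ≤
                (1 + (n : ℝ)⁻¹) *
                  exp (-c * min (chernoffRate (t / μ) * μ ^ 2 / Λ)
                    (√t * log (exp 1 / p)))) ∧
            -- lower bound, under one of (i), (ii), (iii)
            (((p : ℝ) ≤ (n : ℝ) ^ (-2 / ((k : ℝ) + 1 / 3)) ∨
                (min (V ^ (2 / 3 : ℝ)) (μ ^ (2 / 3 : ℝ)) * log n ^ (2 / 3 : ℝ) ≤ t ∧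
                  (p : ℝ) ≤ (n : ℝ) ^ (-1 / ((k : ℝ) - 1)) * log n) ∨
                (min (√V) (√Λ) ≤ t ∧
                  γ * (n : ℝ) ^ (-1 / ((k : ℝ) - 1)) ≤ (p : ℝ) ∧ (p : ℝ) ≤ 1 - γ)) →
              H.ClusterProperty D (min (lam * t) (μ + t)) →
              1 ≤ μ + t →
              d * exp (-C * min (chernoffRate (t / μ) * μ ^ 2 / Λ) (√t * log (1 / p))) ≤
                H.upperTail p (μ + t)) := by

  have hD0 : 0 < D := by linarith
  obtain ⟨n₁, lam₁, hlow₁⟩ := BinomialSubset.exists_le_prob_of_le_rpow hk ha hD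
  obtain ⟨n₂, lam₂, hlow₂⟩ := BinomialSubset.exists_le_prob_of_le_rpow_mul_log hk ha hD
  -- Only the lower bounds for (i) and (ii) need n large, and they do not involve γ; the upper bound
  -- and case (iii) hold for all n ≥ 1.
  refine ⟨max 1 (max n₁ n₂), by positivity, fun γ hγ hγ1 => ?_⟩
  obtain ⟨c, hc, hup⟩ := BinomialSubset.exists_prob_upper_tail_le hk ha hD hγ hγ1
  obtain ⟨lam₃, hlow₃⟩ := BinomialSubset.exists_le_prob_of_dense hk ha hD hγ hγ1
    (le_max_left 1 (2 / (γ * min 1 (a / D))))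
  -- The constants C and d depend on λ through the size of the cluster, so λ is fixed before they
  -- are obtained.
  set lam := max 1 (max lam₁ (max lam₂ lam₃)) with hlam
  obtain ⟨C₁, hC₁, d₁, hd₁, hlow₁⟩ := hlow₁ lam (by simp [hlam])
  obtain ⟨C₂, hC₂, d₂, hd₂, hlow₂⟩ := hlow₂ lam (by simp [hlam])
  obtain ⟨C₃, hC₃, d₃, hd₃, hlow₃⟩ := hlow₃ lam (by simp [hlam])
  refine ⟨c, C₁ + C₂ + C₃, min d₁ (min d₂ d₃), lam, hc, by positivity, by positivity,
    le_max_left _ _, ?_⟩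
  intro n hn α _ H hH hHV hHE hHΔ p h0 t ht
  classical
  have := Fintype.ofFinite α
  have hn1 : 1 ≤ n := (le_max_left _ _).trans hn
  have hnn₁ : n₁ ≤ n := (le_max_left _ _).trans ((le_max_right _ _).trans hn)
  have hnn₂ : n₂ ≤ n := (le_max_right _ _).trans ((le_max_right _ _).trans hn)
  have hn0 : (0 : ℝ) < n := by exact_mod_cast hn1
  have h := BinomialSubset.denseAlmostLinear hH hHV hHE hHΔ
  have hm := BinomialSubset.meanEdges_eq hH p
  have hx := BinomialSubset.varEdges_eq (H := H) p
  have hp1 : (p : ℝ) ≤ 1 := p.2.2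
  have hmx : H.meanEdges p * (1 - p) ≤ H.varEdges p := by
    rw [hm, hx]
    exact h.mean_mul_le_variance (by omega) h0.le hp1
  have hE0 : (0 : ℝ) < (BinomialSubset.edges H).card := lt_of_lt_of_le (by positivity) h.le_card_edges
  have hm0 : 0 < H.meanEdges p := by rw [hm]; positivity
  intro μ V Λ
  rw [BinomialSubset.upperTail_eq]
  refine ⟨fun hcond => hup h hn1 h0 hp1 ht hm hmx hcond, fun hcond hW hμt => ?_⟩
  have hW' := BinomialSubset.exists_subset_of_clusterProperty hW
  have hl0 : 0 ≤ log (1 + t / μ) := log_nonneg (by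
    have : 0 < t / μ := div_pos ht hm0
    linarith)
  have hz : 0 ≤ min (chernoffRate (t / μ) * μ ^ 2 / Λ) (√t * log (1 / p)) := by
    refine le_min ?_ (mul_nonneg (sqrt_nonneg _) (log_nonneg (one_le_one_div h0 hp1)))
    exact le_trans (by positivity) (BinomialSubset.le_rate ht hm0 (show 0 ≤ n * (p : ℝ) ^ (k - 1) by positivity))
  have low₁ : (p : ℝ) ≤ (n : ℝ) ^ (-2 / ((k : ℝ) + 1 / 3)) → _ := fun hp =>
    BinomialSubset.mul_exp_neg_le_of_le (min_le_left d₁ (min d₂ d₃)) hd₁.le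
      (show C₁ ≤ C₁ + C₂ + C₃ by linarith) hz (hlow₁ h hnn₁ h0 ht hm hμt hp hW')
  rcases hcond with hp | ⟨htV, hp⟩ | ⟨htV, hp, hpγ⟩
  · exact low₁ hp
  -- Below n^(-2/(k+1/3)) case (i) already covers (ii); above it μ is polynomially large, as the
  -- argument for (ii) requires.
  · rcases le_or_gt (p : ℝ) ((n : ℝ) ^ (-2 / ((k : ℝ) + 1 / 3))) with hp' | hp'
    · exact low₁ hp'
    · exact BinomialSubset.mul_exp_neg_le_of_le ((min_le_right _ _).trans (min_le_left _ _)) hd₂.le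
        (by linarith) hz (hlow₂ h hnn₂ h0 ht hm hμt hmx htV hp hp' hW')
  · exact BinomialSubset.mul_exp_neg_le_of_le ((min_le_right _ _).trans (min_le_right _ _)) hd₃.le
      (by linarith) hz (hlow₃ h hn1 h0 hpγ ht hm (BinomialSubset.pow_le_mul_pow_of_rpow_le (by omega) hn1 hγ hp)
        hμt (h.mean_mul_le_of_min_sqrt_le (by omega) ha hD0 hγ hn1 h0 hpγ ht hm hx htV) hW')
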